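/- Setting. Let $X=\{X_t\}_{t\ge 0}$ be a continuous-time Markov chain on a probability space $(\Omega,\mathcal F,P)$, right continuous with left limits (RCLL), whose state space is the set of unit vectors $e_1,\dots,e_N$ of $\mathbb R^N$, with measurable, bounded rate matrix $A_t$ ($A_{ij}(t)$ is the rate of jumping from $e_j$ to $e_i$). Let $\mathcal F_t=\sigma(X_s;\,s\le t)$, let $M_t=X_t-X_0-\int_0^tA_sX_s\,ds$ be the associated martingale, and put $$\Psi_t=\mathrm{diag}(A_tX_t)-\mathrm{diag}(X_t)A_t'-A_t\,\mathrm{diag}(X_t),\qquad \|z\|_{X_t}^2=z'\Psi_tz\quad(z\in\mathbb R^N).$$ $L^2_{\mathcal F}(a,b;\mathbb R)$ is the set of adapted RCLL processes $\phi$ on $[a,b]$ with $E\int_a^b|\phi_t|^2dt<\infty$; $H^2(a,b;\mathbb R^N)$ is the set of predictable processes $\phi$ on $[a,b]$ with $E\int_a^b\|\phi_t\|_{X_t}^2dt<\infty$. $L^2(\mathcal F_r;\mathbb R)$ is the set of square integrable $\mathcal F_r$-measurable random variables, and $H^2(\mathcal F_r;\mathbb R^N)$ is the set of $\mathcal F_r$-measurable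 $\mathbb R^N$-valued $\eta$ with $E\|\eta\|_{X_r}^2<\infty$. Let $T,K,L\ge 0$ and let $\delta,\zeta:[0,T]\to[0,\infty)$ be continuous such that (i) $s+\delta(s)\le T+K$ and $s+\zeta(s)\le T+K$ for all $s\in[0,T]$; (ii) for all $t\in[0,T]$ and all nonnegative integrable $g$, $\int_t^Tg(s+\delta(s))ds\le L\int_t^{T+K}g(s)ds$ and $\int_t^Tg(s+\zeta(s))ds\le L\int_t^{T+K}g(s)ds$. For $s\in[0,T]$ and $r,\bar r\in[s,T+K]$ let the driver be a map $$f(s,\cdot):\ \Omega\times\mathbb R\times\mathbb R^N\times L^2(\mathcal F_r;\mathbb R)\times H^2(\mathcal F_{\bar r};\mathbb R^N)\to L^2(\mathcal F_s;\mathbb R)$$ (it may depend on $r,\bar r$, which are suppressed in the notation and equal $s+\delta(s)$, $s+\zeta(s)$ in the equation and in $f(s,0,0,0,0)$), such that $f(s,Y_s,Z_s,Y_{s+\delta(s)},Z_{s+\zeta(s)})$ is jointly measurable in $(s,\omega)$ for all $Y\in L^2_{\mathcal F}(0,T+K;\mathbb R)$ and $Z\in H^2(0,T+K;\mathbb R^N)$.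 Assume, with constants $c_1,c_2>0$: (H1) for all $s\in[0,T]$, $r,\bar r\in[s,T+K]$, $\xi,\xi'\in L^2_{\mathcal F}(s,T+K;\mathbb R)$ and $\eta,\eta'\in H^2(s,T+K;\mathbb R^N)$ with $\xi_r,\xi'_r\in L^2(\mathcal F_r;\mathbb R)$ and $\eta_{\bar r},\eta'_{\bar r}\in H^2(\mathcal F_{\bar r};\mathbb R^N)$, almost surely, for all $y,y'\in\mathbb R$ and $z,z'\in\mathbb R^N$, $$|f(s,y,z,\xi_r,\eta_{\bar r})-f(s,y',z',\xi'_r,\eta'_{\bar r})|\le c_1\big(|y-y'|+E[|\xi_r-\xi'_r|\,|\,\mathcal F_s]\big)+c_2\big(\|z-z'\|_{X_s}+E[\|\eta_{\bar r}-\eta'_{\bar r}\|_{X_{\bar r}}\,|\,\mathcal F_s]\big);$$ (H2) $E\int_0^T|f(s,0,0,0,0)|^2ds<\infty$. Statement. There is a constant $C>0$ depending only on $c_1,c_2,L,K,T$ such that, for all $\xi\in L^2_{\mathcal F}(T,T+K;\mathbb R)$ and $\eta\in H^2(T,T+K;\mathbb R^N)$, every solution $(Y,Z)\in L^2_{\mathcal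 F}(0,T+K;\mathbb R)\times H^2(0,T+K;\mathbb R^N)$ of the anticipated BSDE $$Y_t=\xi_T+\int_t^Tf(s,Y_s,Z_s,Y_{s+\delta(s)},Z_{s+\zeta(s)})\,ds-\int_t^TZ_s'\,dM_s\quad(0\le t\le T),$$ $$Y_t=\xi_t,\quad Z_t=\eta_t\quad(T\le t\le T+K)$$ satisfies $$E\Big[\sup_{0\le s\le T}|Y_s|^2+\int_0^T\|Z_s\|_{X_s}^2ds\Big]\le C\,E\Big[|\xi_T|^2+\int_T^{T+K}\big(|\xi_s|^2+\|\eta_s\|_{X_s}^2\big)ds+\Big(\int_0^T|f(s,0,0,0,0)|ds\Big)^2\Big].$$ -/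

import Mathlib

open MeasureTheory ProbabilityTheory Filter Set
open scoped NNReal ENNReal Topology Matrix

universe u

noncomputable section

namespace AnticipatedBSDE

/-- Lebesgue measure on the time axis `[0, ∞)`. -/
instance nnrealMeasureSpace : MeasureSpace ℝ≥0 where
  volume := (volume : Measure ℝ).comap ((↑) : ℝ≥0 → ℝ)

/-- `g` is right continuous with left limits on the interval `[a, b]`. -/
def IsRCLLOn {E : Type*} [TopologicalSpace E] (g : ℝ≥0 → E) (a b : ℝ≥0) : Prop :=
  (∀ t ∈ Ico a b, ContinuousWithinAt g (Ici t) t) ∧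
    ∀ t ∈ Ioc a b, ∃ l, Tendsto g (𝓝[<] t) (𝓝 l)

/-- A continuous-time Markov chain on `(Ω, P)`, with respect to its own filtration, whose states
are the unit vectors of `ℝ^N` and whose rate matrix `A t` is bounded. Column convention:
`A t i j` is the rate of jumping from `e_j` to `e_i`. -/
structure MarkovChain (N : ℕ) {Ω : Type u} [MeasurableSpace Ω] (P : Measure Ω) where
  /-- the rate matrix -/
  A : ℝ≥0 → Matrix (Fin N) (Fin N) ℝ
  measurable_A : ∀ i j, Measurable fun t => A t i j
  bounded_A : ∃ m : ℝ, ∀ t i j, |A t i j| ≤ m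
  A_nonneg : ∀ t i j, i ≠ j → 0 ≤ A t i j
  A_sum : ∀ t j, ∑ i, A t i j = 0
  /-- the chain -/
  X : ℝ≥0 → Ω → Fin N → ℝ
  stronglyMeasurable_X : ∀ t, StronglyMeasurable (X t)
  X_unit : ∀ t ω, ∃ i, X t ω = Pi.single i 1
  rcll_X : ∀ ω b, IsRCLLOn (fun t => X t ω) 0 b
  /-- Markov property with transition matrices `Φ s t`, which solve Kolmogorov's forward equation
  `dΦ(s, t)/dt = A t * Φ(s, t)`, `Φ(s, s) = 1` (in integrated form). The `i`-th coordinate of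
  `X t` is the indicator of `{X t = e_i}`. -/
  markov : ∃ Φ : ℝ≥0 → ℝ≥0 → Matrix (Fin N) (Fin N) ℝ,
    (∀ s, ContinuousOn (Φ s) (Ici s)) ∧
    (∀ s t, s ≤ t → ∀ i j, Φ s t i j =
      (1 : Matrix (Fin N) (Fin N) ℝ) i j + ∫ r in Ioc s t, (A r * Φ s r) i j) ∧
    ∀ s t, s ≤ t → ∀ i,
      P[fun ω => X t ω i | Filtration.natural X stronglyMeasurable_X s]
        =ᵐ[P] fun ω => (Φ s t *ᵥ X s ω) i

variable {N : ℕ} {Ω : Type u} [MeasurableSpace Ω] {P : Measure Ω}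

namespace MarkovChain

/-- `ℱ t = σ(X s ; s ≤ t)`. -/
def filtration (S : MarkovChain N P) : Filtration ℝ≥0 (inferInstance : MeasurableSpace Ω) :=
  Filtration.natural S.X S.stronglyMeasurable_X

/-- `Ψ_t = diag(A_t X_t) - diag(X_t) A_t' - A_t diag(X_t)`, the density of `⟨X, X⟩`. -/
def Psi (S : MarkovChain N P) (t : ℝ≥0) (ω : Ω) : Matrix (Fin N) (Fin N) ℝ :=
  Matrix.diagonal (S.A t *ᵥ S.X t ω) - Matrix.diagonal (S.X t ω) * (S.A t)ᵀ
    - S.A t * Matrix.diagonal (S.X t ω)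

/-- `‖z‖²_{X_t} = z' Ψ_t z`. -/
def semiSq (S : MarkovChain N P) (t : ℝ≥0) (ω : Ω) (z : Fin N → ℝ) : ℝ :=
  z ⬝ᵥ (S.Psi t ω *ᵥ z)

/-- The seminorm `‖z‖_{X_t}`. -/
def semi (S : MarkovChain N P) (t : ℝ≥0) (ω : Ω) (z : Fin N → ℝ) : ℝ :=
  Real.sqrt (S.semiSq t ω z)

/-- The stochastic integral `∫_{(a, b]} Z_s' dM_s` with respect to the finite variation martingale
`M_t = X_t - X_0 - ∫_0^t A_s X_s ds`. The pure jump path `X` contributes the (finite) sum of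
`Z_s' ΔX_s` over its jump times, the absolutely continuous part contributes the Lebesgue integral
of `Z_s' A_s X_s`. -/
def stochInt (S : MarkovChain N P) (Z : ℝ≥0 → Ω → Fin N → ℝ) (a b : ℝ≥0) (ω : Ω) : ℝ :=
  (∑ᶠ (s : ℝ≥0) (_ : s ∈ Ioc a b),
      Z s ω ⬝ᵥ (S.X s ω - Function.leftLim (fun r => S.X r ω) s))
    - ∫ s in Ioc a b, Z s ω ⬝ᵥ (S.A s *ᵥ S.X s ω)

/-- `L²(ℱ_r; ℝ)`. -/
def MemL2At (S : MarkovChain N P) (r : ℝ≥0) (ξ : Ω → ℝ) : Prop :=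
  StronglyMeasurable[S.filtration r] ξ ∧ MemLp ξ 2 P

/-- `H²(ℱ_r; ℝ^N)`. -/
def MemH2At (S : MarkovChain N P) (r : ℝ≥0) (η : Ω → Fin N → ℝ) : Prop :=
  StronglyMeasurable[S.filtration r] η ∧
    ∫⁻ ω, ENNReal.ofReal (S.semiSq r ω (η ω)) ∂P < ∞

/-- `L²_ℱ(a, b; ℝ)`: adapted RCLL processes `φ` on `[a, b]` with `E ∫_a^b |φ_t|² dt < ∞`. Only the
values of `φ` on `[a, b]` matter. -/
def MemL2 (S : MarkovChain N P) (a b : ℝ≥0) (φ : ℝ≥0 → Ω → ℝ) : Prop :=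
  (∀ t ∈ Icc a b, StronglyMeasurable[S.filtration t] (φ t)) ∧
  (∀ᵐ ω ∂P, IsRCLLOn (fun t => φ t ω) a b) ∧
  ∫⁻ ω, (∫⁻ t in Icc a b, ENNReal.ofReal (|φ t ω| ^ 2)) ∂P < ∞

/-- `H²(a, b; ℝ^N)`: predictable processes `φ` on `[a, b]` with `E ∫_a^b ‖φ_t‖²_{X_t} dt < ∞`. Only
the values of `φ` on `[a, b]` matter. -/
def MemH2 (S : MarkovChain N P) (a b : ℝ≥0) (φ : ℝ≥0 → Ω → Fin N → ℝ) : Prop :=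
  IsStronglyPredictable S.filtration (fun t ω => (Icc a b).indicator (fun s => φ s ω) t) ∧
  ∫⁻ ω, (∫⁻ t in Icc a b, ENNReal.ofReal (S.semiSq t ω (φ t ω))) ∂P < ∞

end MarkovChain

/-- Condition (i): `δ` does not look beyond `T + K`. -/
def DelayBound (T K : ℝ≥0) (δ : ℝ≥0 → ℝ≥0) : Prop :=
  ∀ s ∈ Icc 0 T, s + δ s ≤ T + K

/-- Condition (ii): `∫_t^T g(s + δ(s)) ds ≤ L ∫_t^{T+K} g(s) ds` for `t ∈ [0, T]` and all
nonnegative integrable `g`. -/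
def DelayChange (T K L : ℝ≥0) (δ : ℝ≥0 → ℝ≥0) : Prop :=
  ∀ t ∈ Icc 0 T, ∀ g : ℝ≥0 → ℝ≥0, Measurable g → ∫⁻ s in Icc t (T + K), (g s : ℝ≥0∞) < ∞ →
    ∫⁻ s in Icc t T, (g (s + δ s) : ℝ≥0∞) ≤ L * ∫⁻ s in Icc t (T + K), (g s : ℝ≥0∞)

/-- Drivers. `f s r r' y z ξ η ω` is the value at `(s, ω)` of the driver on
`(y, z, ξ, η) ∈ ℝ × ℝ^N × L²(ℱ_r; ℝ) × H²(ℱ_r'; ℝ^N)`; the domain depends on the times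
`r, r' ∈ [s, T + K]`, so the driver is a family of maps indexed by them. -/
abbrev Driver (N : ℕ) (Ω : Type u) : Type u :=
  ℝ≥0 → ℝ≥0 → ℝ≥0 → ℝ → (Fin N → ℝ) → (Ω → ℝ) → (Ω → Fin N → ℝ) → Ω → ℝ

namespace Driver

/-- `f(s, Y_s, Z_s, Y_{s+δ(s)}, Z_{s+ζ(s)})`. -/
def along (f : Driver N Ω) (δ ζ : ℝ≥0 → ℝ≥0) (Y : ℝ≥0 → Ω → ℝ) (Z : ℝ≥0 → Ω → Fin N → ℝ)
    (s : ℝ≥0) (ω : Ω) : ℝ :=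
  f s (s + δ s) (s + ζ s) (Y s ω) (Z s ω) (Y (s + δ s)) (Z (s + ζ s)) ω

/-- `f(s, 0, 0, 0, 0)`. -/
def atZero (f : Driver N Ω) (δ ζ : ℝ≥0 → ℝ≥0) : ℝ≥0 → Ω → ℝ :=
  f.along δ ζ 0 0

/-- `f` takes values in `L²(ℱ_s; ℝ)`, and is jointly measurable in `(s, ω)` along all pairs of
processes in `L²_ℱ(0, T+K; ℝ) × H²(0, T+K; ℝ^N)`. -/
def IsAdmissible (f : Driver N Ω) (S : MarkovChain N P) (T K : ℝ≥0) (δ ζ : ℝ≥0 → ℝ≥0) : Prop :=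
  (∀ s ∈ Icc 0 T, ∀ r ∈ Icc s (T + K), ∀ r' ∈ Icc s (T + K), ∀ y z ξ η,
    S.MemL2At r ξ → S.MemH2At r' η → S.MemL2At s (f s r r' y z ξ η)) ∧
  ∀ Y Z, S.MemL2 0 (T + K) Y → S.MemH2 0 (T + K) Z →
    AEStronglyMeasurable (fun p : ℝ≥0 × Ω => f.along δ ζ Y Z p.1 p.2)
      ((volume.restrict (Icc 0 T)).prod P)

/-- Condition (H1), Lipschitz continuity. It is required at those times `r, r'` at which the
values of the processes lie in the domain of `f`. -/
def H1 (f : Driver N Ω) (S : MarkovChain N P) (T K : ℝ≥0) (c₁ c₂ : ℝ) : Prop :=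
  ∀ s ∈ Icc 0 T, ∀ r ∈ Icc s (T + K), ∀ r' ∈ Icc s (T + K),
    ∀ ξ ξ' : ℝ≥0 → Ω → ℝ, S.MemL2 s (T + K) ξ → S.MemL2 s (T + K) ξ' →
    S.MemL2At r (ξ r) → S.MemL2At r (ξ' r) →
    ∀ η η' : ℝ≥0 → Ω → Fin N → ℝ, S.MemH2 s (T + K) η → S.MemH2 s (T + K) η' →
    S.MemH2At r' (η r') → S.MemH2At r' (η' r') →
    ∀ᵐ ω ∂P, ∀ (y y' : ℝ) (z z' : Fin N → ℝ),
      |f s r r' y z (ξ r) (η r') ω - f s r r' y' z' (ξ' r) (η' r') ω| ≤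
        c₁ * (|y - y'| + P[fun ω' => |ξ r ω' - ξ' r ω'| | S.filtration s] ω) +
        c₂ * (S.semi s ω (z - z') +
          P[fun ω' => S.semi r' ω' (η r' ω' - η' r' ω') | S.filtration s] ω)

/-- Condition (H2): `E ∫_0^T |f(s, 0, 0, 0, 0)|² ds < ∞`. -/
def H2 (f : Driver N Ω) (P : Measure Ω) (T : ℝ≥0) (δ ζ : ℝ≥0 → ℝ≥0) : Prop :=
  ∫⁻ ω, (∫⁻ s in Icc 0 T, ENNReal.ofReal (|f.atZero δ ζ s ω| ^ 2)) ∂P < ∞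

end Driver

/-- `(Y, Z)` solves the anticipated BSDE with driver `f` and terminal conditions `ξ, η`. -/
structure IsSolution (S : MarkovChain N P) (T K : ℝ≥0) (δ ζ : ℝ≥0 → ℝ≥0) (f : Driver N Ω)
    (ξ : ℝ≥0 → Ω → ℝ) (η : ℝ≥0 → Ω → Fin N → ℝ)
    (Y : ℝ≥0 → Ω → ℝ) (Z : ℝ≥0 → Ω → Fin N → ℝ) : Prop where
  memL2 : S.MemL2 0 (T + K) Y
  memH2 : S.MemH2 0 (T + K) Z
  equation : ∀ᵐ ω ∂P, ∀ t ∈ Icc 0 T,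
    Y t ω = ξ T ω + (∫ s in Ioc t T, f.along δ ζ Y Z s ω) - S.stochInt Z t T ω
  terminal_Y : ∀ᵐ ω ∂P, ∀ t ∈ Icc T (T + K), Y t ω = ξ t ω
  terminal_Z : ∀ᵐ ω ∂P, ∀ t ∈ Icc T (T + K), Z t ω = η t ω

end AnticipatedBSDE

end

/-!
The proof has two halves: a stochastic calculus for the chain, built by hand from the Markov
property, and an energy argument for the equation.

*The chain.* A path has finitely many jumps in bounded time, since its states are isolated points
(`IsStepPath.finite_jumps`), and in fact the expected number of jumps is finite
(`MarkovChain.lintegral_card_jumpTimes_lt_top`). Hence the expected number of jump times `s` with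
`(s, ω) ∈ B` is a finite measure in `B`. Kolmogorov's equation makes `M = X - X_0 - ∫ A X` a
martingale (`MarkovChain.setIntegral_X_sub`). This says that the measure of the jumps and its
compensator agree on the sets `(u, ∞) × F` with `F ∈ ℱ_u`, so they agree on the predictable
`σ`-algebra (`MarkovChain.setLIntegral_jump`). For predictable `Z` the compensation formula
`MarkovChain.lintegral_sum_jumpTimes` follows, and it contains all the stochastic integration that
is needed: the expectation of `∑ (Z' ΔX)²` is that of `∫ ‖Z‖²_X ds`
(`MarkovChain.lintegral_sum_sq_jumpOf`), and `∫ H Z' dM` has mean zero as soon as `E ∫ |H| ‖Z‖_X ds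
< ∞` (`MarkovChain.integral_sum_mul_jumpOf`). No localization is required, because stochastic
integrals are finite sums plus Lebesgue integrals.

*The energy argument.* Along a solution, the driver is some square integrable process `F`, and `Y`
is the sum of an absolutely continuous path and finitely many jumps. For such paths Itô's formula
for the square is elementary (`IsJumpPath.sq`). Taking expectations bounds `E|Y_t|² + E ∫_t^T
‖Z‖²_X ds` by `E|Y_T|² + 2 E ∫_t^T |Y| |F| ds` (`IsLinearSolution.energy`). Let `F₀` be the driver
at zero. By the Lipschitz condition, Jensen's inequality for the conditional expectations and the
change of variables bound for the delays, the mean square of `F - F₀` over `[t, T]` is controlled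
by the second moments of `Y` and `Z` over `[t, T]` and over the terminal interval `[T, T + K]`
(`lintegral_sq_driver_sub_le`). Young's inequality with a small parameter leaves half of the
`Z`-term on the left, and Grönwall's inequality (`exists_gronwall`) bounds the second moments of
`(Y, Z)` by the data and by `e = E ∫ |Y| |F₀| ds`.

The data contain `F₀` only through `d = E (∫ |F₀| ds)²`, so `e` is estimated by `l E sup |Y|² + d /
l`. The supremum is in turn controlled by Doob's inequality (`lintegral_iSup_sq_le`): `Y_t` is the
conditional expectation of `Y_T + ∫_t^T F ds`, so `|Y|` is dominated by the martingale closed by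
`|Y_T| + ∫_0^T |F| ds`. Choosing `l` small lets `e` be absorbed (`exists_const_of_system`), which
gives the estimate with a constant that depends only on the Lipschitz constants, `L` and `T`
(`IsLinearSolution.exists_const`).
-/

noncomputable section

/-! ### Lebesgue measure on the time axis and Itô's formula for jump paths -/

namespace AnticipatedBSDE

theorem measurableEmbedding_nnreal_coe : MeasurableEmbedding ((↑) : ℝ≥0 → ℝ) :=
  MeasurableEmbedding.subtype_coe measurableSet_Ici

theorem volume_nnreal_apply (s : Set ℝ≥0) :
    (volume : Measure ℝ≥0) s = (volume : Measure ℝ) ((↑) '' s) :=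
  measurableEmbedding_nnreal_coe.comap_apply _ _

theorem image_coe_Icc_nnreal (a b : ℝ≥0) : ((↑) : ℝ≥0 → ℝ) '' Icc a b = Icc (a : ℝ) b := by
  ext x
  constructor
  · rintro ⟨y, hy, rfl⟩
    exact ⟨NNReal.coe_le_coe.2 hy.1, NNReal.coe_le_coe.2 hy.2⟩
  · intro hx
    exact ⟨⟨x, a.2.trans hx.1⟩, ⟨NNReal.coe_le_coe.1 hx.1, NNReal.coe_le_coe.1 hx.2⟩, rfl⟩

theorem volume_nnreal_Icc (a b : ℝ≥0) :
    (volume : Measure ℝ≥0) (Icc a b) = ENNReal.ofReal ((b : ℝ) - a) := by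
  rw [volume_nnreal_apply, image_coe_Icc_nnreal, Real.volume_Icc]

instance nullSingletonClass_volume_nnreal : NullSingletonClass (volume : Measure ℝ≥0) :=
  ⟨fun x => by rw [volume_nnreal_apply]; simp⟩

instance isLocallyFiniteMeasure_volume_nnreal :
    IsLocallyFiniteMeasure (volume : Measure ℝ≥0) :=
  ⟨fun x => ⟨Iio (x + 1), Iio_mem_nhds (by simp), by
    have h : Iio (x + 1) ⊆ Icc 0 (x + 1) := fun y hy => ⟨zero_le, hy.le⟩
    refine (measure_mono h).trans_lt ?_
    rw [volume_nnreal_Icc]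
    exact ENNReal.ofReal_lt_top⟩⟩

theorem volume_nnreal_Ioc (a b : ℝ≥0) :
    (volume : Measure ℝ≥0) (Ioc a b) = ENNReal.ofReal ((b : ℝ) - a) := by
  rw [← volume_nnreal_Icc]
  exact measure_congr Ioc_ae_eq_Icc

instance isFiniteMeasure_restrict_Icc_nnreal (a b : ℝ≥0) :
    IsFiniteMeasure ((volume : Measure ℝ≥0).restrict (Icc a b)) :=
  ⟨by rw [Measure.restrict_apply_univ, volume_nnreal_Icc]; exact ENNReal.ofReal_lt_top⟩

instance isFiniteMeasure_restrict_Ioc_nnreal (a b : ℝ≥0) :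
    IsFiniteMeasure ((volume : Measure ℝ≥0).restrict (Ioc a b)) :=
  ⟨by rw [Measure.restrict_apply_univ, volume_nnreal_Ioc]; exact ENNReal.ofReal_lt_top⟩

/-- The primitive `r ↦ ∫_r^T g` is left continuous, by dominated convergence. -/
theorem tendsto_setIntegral_Ioc_left {g : ℝ≥0 → ℝ} {s T : ℝ≥0}
    (hg : IntegrableOn g (Ioc 0 T)) :
    Tendsto (fun r => ∫ x in Ioc r T, g x) (𝓝[<] s) (𝓝 (∫ x in Ioc s T, g x)) := by
  have h : ∀ r, ∫ x in Ioc r T, g x = ∫ x in Ioc 0 T, (Ioi r).indicator g x := by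
    intro r
    rw [setIntegral_indicator measurableSet_Ioi]
    congr 2
    ext x
    exact ⟨fun hx => ⟨⟨pos_of_gt hx.1, hx.2⟩, hx.1⟩, fun hx => ⟨hx.2, hx.1.2⟩⟩
  simp_rw [h]
  refine tendsto_integral_filter_of_dominated_convergence (fun x => ‖g x‖) ?_ ?_ hg.norm ?_
  · exact Eventually.of_forall fun r =>
      hg.aestronglyMeasurable.indicator measurableSet_Ioi
  · exact Eventually.of_forall fun r => Eventually.of_forall fun x =>
      norm_indicator_le_norm_self _ _
  · have h0 : ∀ᵐ x ∂((volume : Measure ℝ≥0).restrict (Ioc 0 T)), x ≠ s :=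
      ae_restrict_of_ae (by simp [ae_iff])
    filter_upwards [h0] with x hx
    rcases lt_or_gt_of_ne hx with hx | hx
    · refine tendsto_const_nhds.congr' ?_
      filter_upwards [Ioo_mem_nhdsLT hx] with r hr
      rw [indicator_of_notMem, indicator_of_notMem]
      · exact not_lt.2 hr.1.le
      · exact not_lt.2 hx.le
    · refine tendsto_const_nhds.congr' ?_
      filter_upwards [self_mem_nhdsWithin] with r hr
      rw [indicator_of_mem, indicator_of_mem]
      · exact (lt_trans hr hx : r < x)
      · exact hx

/-- `(∫_t^T g)² = 2 ∫_t^T g(r) (∫_r^T g) dr`, by Fubini. -/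
theorem sq_setIntegral_Ioc {g : ℝ≥0 → ℝ} {t T : ℝ≥0} (hg : IntegrableOn g (Ioc t T)) :
    IntegrableOn (fun r => g r * ∫ x in Ioc r T, g x) (Ioc t T) ∧
    (∫ x in Ioc t T, g x) ^ 2 = 2 * ∫ r in Ioc t T, g r * ∫ x in Ioc r T, g x := by
  set ν := (volume : Measure ℝ≥0).restrict (Ioc t T) with hν
  have hg' : Integrable g ν := hg
  have hprod : Integrable (fun p : ℝ≥0 × ℝ≥0 => g p.1 * g p.2) (ν.prod ν) := hg'.mul_prod hg'
  have hms : MeasurableSet {p : ℝ≥0 × ℝ≥0 | p.1 < p.2} :=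
    measurableSet_lt measurable_fst measurable_snd
  have h1 : ∀ r ∈ Ioc t T, ∫ x in Ioc r T, g x = ∫ x, (Ioi r).indicator g x ∂ν := by
    intro r hr
    rw [hν, setIntegral_indicator measurableSet_Ioi]
    congr 2
    ext x
    exact ⟨fun hx => ⟨⟨hr.1.trans hx.1, hx.2⟩, hx.1⟩, fun hx => ⟨hx.2, hx.1.2⟩⟩
  have h2 : ∀ r, ∫ x, g x ∂ν = (∫ x, (Ioi r).indicator g x ∂ν) + ∫ x, (Iio r).indicator g x ∂ν := by
    intro r
    rw [← integral_add (hg'.indicator measurableSet_Ioi) (hg'.indicator measurableSet_Iio)]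
    refine integral_congr_ae ?_
    have h0 : ∀ᵐ x ∂ν, x ≠ r := ae_restrict_of_ae (by simp [ae_iff])
    filter_upwards [h0] with x hx
    rcases lt_or_gt_of_ne hx with hx | hx
    · simp [indicator, hx, hx.le]
    · simp [indicator, hx, hx.le]
  have h3 : ∫ r in Ioc t T, g r * ∫ x in Ioc r T, g x
      = ∫ r, ∫ x, ({p : ℝ≥0 × ℝ≥0 | p.1 < p.2}.indicator
          (fun p => g p.1 * g p.2)) (r, x) ∂ν ∂ν := by
    refine setIntegral_congr_fun measurableSet_Ioc fun r hr => ?_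
    rw [h1 r hr, ← integral_const_mul]
    refine integral_congr_ae (Eventually.of_forall fun x => ?_)
    by_cases hx : r < x <;> simp [indicator, hx]
  -- the triangles below and above the diagonal contribute the same amount
  have h4 : ∫ r, g r * (∫ x, (Iio r).indicator g x ∂ν) ∂ν
      = ∫ r in Ioc t T, g r * ∫ x in Ioc r T, g x := by
    rw [h3, integral_integral_swap (f := fun r x =>
      ({p : ℝ≥0 × ℝ≥0 | p.1 < p.2}.indicator (fun p => g p.1 * g p.2)) (r, x))
      (hprod.indicator hms)]
    refine integral_congr_ae (Eventually.of_forall fun r => ?_)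
    simp only
    rw [← integral_const_mul]
    refine integral_congr_ae (Eventually.of_forall fun x => ?_)
    by_cases hx : x < r <;> simp [indicator, hx, mul_comm]
  have h5 : ∫ r, g r * (∫ x, (Ioi r).indicator g x ∂ν) ∂ν
      = ∫ r in Ioc t T, g r * ∫ x in Ioc r T, g x :=
    (setIntegral_congr_fun measurableSet_Ioc fun r hr => by rw [h1 r hr])
  have i5 : Integrable (fun r => g r * (∫ x, (Ioi r).indicator g x ∂ν)) ν := by
    have := (hprod.indicator hms).integral_prod_left
    refine this.congr (Eventually.of_forall fun r => ?_)
    simp only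
    rw [← integral_const_mul]
    refine integral_congr_ae (Eventually.of_forall fun x => ?_)
    by_cases hx : r < x <;> simp [indicator, hx]
  have i4 : Integrable (fun r => g r * (∫ x, (Iio r).indicator g x ∂ν)) ν := by
    have := (hprod.indicator hms).integral_prod_right
    refine this.congr (Eventually.of_forall fun r => ?_)
    simp only
    rw [← integral_const_mul]
    refine integral_congr_ae (Eventually.of_forall fun x => ?_)
    by_cases hx : x < r <;> simp [indicator, hx, mul_comm]
  refine ⟨Integrable.congr i5 ?_, ?_⟩
  · filter_upwards [ae_restrict_mem measurableSet_Ioc] with r hr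
    rw [h1 r hr]
  calc (∫ x in Ioc t T, g x) ^ 2 = ∫ r, g r * (∫ x, g x ∂ν) ∂ν := by
        rw [integral_mul_const, sq]
    _ = ∫ r, (g r * (∫ x, (Ioi r).indicator g x ∂ν) + g r * ∫ x, (Iio r).indicator g x ∂ν) ∂ν :=
        integral_congr_ae (Eventually.of_forall fun r => by simp only; rw [h2 r, mul_add])
    _ = _ := by rw [integral_add i5 i4, h4, h5]; ring

/-- The jump part of Itô's formula: the square of a sum, with the mixed products ordered by time. -/
theorem sq_sum_eq_sum_sq_add {E : Finset ℝ≥0} (J : ℝ≥0 → ℝ) :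
    (∑ s ∈ E, J s) ^ 2 = ∑ s ∈ E, J s ^ 2 + 2 * ∑ s ∈ E, J s * ∑ r ∈ E with s < r, J r := by
  induction E using Finset.induction_on_max with
  | empty => simp
  | insert a E hE ih =>
    have ha : a ∉ E := fun h => lt_irrefl _ (hE a h)
    have h1 : (insert a E).filter (fun r => a < r) = ∅ := by
      refine Finset.filter_eq_empty_iff.2 fun r hr => ?_
      rcases Finset.mem_insert.1 hr with rfl | hr
      · exact lt_irrefl _
      · exact (hE r hr).le.not_gt
    have h2 : ∀ s ∈ E, ∑ r ∈ insert a E with s < r, J r = J a + ∑ r ∈ E with s < r, J r := by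
      intro s hs
      rw [Finset.filter_insert, if_pos (hE s hs), Finset.sum_insert (by simp [ha])]
    have h3 : ∑ s ∈ E, J s * ∑ r ∈ insert a E with s < r, J r =
        (∑ s ∈ E, J s) * J a + ∑ s ∈ E, J s * ∑ r ∈ E with s < r, J r := by
      rw [Finset.sum_mul, ← Finset.sum_add_distrib]
      exact Finset.sum_congr rfl fun s hs => by rw [h2 s hs, mul_add]
    rw [Finset.sum_insert ha, Finset.sum_insert ha, Finset.sum_insert ha, h1, Finset.sum_empty,
      h3, add_sq, ih]
    ring

/-- A path which is the sum of an absolutely continuous part and finitely many jumps `J s` at the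
times `s ∈ D`, written backwards from the terminal time. -/
def IsJumpPath (y : ℝ≥0 → ℝ) (c : ℝ) (g J : ℝ≥0 → ℝ) (D : Finset ℝ≥0) (T : ℝ≥0) : Prop :=
  ∀ t ≤ T, y t = c + (∫ r in Ioc t T, g r) - ∑ s ∈ D with t < s, J s

/-- The left limit of a jump path is `y s - J s` at the jump times, and `y s` elsewhere. -/
theorem IsJumpPath.tendsto_left {y : ℝ≥0 → ℝ} {c : ℝ} {g J : ℝ≥0 → ℝ} {D : Finset ℝ≥0} {T : ℝ≥0}
    (h : IsJumpPath y c g J D T) (hg : IntegrableOn g (Ioc 0 T)) {s : ℝ≥0} (hs : s ≤ T) :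
    Tendsto y (𝓝[<] s) (𝓝 (y s - if s ∈ D then J s else 0)) := by
  have h1 : Tendsto (fun r => ∑ q ∈ D with r < q, J q) (𝓝[<] s)
      (𝓝 (∑ q ∈ D with s < q, J q + if s ∈ D then J s else 0)) := by
    refine tendsto_const_nhds.congr' ?_
    have h2 : ∀ᶠ r in 𝓝[<] s, ∀ q ∈ D, q < s → q < r := by
      rw [eventually_all_finset]
      intro q _
      by_cases hq : q < s
      · filter_upwards [Ioo_mem_nhdsLT hq] with r hr _ using hr.1
      · exact Eventually.of_forall fun r h => absurd h hq
    filter_upwards [h2, self_mem_nhdsWithin] with r hr (hrs : r < s)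
    have h3 : D.filter (fun q => r < q) = D.filter (fun q => s ≤ q) := by
      refine Finset.filter_congr fun q hq => ⟨fun h => ?_, fun h => hrs.trans_le h⟩
      by_contra h'
      exact absurd h (hr q hq (not_le.1 h')).not_gt
    have h4 : D.filter (fun q => s ≤ q) =
        D.filter (fun q => s < q) ∪ D.filter (fun q => q = s) := by
      ext q
      simp only [Finset.mem_filter, Finset.mem_union, le_iff_lt_or_eq, eq_comm (a := q)]
      tauto
    rw [h3, h4, Finset.sum_union, Finset.sum_filter (p := fun q => q = s),
      Finset.sum_ite_eq' D s]
    rw [Finset.disjoint_filter]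
    rintro q _ h rfl
    exact lt_irrefl _ h
  have h5 := ((tendsto_setIntegral_Ioc_left (s := s) hg).const_add c).sub h1
  rw [h s hs]
  have h6 : c + (∫ r in Ioc s T, g r) - (∑ q ∈ D with s < q, J q + if s ∈ D then J s else 0)
      = (c + (∫ r in Ioc s T, g r) - ∑ q ∈ D with s < q, J q) - if s ∈ D then J s else 0 := by
    ring
  rw [← h6]
  refine h5.congr' ?_
  filter_upwards [self_mem_nhdsWithin] with r (hr : r < s)
  rw [h r (hr.le.trans hs)]

/-- Itô's formula for the square of a jump path. In the last sum `y s - J s` is the left limit of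
`y` at the jump time `s`. -/
theorem IsJumpPath.sq {y : ℝ≥0 → ℝ} {c : ℝ} {g J : ℝ≥0 → ℝ} {D : Finset ℝ≥0} {T : ℝ≥0}
    (h : IsJumpPath y c g J D T) (hg : IntegrableOn g (Ioc 0 T)) (hD : ∀ s ∈ D, s ≤ T)
    {t : ℝ≥0} (ht : t ≤ T) :
    y t ^ 2 + ∑ s ∈ D with t < s, J s ^ 2 =
      c ^ 2 + 2 * (∫ r in Ioc t T, y r * g r) - 2 * ∑ s ∈ D with t < s, (y s - J s) * J s := by
  have hg' : ∀ t, IntegrableOn g (Ioc t T) := fun t => hg.mono_set (Ioc_subset_Ioc_left zero_le)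
  set E := D.filter (fun s => t < s) with hE
  obtain ⟨hu1, hu2⟩ := sq_setIntegral_Ioc (hg' t)
  have hv : ∀ s ∈ E, ∑ r ∈ D with s < r, J r = ∑ r ∈ E with s < r, J r := by
    intro s hs
    refine Finset.sum_congr ?_ fun _ _ => rfl
    ext r
    simp only [hE, Finset.mem_filter] at hs ⊢
    exact ⟨fun h => ⟨⟨h.1, hs.2.trans h.2⟩, h.2⟩, fun h => ⟨h.1.1, h.2⟩⟩
  -- the contribution of a jump at `s` to `∫ y g`
  have hj : ∀ s ∈ D, ∫ r in Ioc t T, (Iio s).indicator g r =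
      if t < s then (∫ r in Ioc t T, g r) - ∫ r in Ioc s T, g r else 0 := by
    intro s hs
    rw [setIntegral_indicator measurableSet_Iio]
    split_ifs with hts
    · have h1 : Ioc t T ∩ Iio s = Ioo t s := by
        ext r
        exact ⟨fun h => ⟨h.1.1, h.2⟩, fun h => ⟨⟨h.1, h.2.le.trans (hD s hs)⟩, h.2⟩⟩
      have h2 : Ioc t T = Ioc t s ∪ Ioc s T := (Ioc_union_Ioc_eq_Ioc hts.le (hD s hs)).symm
      have h3 : ∫ r in Ioc t T, g r = (∫ r in Ioc t s, g r) + ∫ r in Ioc s T, g r := by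
        rw [h2]
        refine setIntegral_union (Ioc_disjoint_Ioc_of_le le_rfl) measurableSet_Ioc ?_ (hg' s)
        exact (hg' t).mono_set (Ioc_subset_Ioc_right (hD s hs))
      rw [h1, h3, setIntegral_congr_set Ioo_ae_eq_Ioc]
      ring
    · have h1 : Ioc t T ∩ Iio s = ∅ := by
        ext r
        simp only [mem_inter_iff, mem_Ioc, mem_Iio, mem_empty_iff_false, iff_false, not_and, not_lt]
        exact fun h => (not_lt.1 hts).trans h.1.le
      rw [h1, setIntegral_empty]
  have hint : ∫ r in Ioc t T, y r * g r = c * (∫ r in Ioc t T, g r) +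
      (∫ r in Ioc t T, g r * ∫ x in Ioc r T, g x) -
      ∑ s ∈ E, J s * ((∫ r in Ioc t T, g r) - ∫ r in Ioc s T, g r) := by
    have h1 : ∀ r ∈ Ioc t T, y r * g r = c * g r + (g r * ∫ x in Ioc r T, g x) -
        ∑ s ∈ D, J s * (Iio s).indicator g r := by
      intro r hr
      have : ∑ s ∈ D, J s * (Iio s).indicator g r = (∑ s ∈ D with r < s, J s) * g r := by
        rw [Finset.sum_filter, Finset.sum_mul]
        refine Finset.sum_congr rfl fun s _ => ?_
        by_cases hs : r < s <;> simp [hs]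
      rw [h r hr.2, this]
      ring
    have i1 : ∀ s, IntegrableOn (fun r => J s * (Iio s).indicator g r) (Ioc t T) := fun s =>
      ((hg' t).indicator measurableSet_Iio).const_mul _
    rw [setIntegral_congr_fun measurableSet_Ioc h1, integral_sub, integral_add, integral_const_mul,
      integral_finsetSum]
    · congr 1
      rw [hE, Finset.sum_filter]
      refine Finset.sum_congr rfl fun s hs => ?_
      rw [integral_const_mul, hj s hs, mul_ite, mul_zero]
    · exact fun s _ => i1 s
    · exact (hg' t).const_mul c
    · exact hu1
    · exact ((hg' t).const_mul c).add hu1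
    · exact integrable_finsetSum _ fun s _ => i1 s
  have hyE : ∑ s ∈ E, (y s - J s) * J s =
      c * ∑ s ∈ E, J s + ∑ s ∈ E, J s * (∫ r in Ioc s T, g r) -
        ∑ s ∈ E, J s * (∑ r ∈ E with s < r, J r) - ∑ s ∈ E, J s ^ 2 := by
    rw [Finset.mul_sum, ← Finset.sum_add_distrib, ← Finset.sum_sub_distrib,
      ← Finset.sum_sub_distrib]
    refine Finset.sum_congr rfl fun s hs => ?_
    rw [h s (hD s (Finset.mem_filter.1 hs).1), hv s hs]
    ring
  have hE2 := sq_sum_eq_sum_sq_add (E := E) J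
  have hsub : ∑ s ∈ E, J s * ((∫ r in Ioc t T, g r) - ∫ r in Ioc s T, g r) =
      (∑ s ∈ E, J s) * (∫ r in Ioc t T, g r) - ∑ s ∈ E, J s * ∫ r in Ioc s T, g r := by
    rw [Finset.sum_mul, ← Finset.sum_sub_distrib]
    exact Finset.sum_congr rfl fun s _ => by ring
  rw [hint, hyE, hsub, h t ht]
  linear_combination hE2 + hu2

end AnticipatedBSDE

/-! ### Step paths and their jumps -/

namespace AnticipatedBSDE

open Function (leftLim)

/-- A path which is right continuous with left limits for the discrete topology on the states. At
time `0` the condition on left limits is void. -/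
structure IsStepPath {E : Type*} [TopologicalSpace E] (x : ℝ≥0 → E) : Prop where
  right : ∀ s, ∀ᶠ r in 𝓝[≥] s, x r = x s
  left : ∀ s, ∀ᶠ r in 𝓝[<] s, x r = leftLim x s

variable {E : Type*} [TopologicalSpace E] {x : ℝ≥0 → E}

theorem eventually_eq_of_tendsto_of_finite [T1Space E] {α : Type*} {l : Filter α} {y : α → E}
    {F : Set E} (hF : F.Finite) (hy : ∀ r, y r ∈ F) {a : E} (h : Tendsto y l (𝓝 a)) :
    ∀ᶠ r in l, y r = a := by
  have h1 : (F \ {a})ᶜ ∈ 𝓝 a :=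
    (hF.subset sdiff_subset).isClosed.isOpen_compl.mem_nhds (by simp)
  filter_upwards [h h1] with r hr
  by_contra hne
  exact hr ⟨hy r, hne⟩

/-- On a finite set of states every RCLL path is a step path, since points of a finite set are
isolated. -/
theorem isStepPath_of_finite [T2Space E] {F : Set E} (hF : F.Finite) (hx : ∀ r, x r ∈ F)
    (h : ∀ b, IsRCLLOn x 0 b) : IsStepPath x where
  right s := eventually_eq_of_tendsto_of_finite hF hx ((h (s + 1)).1 s ⟨zero_le, by simp⟩)
  left s := by
    rcases eq_or_ne s 0 with rfl | hs
    · simp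
    obtain ⟨l, hl⟩ := (h s).2 s ⟨pos_iff_ne_zero.2 hs, le_rfl⟩
    have : (𝓝[<] s).NeBot := nhdsLT_neBot_of_exists_lt ⟨0, pos_iff_ne_zero.2 hs⟩
    rw [leftLim_eq_of_tendsto hl]
    exact eventually_eq_of_tendsto_of_finite hF hx hl

/-- The jump times of `x` in `(0, b]`. -/
def jumps (x : ℝ≥0 → E) (b : ℝ≥0) : Set ℝ≥0 := {s | s ∈ Ioc 0 b ∧ x s ≠ leftLim x s}

namespace IsStepPath

/-- The jump times are locally isolated, and `[0, b]` is compact. -/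
theorem finite_jumps (hx : IsStepPath x) (b : ℝ≥0) : (jumps x b).Finite := by
  have key : ∀ s : ℝ≥0, ∃ U ∈ 𝓝 s, (jumps x b ∩ U) ⊆ {s} := by
    intro s
    have h1 : ∀ᶠ r in 𝓝[>] s, x r = leftLim x r := by
      have h2 := hx.right s
      rw [eventually_nhdsWithin_iff, eventually_nhds_iff] at h2
      obtain ⟨U, hU, hUo, hsU⟩ := h2
      filter_upwards [mem_nhdsWithin_of_mem_nhds (hUo.mem_nhds hsU), self_mem_nhdsWithin]
        with r hr (hsr : s < r)
      have : (𝓝[<] r).NeBot := nhdsLT_neBot_of_exists_lt ⟨s, hsr⟩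
      have h3 : ∀ᶠ q in 𝓝[<] r, x q = x s := by
        filter_upwards [mem_nhdsWithin_of_mem_nhds (hUo.mem_nhds hr), Ioo_mem_nhdsLT hsr]
          with q hq hq' using hU q hq hq'.1.le
      obtain ⟨q, hq1, hq2⟩ := (h3.and (hx.left r)).exists
      rw [hU r hr hsr.le, ← hq1, hq2]
    have h4 : ∀ᶠ r in 𝓝[<] s, x r = leftLim x r := by
      rcases eq_or_ne s 0 with rfl | hs
      · simp
      obtain ⟨a, ha, hU⟩ := (mem_nhdsLT_iff_exists_Ioo_subset' (pos_iff_ne_zero.2 hs)).1 (hx.left s)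
      filter_upwards [Ioo_mem_nhdsLT ha] with r hr
      have : (𝓝[<] r).NeBot := nhdsLT_neBot_of_exists_lt ⟨a, hr.1⟩
      have h3 : ∀ᶠ q in 𝓝[<] r, x q = leftLim x s := by
        filter_upwards [Ioo_mem_nhdsLT hr.1] with q hq using hU ⟨hq.1, hq.2.trans hr.2⟩
      obtain ⟨q, hq1, hq2⟩ := (h3.and (hx.left r)).exists
      rw [hU hr, ← hq1, hq2]
    have h5 : ∀ᶠ r in 𝓝[≠] s, x r = leftLim x r := by
      rw [← nhdsLT_sup_nhdsGT, eventually_sup]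
      exact ⟨h4, h1⟩
    rw [eventually_nhdsWithin_iff] at h5
    refine ⟨_, h5, fun r hr => ?_⟩
    by_contra hne
    exact hr.1.2 (hr.2 hne)
  have h : ((jumps x b) ∩ Icc 0 b).Finite := by
    refine isCompact_Icc.induction_on (p := fun t => (jumps x b ∩ t).Finite) (by simp)
      (fun s t hst ht => ht.subset (inter_subset_inter_right _ hst))
      (fun s t hs ht => by rw [inter_union_distrib_left]; exact hs.union ht) fun s _ => ?_
    obtain ⟨U, hU, h⟩ := key s
    exact ⟨U, mem_nhdsWithin_of_mem_nhds hU, (finite_singleton s).subset h⟩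
  exact h.subset fun s hs => ⟨hs, hs.1.1.le, hs.1.2⟩

/-- The jump times in `(0, b]` as a finite set. -/
def jumpFinset (hx : IsStepPath x) (b : ℝ≥0) : Finset ℝ≥0 := (hx.finite_jumps b).toFinset

theorem mem_jumpFinset (hx : IsStepPath x) {b s : ℝ≥0} :
    s ∈ hx.jumpFinset b ↔ (0 < s ∧ s ≤ b) ∧ x s ≠ leftLim x s := by
  simp [jumpFinset, jumps]

theorem eq_of_no_jump (hx : IsStepPath x) {u v : ℝ≥0} (huv : u ≤ v)
    (h : ∀ s ∈ Ioc u v, x s = leftLim x s) : x v = x u := by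
  refine isPreconnected_Icc.induction₂ (fun r t => x t = x r) ?_ ?_ ?_
    (left_mem_Icc.2 huv) (right_mem_Icc.2 huv)
  · intro r hr
    rcases hr.1.eq_or_lt with rfl | hlt
    · exact nhdsWithin_mono _ (fun t ht => ht.1) (hx.right u)
    · refine nhdsWithin_le_nhds ?_
      rw [← nhdsLT_sup_nhdsGE, mem_sup]
      refine ⟨?_, hx.right r⟩
      filter_upwards [hx.left r] with t ht
      rw [ht, h r ⟨hlt, hr.2⟩]
  · intro r s t _ _ _ h1 h2
    exact h2.trans h1
  · intro r s _ _ h1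
    exact h1.symm

theorem leftLim_eq_of_no_jump (hx : IsStepPath x) {u s : ℝ≥0} (hus : u < s)
    (h : ∀ r ∈ Ioo u s, x r = leftLim x r) : leftLim x s = x u := by
  have : (𝓝[<] s).NeBot := nhdsLT_neBot_of_exists_lt ⟨u, hus⟩
  obtain ⟨r, hr, hr'⟩ := ((hx.left s).and (Ioo_mem_nhdsLT hus)).exists
  rw [← hr]
  exact hx.eq_of_no_jump hr'.1.le fun q hq => h q ⟨hq.1, hq.2.trans_lt hr'.2⟩

/-- If there is at most one jump in the cell `(u, v]`, a function of the states at its two ends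
which vanishes on the diagonal is the sum of that function over the jumps in the cell. -/
theorem apply_eq_sum_of_subsingleton_jumps {M : Type*} [AddCommMonoid M] (hx : IsStepPath x)
    (f : E → E → M) (hf : ∀ a, f a a = 0) {b u v : ℝ≥0} (huv : u ≤ v) (hv : v ≤ b)
    (h : ∀ s ∈ hx.jumpFinset b, ∀ r ∈ hx.jumpFinset b, s ∈ Ioc u v → r ∈ Ioc u v → s = r) :
    f (x u) (x v) = ∑ s ∈ hx.jumpFinset b with s ∈ Ioc u v, f (leftLim x s) (x s) := by
  by_cases hne : ∃ s ∈ hx.jumpFinset b, s ∈ Ioc u v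
  · obtain ⟨s, hs, hsI⟩ := hne
    have h1 : (hx.jumpFinset b).filter (fun s => s ∈ Ioc u v) = {s} := by
      ext r
      simp only [Finset.mem_filter, Finset.mem_singleton]
      exact ⟨fun hr => h r hr.1 s hs hr.2 hsI, by rintro rfl; exact ⟨hs, hsI⟩⟩
    have h2 : ∀ r ∈ Ioc u v, r ≠ s → x r = leftLim x r := by
      intro r hr hrs
      by_contra hj
      exact hrs (h r (hx.mem_jumpFinset.2 ⟨⟨pos_of_gt hr.1, hr.2.trans hv⟩, hj⟩) s hs hr hsI)
    rw [h1, Finset.sum_singleton,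
      hx.leftLim_eq_of_no_jump hsI.1 fun r hr => h2 r ⟨hr.1, hr.2.le.trans hsI.2⟩ hr.2.ne,
      hx.eq_of_no_jump hsI.2 fun r hr => h2 r ⟨hsI.1.trans hr.1, hr.2⟩ hr.1.ne']
  · push Not at hne
    rw [Finset.filter_false_of_mem hne, Finset.sum_empty, hx.eq_of_no_jump huv, hf]
    intro s hs
    by_contra hj
    exact hne s (hx.mem_jumpFinset.2 ⟨⟨pos_of_gt hs.1, hs.2.trans hv⟩, hj⟩) hs

/-- The points of the uniform grid of `[a, a + c]` with `n + 1` cells. -/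
def gridPt (a c : ℝ≥0) (n k : ℕ) : ℝ≥0 := a + c * (k / (n + 1))

theorem gridPt_mono (a c : ℝ≥0) (n : ℕ) : Monotone (gridPt a c n) := fun k l hkl => by
  unfold gridPt
  gcongr

theorem gridPt_zero (a c : ℝ≥0) (n : ℕ) : gridPt a c n 0 = a := by simp [gridPt]

theorem gridPt_last (a c : ℝ≥0) (n : ℕ) : gridPt a c n (n + 1) = a + c := by
  simp [gridPt]

theorem gridPt_succ (a c : ℝ≥0) (n k : ℕ) :
    gridPt a c n (k + 1) = gridPt a c n k + c / (n + 1) := by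
  simp only [gridPt, Nat.cast_add, Nat.cast_one]
  rw [add_div, mul_add, add_assoc, mul_one_div]

/-- On a fine enough grid every cell contains at most one jump, so that sums over the cells are sums
over the jumps. -/
theorem eventually_sum_grid {M : Type*} [AddCommMonoid M] (hx : IsStepPath x) (f : E → E → M)
    (hf : ∀ a, f a a = 0) {a c b : ℝ≥0} (hb : a + c ≤ b) :
    ∀ᶠ n : ℕ in atTop,
      ∑ k ∈ Finset.range (n + 1), f (x (gridPt a c n k)) (x (gridPt a c n (k + 1))) =
        ∑ s ∈ hx.jumpFinset b with s ∈ Ioc a (a + c), f (leftLim x s) (x s) := by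
  -- eventually the mesh is smaller than the distance between any two jumps
  have h1 : ∀ᶠ n : ℕ in atTop, ∀ s ∈ hx.jumpFinset b, ∀ r ∈ hx.jumpFinset b,
      s < r → s + c / (n + 1) < r := by
    rw [eventually_all_finset]
    intro s _
    rw [eventually_all_finset]
    intro r _
    by_cases hsr : s < r
    · have h2 : Tendsto (fun n : ℕ => s + c / ((n : ℝ≥0) + 1)) atTop (𝓝 (s + 0)) := by
        refine tendsto_const_nhds.add ?_
        have := (tendsto_one_div_add_atTop_nhds_zero_nat (𝕜 := ℝ≥0)).const_mul c
        simpa only [mul_one_div, mul_zero] using this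
      rw [add_zero] at h2
      filter_upwards [h2.eventually (gt_mem_nhds hsr)] with n hn _ using hn
    · exact Eventually.of_forall fun n h => absurd h hsr
  filter_upwards [h1] with n hn
  have hmono := gridPt_mono a c n
  have hle : ∀ k ≤ n + 1, gridPt a c n k ≤ a + c := fun k hk => by
    rw [← gridPt_last a c n]; exact hmono hk
  have h3 : ∀ s ∈ hx.jumpFinset b, ∀ r ∈ hx.jumpFinset b, ∀ k,
      s ∈ Ioc (gridPt a c n k) (gridPt a c n (k + 1)) →
      r ∈ Ioc (gridPt a c n k) (gridPt a c n (k + 1)) → ¬ s < r := by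
    intro s hs r hr k hsk hrk hlt
    have h4 := hn s hs r hr hlt
    rw [gridPt_succ] at hrk
    exact absurd (hrk.2.trans (add_le_add_left hsk.1.le _)) h4.not_ge
  have h5 : ∀ m ≤ n + 1,
      ∑ k ∈ Finset.range m, f (x (gridPt a c n k)) (x (gridPt a c n (k + 1))) =
        ∑ s ∈ hx.jumpFinset b with s ∈ Ioc a (gridPt a c n m), f (leftLim x s) (x s) := by
    intro m
    induction m with
    | zero => intro _; simp [gridPt_zero]
    | succ m ih =>
      intro hm
      rw [Finset.sum_range_succ, ih (by lia), hx.apply_eq_sum_of_subsingleton_jumps f hf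
        (hmono m.le_succ) ((hle (m + 1) hm).trans hb) (fun s hs r hr hsk hrk =>
          le_antisymm (not_lt.1 (h3 r hr s hs m hrk hsk)) (not_lt.1 (h3 s hs r hr m hsk hrk))),
        ← Finset.sum_union]
      · refine Finset.sum_congr ?_ fun _ _ => rfl
        rw [← Finset.filter_or]
        refine Finset.filter_congr fun s _ => ?_
        rw [← mem_union, Ioc_union_Ioc_eq_Ioc _ (hmono m.le_succ)]
        exact (gridPt_zero a c n).symm.le.trans (hmono m.zero_le)
      · rw [Finset.disjoint_filter]
        exact fun s _ h h' => absurd h'.1 h.2.not_gt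
  rw [h5 (n + 1) le_rfl, gridPt_last]

end IsStepPath

end AnticipatedBSDE

/-! ### Predictable and jointly measurable versions -/

namespace AnticipatedBSDE

open Function (leftLim)

/-- The largest point `k / (n + 1)` strictly to the left of `s` (and `0` if `s = 0`). -/
def gridLeft (n : ℕ) (s : ℝ≥0) : ℝ≥0 := ((⌈s * (n + 1)⌉₊ - 1 : ℕ) : ℝ≥0) / (n + 1)

/-- The smallest point `k / (n + 1)` strictly to the right of `s`. -/
def gridRight (n : ℕ) (s : ℝ≥0) : ℝ≥0 := ((⌊s * (n + 1)⌋₊ + 1 : ℕ) : ℝ≥0) / (n + 1)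

theorem gridLeft_lt {n : ℕ} {s : ℝ≥0} (hs : 0 < s) : gridLeft n s < s := by
  have hn : (0 : ℝ≥0) < n + 1 := by positivity
  rw [gridLeft, div_lt_iff₀ hn, ← Nat.lt_ceil]
  exact Nat.sub_lt (Nat.ceil_pos.2 (mul_pos hs hn)) one_pos

theorem le_gridLeft_add {n : ℕ} {s : ℝ≥0} : s ≤ gridLeft n s + 1 / (n + 1) := by
  have hn : (0 : ℝ≥0) < n + 1 := by positivity
  rw [gridLeft, ← add_div, le_div_iff₀ hn]
  refine (Nat.le_ceil _).trans ?_
  exact_mod_cast (by lia : ⌈s * (n + 1)⌉₊ ≤ ⌈s * (n + 1)⌉₊ - 1 + 1)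

theorem lt_gridRight {n : ℕ} {s : ℝ≥0} : s < gridRight n s := by
  have hn : (0 : ℝ≥0) < n + 1 := by positivity
  rw [gridRight, lt_div_iff₀ hn]
  push_cast
  exact Nat.lt_floor_add_one _

theorem gridRight_le {n : ℕ} {s : ℝ≥0} : gridRight n s ≤ s + 1 / (n + 1) := by
  have hn : (0 : ℝ≥0) < n + 1 := by positivity
  rw [gridRight, div_le_iff₀ hn, add_mul, one_div, inv_mul_cancel₀ hn.ne']
  push_cast
  gcongr
  exact Nat.floor_le zero_le

theorem tendsto_gridLeft {s : ℝ≥0} (hs : 0 < s) :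
    Tendsto (fun n => gridLeft n s) atTop (𝓝[<] s) := by
  refine tendsto_nhdsWithin_iff.2 ⟨?_, Eventually.of_forall fun n => gridLeft_lt hs⟩
  have h1 := tendsto_one_div_add_atTop_nhds_zero_nat (𝕜 := ℝ≥0)
  have h2 : Tendsto (fun n : ℕ => s - 1 / ((n : ℝ≥0) + 1)) atTop (𝓝 (s - 0)) :=
    tendsto_const_nhds.sub h1
  rw [tsub_zero] at h2
  exact tendsto_of_tendsto_of_tendsto_of_le_of_le h2 tendsto_const_nhds
    (fun n => tsub_le_iff_right.2 le_gridLeft_add) fun n => (gridLeft_lt hs).le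

theorem tendsto_gridRight (s : ℝ≥0) : Tendsto (fun n => gridRight n s) atTop (𝓝[≥] s) := by
  refine tendsto_nhdsWithin_iff.2 ⟨?_, Eventually.of_forall fun n => lt_gridRight.le⟩
  have h2 := (tendsto_one_div_add_atTop_nhds_zero_nat (𝕜 := ℝ≥0)).const_add s
  rw [add_zero] at h2
  exact tendsto_of_tendsto_of_tendsto_of_le_of_le tendsto_const_nhds h2
    (fun n => lt_gridRight.le) fun n => gridRight_le

variable {Ω : Type u} {mΩ : MeasurableSpace Ω} {𝓕 : Filtration ℝ≥0 mΩ}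

theorem predictable_le : 𝓕.predictable ≤ Prod.instMeasurableSpace :=
  measurableSpace_le_predictable_of_measurableSet
    (fun A hA => (measurableSet_singleton _).prod (𝓕.le _ A hA))
    fun i A hA => measurableSet_Ioi.prod (𝓕.le i A hA)

theorem measurable_fst_predictable : Measurable[𝓕.predictable] (Prod.fst : ℝ≥0 × Ω → ℝ≥0) := by
  have h : @Measurable _ _ 𝓕.predictable (borel ℝ≥0) (Prod.fst : ℝ≥0 × Ω → ℝ≥0) := by
    rw [borel_eq_generateFrom_Ioi]
    refine @measurable_generateFrom _ _ 𝓕.predictable _ _ ?_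
    rintro _ ⟨a, rfl⟩
    have := measurableSet_predictable_Ioi_prod (𝓕 := 𝓕) (i := a) (s := univ) MeasurableSet.univ
    convert this using 1
    ext p
    simp
  rwa [← BorelSpace.measurable_eq (α := ℝ≥0)] at h

/-- On each of the strips `(k / (n + 1), (k + 1) / (n + 1)]` this is a variable which is known at
the left end of the strip. -/
theorem measurable_gridLeft {Y : ℝ≥0 → Ω → ℝ} (hY : ∀ t, Measurable[𝓕 t] (Y t)) (n : ℕ) :
    Measurable[𝓕.predictable] fun p : ℝ≥0 × Ω => Y (gridLeft n p.1) p.2 := by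
  intro B hB
  have hn : (0 : ℝ≥0) < n + 1 := by positivity
  have : (fun p : ℝ≥0 × Ω => Y (gridLeft n p.1) p.2) ⁻¹' B = ({⊥} ×ˢ (Y 0 ⁻¹' B)) ∪
      ⋃ k : ℕ, Ioc ((k : ℝ≥0) / (n + 1)) ((k + 1 : ℕ) / (n + 1)) ×ˢ (Y (k / (n + 1)) ⁻¹' B) := by
    ext ⟨s, ω⟩
    simp only [mem_preimage, mem_union, mem_prod, mem_iUnion, mem_singleton_iff]
    have hk : ∀ k : ℕ, s ∈ Ioc ((k : ℝ≥0) / (n + 1)) ((k + 1 : ℕ) / (n + 1)) →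
        gridLeft n s = k / (n + 1) := by
      intro k hk
      rw [mem_Ioc, div_lt_iff₀ hn, le_div_iff₀ hn] at hk
      have h1 : ⌈s * (n + 1)⌉₊ = k + 1 := by
        rw [Nat.ceil_eq_iff (by simp)]
        simpa using hk
      rw [gridLeft, h1, Nat.add_sub_cancel]
    constructor
    · intro h
      rcases eq_or_ne s 0 with rfl | hs
      · left
        simpa [gridLeft] using h
      · right
        have hs' := pos_iff_ne_zero.2 hs
        have h2 : ⌈s * (n + 1)⌉₊ - 1 + 1 = ⌈s * (n + 1)⌉₊ :=
          Nat.sub_add_cancel (Nat.ceil_pos.2 (mul_pos hs' hn))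
        refine ⟨⌈s * (n + 1)⌉₊ - 1, ⟨gridLeft_lt hs', ?_⟩, h⟩
        rw [le_div_iff₀ hn, h2]
        exact Nat.le_ceil _
    · rintro (⟨h1, h2⟩ | ⟨k, h1, h2⟩)
      · have h1 : s = 0 := h1
        subst h1
        simpa [gridLeft] using h2
      · rwa [hk k h1]
  rw [this]
  refine (measurableSet_predictable_singleton_bot_prod (hY 0 hB)).union (.iUnion fun k => ?_)
  exact measurableSet_predictable_Ioc_prod _ _ (hY _ hB)

/-- A predictable version of the process of left limits of `Y`. The upper limit makes it measurable
everywhere; it is the left limit wherever that exists. -/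
def leftVersion (Y : ℝ≥0 → Ω → ℝ) (p : ℝ≥0 × Ω) : ℝ :=
  limsup (fun n => Y (gridLeft n p.1) p.2) atTop

theorem measurable_leftVersion {Y : ℝ≥0 → Ω → ℝ} (hY : ∀ t, Measurable[𝓕 t] (Y t)) :
    Measurable[𝓕.predictable] (leftVersion Y) :=
  @Measurable.limsup _ _ _ _ _ 𝓕.predictable _ _ _ _ fun n => measurable_gridLeft hY n

theorem leftVersion_eq {Y : ℝ≥0 → Ω → ℝ} {s : ℝ≥0} {ω : Ω} {l : ℝ} (hs : 0 < s)
    (h : Tendsto (fun t => Y t ω) (𝓝[<] s) (𝓝 l)) : leftVersion Y (s, ω) = l :=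
  (h.comp (tendsto_gridLeft hs)).limsup_eq

theorem measurable_gridRight {E : Type*} [MeasurableSpace E] {Y : ℝ≥0 → Ω → E}
    (hY : ∀ t, Measurable (Y t)) (n : ℕ) :
    Measurable fun p : ℝ≥0 × Ω => Y (gridRight n p.1) p.2 := by
  have h1 : Measurable fun p : ℕ × Ω => Y ((p.1 : ℝ≥0) / (n + 1)) p.2 :=
    measurable_from_prod_countable_right fun k => hY ((k : ℝ≥0) / (n + 1))
  have h2 : Measurable fun p : ℝ≥0 × Ω => (⌊p.1 * (n + 1)⌋₊ + 1, p.2) :=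
    ((Nat.measurable_floor.comp (measurable_fst.mul_const _)).add_const 1).prodMk measurable_snd
  have h3 := h1.comp h2
  simpa only [gridRight, Function.comp_def] using h3

/-- A jointly measurable version of a right continuous process on `[0, b]`. The grid points are
stopped at `b`, because nothing is known about `Y` beyond `b`. -/
def rightVersion (b : ℝ≥0) (Y : ℝ≥0 → Ω → ℝ) (p : ℝ≥0 × Ω) : ℝ :=
  limsup (fun n => Y (min (gridRight n p.1) b) p.2) atTop

theorem measurable_rightVersion {b : ℝ≥0} {Y : ℝ≥0 → Ω → ℝ} (hY : ∀ t ≤ b, Measurable (Y t)) :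
    Measurable (rightVersion b Y) :=
  Measurable.limsup fun n =>
    measurable_gridRight (Y := fun t => Y (min t b)) (fun _ => hY _ (min_le_right _ _)) n

theorem rightVersion_eq {b : ℝ≥0} {Y : ℝ≥0 → Ω → ℝ} {s : ℝ≥0} {ω : Ω}
    (h : IsRCLLOn (fun t => Y t ω) 0 b) (hs : s ≤ b) : rightVersion b Y (s, ω) = Y s ω := by
  refine Tendsto.limsup_eq ?_
  rcases hs.eq_or_lt with rfl | hs
  · refine tendsto_const_nhds.congr fun n => ?_
    rw [min_eq_right lt_gridRight.le]
  · have h1 := (h.1 s ⟨zero_le, hs⟩).tendsto.comp (tendsto_gridRight s)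
    refine h1.congr' ?_
    have h2 := (tendsto_gridRight s).mono_right nhdsWithin_le_nhds
    filter_upwards [h2.eventually (gt_mem_nhds hs)] with n hn
    simp only [Function.comp]
    rw [min_eq_left hn.le]

end AnticipatedBSDE

/-! ### The states of the chain and the seminorm -/

namespace AnticipatedBSDE

open Function (leftLim)

namespace MarkovChain

variable {N : ℕ} {Ω : Type u} [MeasurableSpace Ω] {P : Measure Ω} (S : MarkovChain N P)

/-- The index of the current state. -/
def state (t : ℝ≥0) (ω : Ω) : Fin N := (S.X_unit t ω).choose

theorem X_eq (t : ℝ≥0) (ω : Ω) : S.X t ω = Pi.single (S.state t ω) 1 := (S.X_unit t ω).choose_spec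

theorem isStepPath (ω : Ω) : IsStepPath fun t => S.X t ω :=
  isStepPath_of_finite (finite_range fun i : Fin N => (Pi.single i 1 : Fin N → ℝ))
    (fun t => ⟨_, (S.X_eq t ω).symm⟩) (S.rcll_X ω)

theorem exists_leftLim_eq (t : ℝ≥0) (ω : Ω) :
    ∃ j, leftLim (fun r => S.X r ω) t = Pi.single j 1 := by
  rcases eq_or_ne t 0 with rfl | ht
  · exact ⟨_, (leftLim_eq_of_eq_bot _ (by simp)).trans (S.X_eq 0 ω)⟩
  · have : (𝓝[<] t).NeBot := nhdsLT_neBot_of_exists_lt ⟨0, pos_iff_ne_zero.2 ht⟩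
    obtain ⟨r, hr⟩ := ((S.isStepPath ω).left t).exists
    exact ⟨_, hr.symm.trans (S.X_eq r ω)⟩

/-- The index of the state immediately before time `t`. -/
def leftState (t : ℝ≥0) (ω : Ω) : Fin N := (S.exists_leftLim_eq t ω).choose

theorem leftLim_X_eq (t : ℝ≥0) (ω : Ω) :
    leftLim (fun r => S.X r ω) t = Pi.single (S.leftState t ω) 1 :=
  (S.exists_leftLim_eq t ω).choose_spec

theorem single_one_injective : Function.Injective fun i : Fin N => (Pi.single i 1 : Fin N → ℝ) := by
  intro i j h
  by_contra hij
  have h1 := congrFun h i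
  simp [Pi.single_eq_of_ne hij] at h1

/-- The jump times of the chain in `(0, b]`. -/
def jumpTimes (b : ℝ≥0) (ω : Ω) : Finset ℝ≥0 := (S.isStepPath ω).jumpFinset b

variable {S}

theorem mem_jumpTimes {b s : ℝ≥0} {ω : Ω} :
    s ∈ S.jumpTimes b ω ↔ (0 < s ∧ s ≤ b) ∧ S.state s ω ≠ S.leftState s ω := by
  rw [jumpTimes, IsStepPath.mem_jumpFinset, X_eq, leftLim_X_eq, single_one_injective.ne_iff]

theorem leftState_eq_of_notMem {b s : ℝ≥0} {ω : Ω} (h : s ∉ S.jumpTimes b ω) (hs : s ∈ Ioc 0 b) :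
    S.leftState s ω = S.state s ω := by
  by_contra hne
  exact h (mem_jumpTimes.2 ⟨hs, fun h => hne h.symm⟩)

theorem X_apply (t : ℝ≥0) (ω : Ω) (i : Fin N) : S.X t ω i = if i = S.state t ω then 1 else 0 := by
  rw [X_eq, Pi.single_apply]

theorem abs_X_le (t : ℝ≥0) (ω : Ω) (i : Fin N) : |S.X t ω i| ≤ 1 := by
  rw [X_apply]; split_ifs <;> simp

theorem X_nonneg (t : ℝ≥0) (ω : Ω) (i : Fin N) : 0 ≤ S.X t ω i := by
  rw [X_apply]; split_ifs <;> simp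

theorem mulVec_X (s t : ℝ≥0) (ω : Ω) : S.A s *ᵥ S.X t ω = fun i => S.A s i (S.state t ω) := by
  rw [X_eq]; exact Matrix.mulVec_single_one _ _

/-- `‖z‖²_{X_s}` is the sum, over the states `i`, of the rate of jumping to `e_i` times the square
of the jump `z' ΔX` that this causes. The diagonal of `A` does not contribute. -/
theorem semiSq_eq (s : ℝ≥0) (ω : Ω) (z : Fin N → ℝ) :
    S.semiSq s ω z = ∑ i, S.A s i (S.state s ω) * (z i - z (S.state s ω)) ^ 2 := by
  set j := S.state s ω with hj
  have h0 : S.X s ω = Pi.single j 1 := S.X_eq s ω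
  have h1 : z ⬝ᵥ (Matrix.diagonal (S.A s *ᵥ S.X s ω) *ᵥ z) = ∑ i, S.A s i j * z i ^ 2 := by
    simp only [dotProduct, Matrix.mulVec_diagonal, mulVec_X]
    exact Finset.sum_congr rfl fun i _ => by rw [← hj]; ring
  have h2 : z ⬝ᵥ ((Matrix.diagonal (S.X s ω) * (S.A s)ᵀ) *ᵥ z) = z j * ∑ i, S.A s i j * z i := by
    rw [← Matrix.mulVec_mulVec]
    simp only [dotProduct, Matrix.mulVec_diagonal, h0, Matrix.mulVec_transpose, Matrix.vecMul,
      Pi.single_apply, ite_mul, one_mul, zero_mul, mul_ite, mul_zero, Finset.sum_ite_eq',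
      Finset.mem_univ, if_true]
    exact congrArg _ (Finset.sum_congr rfl fun i _ => mul_comm _ _)
  have h3 : z ⬝ᵥ ((S.A s * Matrix.diagonal (S.X s ω)) *ᵥ z) = z j * ∑ i, S.A s i j * z i := by
    rw [← Matrix.mulVec_mulVec]
    have : Matrix.diagonal (S.X s ω) *ᵥ z = z j • Pi.single j 1 := by
      ext i
      rw [Matrix.mulVec_diagonal, h0, Pi.smul_apply, smul_eq_mul, Pi.single_apply]
      split_ifs with h
      · rw [h]; ring
      · simp
    rw [this, Matrix.mulVec_smul, Matrix.mulVec_single_one, dotProduct_smul, smul_eq_mul]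
    congr 1
    exact Finset.sum_congr rfl fun i _ => mul_comm _ _
  have h4 : ∑ i, S.A s i j * (z i - z j) ^ 2 = ∑ i, S.A s i j * z i ^ 2
      - 2 * (z j * ∑ i, S.A s i j * z i) + z j ^ 2 * ∑ i, S.A s i j := by
    rw [Finset.mul_sum, Finset.mul_sum, Finset.mul_sum, ← Finset.sum_sub_distrib,
      ← Finset.sum_add_distrib]
    exact Finset.sum_congr rfl fun i _ => by ring
  rw [h4, S.A_sum, semiSq, Psi, Matrix.sub_mulVec, Matrix.sub_mulVec, dotProduct_sub,
    dotProduct_sub, h1, h2, h3]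
  ring

theorem semiSq_term_nonneg (s : ℝ≥0) (ω : Ω) (z : Fin N → ℝ) (i : Fin N) :
    0 ≤ S.A s i (S.state s ω) * (z i - z (S.state s ω)) ^ 2 := by
  rcases eq_or_ne i (S.state s ω) with h | h
  · rw [← h]; simp
  · exact mul_nonneg (S.A_nonneg s _ _ h) (sq_nonneg _)

theorem semiSq_nonneg (s : ℝ≥0) (ω : Ω) (z : Fin N → ℝ) : 0 ≤ S.semiSq s ω z := by
  rw [semiSq_eq]
  exact Finset.sum_nonneg fun i _ => S.semiSq_term_nonneg s ω z i

/-- The compensator density of the jumps `z' ΔX`. The columns of `A` sum to zero, so that `z` may be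
shifted by its value at the current state. -/
theorem dotProduct_mulVec_X (s : ℝ≥0) (ω : Ω) (z : Fin N → ℝ) :
    z ⬝ᵥ (S.A s *ᵥ S.X s ω) = ∑ i, S.A s i (S.state s ω) * (z i - z (S.state s ω)) := by
  have : ∑ i, S.A s i (S.state s ω) * (z i - z (S.state s ω)) =
      ∑ i, z i * S.A s i (S.state s ω) - (∑ i, S.A s i (S.state s ω)) * z (S.state s ω) := by
    rw [Finset.sum_mul, ← Finset.sum_sub_distrib]
    exact Finset.sum_congr rfl fun i _ => by ring
  rw [this, S.A_sum, mulVec_X]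
  simp [dotProduct]

theorem measurable_X_apply (t : ℝ≥0) (i : Fin N) : Measurable fun ω => S.X t ω i :=
  (measurable_pi_apply i).comp (S.stronglyMeasurable_X t).measurable

theorem adapted_X (t : ℝ≥0) : Measurable[S.filtration t] (S.X t) :=
  (Filtration.stronglyAdapted_natural S.stronglyMeasurable_X t).measurable

theorem adapted_X_apply (t : ℝ≥0) (i : Fin N) : Measurable[S.filtration t] fun ω => S.X t ω i :=
  (measurable_pi_apply i).comp (S.adapted_X t)

theorem measurable_X_prod : Measurable fun p : ℝ≥0 × Ω => S.X p.1 p.2 := by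
  refine measurable_of_tendsto_metrizable (f := fun n (p : ℝ≥0 × Ω) => S.X (gridRight n p.1) p.2)
    (fun n => ?_) (tendsto_pi_nhds.2 fun p => ?_)
  · exact measurable_gridRight (fun t => (S.stronglyMeasurable_X t).measurable) n
  · refine tendsto_const_nhds.congr' ?_
    filter_upwards [(tendsto_gridRight p.1).eventually ((S.isStepPath p.2).right p.1)] with n hn
    exact hn.symm

theorem measurable_state : Measurable fun p : ℝ≥0 × Ω => S.state p.1 p.2 := by
  refine measurable_to_countable' fun i => ?_
  have : (fun p : ℝ≥0 × Ω => S.state p.1 p.2) ⁻¹' {i} = (fun p => S.X p.1 p.2 i) ⁻¹' {1} := by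
    ext p
    simp only [mem_preimage, mem_singleton_iff, X_apply]
    split_ifs with h
    · simp [h]
    · simp [Ne.symm h]
  rw [this]
  exact (measurable_pi_apply i).comp S.measurable_X_prod (measurableSet_singleton _)

theorem measurable_A_state (i : Fin N) :
    Measurable fun p : ℝ≥0 × Ω => S.A p.1 i (S.state p.1 p.2) := by
  have h : Measurable fun p : ℝ≥0 × Ω => S.A p.1 i := by
    refine measurable_pi_iff.2 fun j => (S.measurable_A i j).comp measurable_fst
  have h2 : Measurable fun q : (Fin N → ℝ) × Fin N => q.1 q.2 :=
    measurable_from_prod_countable_left fun j => measurable_pi_apply j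
  exact h2.comp (h.prodMk S.measurable_state)

theorem exists_bound (S : MarkovChain N P) : ∃ m : ℝ, 0 ≤ m ∧ ∀ t i j, |S.A t i j| ≤ m := by
  obtain ⟨m, hm⟩ := S.bounded_A
  exact ⟨max m 0, le_max_right _ _, fun t i j => (hm t i j).trans (le_max_left _ _)⟩

end MarkovChain

end AnticipatedBSDE

/-! ### The martingale property and the expected number of jumps -/

namespace AnticipatedBSDE

open Function (leftLim)

namespace MarkovChain

variable {N : ℕ} {Ω : Type u} [MeasurableSpace Ω] {P : Measure Ω} {S : MarkovChain N P}

theorem integrable_X [IsFiniteMeasure P] (t : ℝ≥0) (i : Fin N) :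
    Integrable (fun ω => S.X t ω i) P :=
  Integrable.of_bound (S.measurable_X_apply t i).aestronglyMeasurable 1
    (Eventually.of_forall fun ω => S.abs_X_le t ω i)

theorem abs_mulVec_X_le {m : ℝ} (hm : ∀ t i j, |S.A t i j| ≤ m) (s : ℝ≥0) (ω : Ω) (i : Fin N) :
    |(S.A s *ᵥ S.X s ω) i| ≤ m := by
  rw [mulVec_X]; exact hm _ _ _

theorem measurable_mulVec_X (i : Fin N) :
    Measurable fun p : ℝ≥0 × Ω => (S.A p.1 *ᵥ S.X p.1 p.2) i := by
  simp only [mulVec_X]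
  exact S.measurable_A_state i

theorem integrable_mulVec_X [IsFiniteMeasure P] (u v : ℝ≥0) (F : Set Ω) (i : Fin N) :
    Integrable (fun p : Ω × ℝ≥0 => (S.A p.2 *ᵥ S.X p.2 p.1) i)
      ((P.restrict F).prod (volume.restrict (Ioc u v))) := by
  obtain ⟨m, -, hm⟩ := S.exists_bound
  exact Integrable.of_bound ((S.measurable_mulVec_X i).comp measurable_swap).aestronglyMeasurable m
    (Eventually.of_forall fun p => abs_mulVec_X_le hm p.2 p.1 i)

/-- `M = X - X_0 - ∫ A X` is a martingale: by the Markov property both sides are linear in the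
vector `E[X_u; F]`, with the coefficients `Φ(u, v) - 1` and `∫_u^v A_r Φ(u, r) dr`, which agree by
Kolmogorov's equation. -/
theorem setIntegral_X_sub [IsFiniteMeasure P] {u v : ℝ≥0} (huv : u ≤ v) {F : Set Ω}
    (hF : MeasurableSet[S.filtration u] F) (i : Fin N) :
    ∫ ω in F, (S.X v ω i - S.X u ω i) ∂P =
      ∫ ω in F, (∫ r in Ioc u v, (S.A r *ᵥ S.X r ω) i) ∂P := by
  obtain ⟨m, hm0, hm⟩ := S.exists_bound
  obtain ⟨Φ, hΦc, hΦ, hM'⟩ := S.markov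
  have hM : ∀ s t, s ≤ t → ∀ i, P[fun ω => S.X t ω i | S.filtration s] =ᵐ[P]
    fun ω => (Φ s t *ᵥ S.X s ω) i := hM'
  set p : Fin N → ℝ := fun j => ∫ ω in F, S.X u ω j ∂P with hp
  -- the mean of `X_r` on `F` is transported by the transition matrix
  have hq : ∀ r, u ≤ r → ∀ l, ∫ ω in F, S.X r ω l ∂P = ∑ j, Φ u r l j * p j := by
    intro r hr l
    rw [← setIntegral_condExp (S.filtration.le u) (S.integrable_X r l) hF,
      setIntegral_congr_ae (g := fun ω => (Φ u r *ᵥ S.X u ω) l) (S.filtration.le u _ hF)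
        ((hM u r hr l).mono fun ω hω _ => hω)]
    simp only [Matrix.mulVec, dotProduct]
    rw [integral_finsetSum]
    · simp only [integral_const_mul, hp]
    · exact fun j _ => ((S.integrable_X u j).integrableOn).const_mul _
  have hAΦ : ∀ j, IntegrableOn (fun r => (S.A r * Φ u r) i j) (Ioc u v) := by
    intro j
    simp only [Matrix.mul_apply]
    refine integrable_finsetSum _ fun l _ => ?_
    have h1 : ContinuousOn (fun r => Φ u r l j) (Icc u v) :=
      (continuous_id.matrix_elem l j).comp_continuousOn ((hΦc u).mono fun x hx => hx.1)
    have h2 : IntegrableOn (fun r => Φ u r l j) (Ioc u v) :=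
      (h1.integrableOn_compact isCompact_Icc).mono_set Ioc_subset_Icc_self
    exact h2.bdd_mul (S.measurable_A i l).aestronglyMeasurable
      (Eventually.of_forall fun r => hm r i l)
  have hR : ∫ ω in F, (∫ r in Ioc u v, (S.A r *ᵥ S.X r ω) i) ∂P =
      ∑ j, p j * ∫ r in Ioc u v, (S.A r * Φ u r) i j := by
    rw [integral_integral_swap (f := fun ω r => (S.A r *ᵥ S.X r ω) i)
      (S.integrable_mulVec_X u v F i)]
    have h3 : ∀ r ∈ Ioc u v, ∫ ω in F, (S.A r *ᵥ S.X r ω) i ∂P =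
        ∑ j, p j * (S.A r * Φ u r) i j := by
      intro r hr
      simp only [Matrix.mulVec, dotProduct]
      rw [integral_finsetSum _ fun l _ => ((S.integrable_X r l).integrableOn).const_mul _]
      simp only [integral_const_mul, hq r hr.1.le, Matrix.mul_apply, Finset.mul_sum]
      rw [Finset.sum_comm]
      exact Finset.sum_congr rfl fun j _ => Finset.sum_congr rfl fun l _ => by ring
    rw [setIntegral_congr_fun measurableSet_Ioc h3,
      integral_finsetSum _ fun j _ => (hAΦ j).const_mul _]
    simp only [integral_const_mul]
  rw [hR, integral_sub (S.integrable_X v i).integrableOn (S.integrable_X u i).integrableOn,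
    hq v huv i]
  have h4 : ∀ j, p j * ∫ r in Ioc u v, (S.A r * Φ u r) i j =
      Φ u v i j * p j - p j * (1 : Matrix (Fin N) (Fin N) ℝ) i j := by
    intro j
    rw [hΦ u v huv i j]
    ring
  simp only [h4, Finset.sum_sub_distrib, Matrix.one_apply, mul_ite, mul_one, mul_zero,
    Finset.sum_ite_eq, Finset.mem_univ, if_true]
  rfl

theorem abs_integral_mulVec_X_le {m : ℝ} (hm : ∀ t i j, |S.A t i j| ≤ m) {u v : ℝ≥0}
    (huv : u ≤ v) (ω : Ω) (i : Fin N) :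
    |∫ r in Ioc u v, (S.A r *ᵥ S.X r ω) i| ≤ m * (v - u) := by
  have h := norm_setIntegral_le_of_norm_le_const (μ := (volume : Measure ℝ≥0)) (s := Ioc u v)
    (f := fun r => (S.A r *ᵥ S.X r ω) i) (C := m)
    (by rw [volume_nnreal_Ioc]; exact ENNReal.ofReal_lt_top)
    (fun r _ => abs_mulVec_X_le hm r ω i)
  rwa [Measure.real, volume_nnreal_Ioc,
    ENNReal.toReal_ofReal (sub_nonneg.2 (NNReal.coe_le_coe.2 huv))] at h

theorem measurableSet_X_ne (u v : ℝ≥0) : MeasurableSet {ω | S.X u ω ≠ S.X v ω} :=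
  (measurableSet_eq_fun (S.stronglyMeasurable_X u).measurable
    (S.stronglyMeasurable_X v).measurable).compl

/-- The probability that the states at times `u` and `v` differ is at most of order `v - u`: on
`{X_u = e_j}` it is the mean of `-∫_u^v (A X)_j`. -/
theorem measure_X_ne_le [IsProbabilityMeasure P] {m : ℝ}
    (hm : ∀ t i j, |S.A t i j| ≤ m) {u v : ℝ≥0} (huv : u ≤ v) :
    P {ω | S.X u ω ≠ S.X v ω} ≤ ENNReal.ofReal (m * (v - u)) := by
  set F : Fin N → Set Ω := fun j => {ω | S.X u ω j = 1} with hFdef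
  have hF : ∀ j, MeasurableSet[S.filtration u] (F j) := fun j =>
    (S.adapted_X_apply u j) (measurableSet_singleton 1)
  have hF' : ∀ j, MeasurableSet (F j) := fun j => S.filtration.le u _ (hF j)
  have hmem : ∀ j ω, ω ∈ F j ↔ S.state u ω = j := by
    intro j ω
    simp only [hFdef, mem_ofPred_eq, X_apply]
    split_ifs with h
    · simp [h]
    · simp [Ne.symm h]
  have h1 : ∀ j, ∫ ω in F j, (1 - S.X v ω j) ∂P ≤ m * (v - u) * P.real (F j) := by
    intro j
    have h2 : ∫ ω in F j, (1 - S.X v ω j) ∂P = - ∫ ω in F j, (S.X v ω j - S.X u ω j) ∂P := by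
      rw [← integral_neg]
      refine setIntegral_congr_fun (hF' j) fun ω hω => ?_
      have : S.X u ω j = 1 := hω
      simp only [this]; ring
    rw [h2, S.setIntegral_X_sub huv (hF j) j]
    have h3 := norm_setIntegral_le_of_norm_le_const (μ := P) (s := F j)
      (f := fun ω => ∫ r in Ioc u v, (S.A r *ᵥ S.X r ω) j) (C := m * (v - u)) (measure_lt_top _ _)
      (fun ω _ => S.abs_integral_mulVec_X_le hm huv ω j)
    exact (neg_le_abs _).trans h3
  have h4 : P.real {ω | S.X u ω ≠ S.X v ω} = ∑ j, ∫ ω in F j, (1 - S.X v ω j) ∂P := by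
    have h5 : ∀ j, ∫ ω in F j, (1 - S.X v ω j) ∂P = P.real ({ω | S.X u ω ≠ S.X v ω} ∩ F j) := by
      intro j
      rw [← integral_indicator_one ((S.measurableSet_X_ne u v).inter (hF' j)),
        ← integral_indicator (hF' j)]
      refine integral_congr_ae (Eventually.of_forall fun ω => ?_)
      by_cases hω : ω ∈ F j
      · have hj := (hmem j ω).1 hω
        simp only [indicator_of_mem hω]
        by_cases hne : S.X u ω = S.X v ω
        · rw [indicator_of_notMem (by simp [hne]), ← hne, show S.X u ω j = 1 from hω, sub_self]
        · rw [indicator_of_mem (show ω ∈ _ ∩ _ from ⟨hne, hω⟩), X_apply, if_neg]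
          · simp
          · intro h
            rw [X_eq, X_eq] at hne
            exact hne (by rw [hj, h])
      · rw [indicator_of_notMem hω, indicator_of_notMem (fun h => hω h.2)]
    simp only [h5]
    rw [← measureReal_iUnion_fintype]
    · congr 1
      ext ω
      simp only [mem_iUnion, mem_inter_iff, exists_and_left, hmem, exists_eq', and_true]
    · intro i j hij
      refine disjoint_left.2 fun ω h h' => hij ?_
      exact ((hmem i ω).1 h.2).symm.trans ((hmem j ω).1 h'.2)
    · intro j
      exact (S.measurableSet_X_ne u v).inter (hF' j)
  have h6 : ∑ j, P.real (F j) = 1 := by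
    rw [← measureReal_iUnion_fintype _ hF']
    · have : ⋃ j, F j = univ := by
        ext ω
        simp [hmem]
      rw [this, probReal_univ]
    · intro i j hij
      refine disjoint_left.2 fun ω h h' => hij ?_
      exact ((hmem i ω).1 h).symm.trans ((hmem j ω).1 h')
  have h7 : P.real {ω | S.X u ω ≠ S.X v ω} ≤ m * (v - u) := by
    rw [h4]
    refine (Finset.sum_le_sum fun j _ => h1 j).trans ?_
    rw [← Finset.mul_sum, h6, mul_one]
  rw [← ofReal_measureReal]
  exact ENNReal.ofReal_le_ofReal h7

open scoped Classical in
/-- The number of jumps in `(a, a + c]` is the limit of the number of changes of state along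
refining grids. -/
theorem eventually_card_jumpTimes {a c b : ℝ≥0} (hb : a + c ≤ b) (ω : Ω) :
    ∀ᶠ n : ℕ in atTop, ∑ k ∈ Finset.range (n + 1),
      (if S.X (IsStepPath.gridPt a c n k) ω = S.X (IsStepPath.gridPt a c n (k + 1)) ω
        then 0 else 1 : ℝ≥0∞) =
      ((S.jumpTimes b ω).filter fun s => s ∈ Ioc a (a + c)).card := by
  have h := (S.isStepPath ω).eventually_sum_grid (fun x y => (if x = y then 0 else 1 : ℝ≥0∞))
    (fun x => by simp) hb
  filter_upwards [h] with n hn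
  rw [hn, Finset.card_eq_sum_ones, Nat.cast_sum]
  refine Finset.sum_congr rfl fun s hs => ?_
  have h1 := (IsStepPath.mem_jumpFinset _).1 (Finset.mem_filter.1 hs).1
  rw [if_neg (fun h => h1.2 h.symm)]
  simp

theorem measurable_ite_X_eq (u v : ℝ≥0) [∀ ω, Decidable (S.X u ω = S.X v ω)] :
    Measurable fun ω => (if S.X u ω = S.X v ω then 0 else 1 : ℝ≥0∞) :=
  Measurable.ite (measurableSet_eq_fun (S.stronglyMeasurable_X u).measurable
          (S.stronglyMeasurable_X v).measurable) measurable_const measurable_const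

theorem measurable_card_jumpTimes {a c b : ℝ≥0} (hb : a + c ≤ b) :
    Measurable fun ω => (((S.jumpTimes b ω).filter fun s => s ∈ Ioc a (a + c)).card : ℝ≥0∞) := by
  classical
  refine measurable_of_tendsto_metrizable (f := fun n ω => ∑ k ∈ Finset.range (n + 1),
      (if S.X (IsStepPath.gridPt a c n k) ω = S.X (IsStepPath.gridPt a c n (k + 1)) ω
        then 0 else 1 : ℝ≥0∞)) (fun n => ?_) (tendsto_pi_nhds.2 fun ω => ?_)
  · exact Finset.measurable_sum _ fun k _ => S.measurable_ite_X_eq _ _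
  · refine tendsto_const_nhds.congr' ?_
    filter_upwards [S.eventually_card_jumpTimes hb ω] with n hn
    rw [hn]

theorem filter_jumpTimes (b : ℝ≥0) (ω : Ω) :
    (S.jumpTimes b ω).filter (fun s => s ∈ Ioc 0 (0 + b)) = S.jumpTimes b ω := by
  refine Finset.filter_true_of_mem fun s hs => ?_
  rw [zero_add]
  exact (mem_jumpTimes.1 hs).1

/-- The expected number of jumps in a bounded time interval is finite. By Fatou's lemma it is at
most the lower limit of the expected numbers of changes of state along the grids, and
`measure_X_ne_le` bounds these by the length of the interval. -/
theorem lintegral_card_jumpTimes_lt_top [IsProbabilityMeasure P] (b : ℝ≥0) :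
    ∫⁻ ω, ((S.jumpTimes b ω).card : ℝ≥0∞) ∂P < ∞ := by
  classical
  obtain ⟨m, hm0, hm⟩ := S.exists_bound
  set f : ℕ → Ω → ℝ≥0∞ := fun n ω => ∑ k ∈ Finset.range (n + 1),
      (if S.X (IsStepPath.gridPt 0 b n k) ω = S.X (IsStepPath.gridPt 0 b n (k + 1)) ω
        then 0 else 1 : ℝ≥0∞) with hf
  have hfm : ∀ n, Measurable (f n) := fun n =>
    Finset.measurable_sum _ fun k _ => S.measurable_ite_X_eq _ _
  have h1 : ∀ ω, ((S.jumpTimes b ω).card : ℝ≥0∞) = liminf (fun n => f n ω) atTop := by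
    intro ω
    symm
    refine Tendsto.liminf_eq (tendsto_const_nhds.congr' ?_)
    filter_upwards [S.eventually_card_jumpTimes (a := 0) (c := b) (b := b) (by simp) ω] with n hn
    rw [hf]
    simp only
    rw [hn, filter_jumpTimes]
  have h2 : ∀ n, ∫⁻ ω, f n ω ∂P ≤ ENNReal.ofReal (m * b) := by
    intro n
    rw [hf, lintegral_finsetSum _ fun k _ => S.measurable_ite_X_eq _ _]
    have h3 : ∀ k, ∫⁻ ω, (if S.X (IsStepPath.gridPt 0 b n k) ω =
        S.X (IsStepPath.gridPt 0 b n (k + 1)) ω then 0 else 1 : ℝ≥0∞) ∂P ≤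
        ENNReal.ofReal (m * (b / (n + 1))) := by
      intro k
      have h4 : ∀ ω, (if S.X (IsStepPath.gridPt 0 b n k) ω =
          S.X (IsStepPath.gridPt 0 b n (k + 1)) ω then 0 else 1 : ℝ≥0∞) =
          {ω | S.X (IsStepPath.gridPt 0 b n k) ω ≠
            S.X (IsStepPath.gridPt 0 b n (k + 1)) ω}.indicator 1 ω := by
        intro ω
        by_cases h : S.X (IsStepPath.gridPt 0 b n k) ω = S.X (IsStepPath.gridPt 0 b n (k + 1)) ω <;>
          simp [h]
      simp only [h4]
      rw [lintegral_indicator_one (S.measurableSet_X_ne _ _)]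
      refine (S.measure_X_ne_le hm (IsStepPath.gridPt_mono 0 b n k.le_succ)).trans ?_
      rw [Nat.succ_eq_add_one, IsStepPath.gridPt_succ]
      refine ENNReal.ofReal_le_ofReal (le_of_eq ?_)
      push_cast
      ring
    refine (Finset.sum_le_sum fun k _ => h3 k).trans ?_
    rw [Finset.sum_const, Finset.card_range, nsmul_eq_mul]
    rw [← ENNReal.ofReal_natCast, ← ENNReal.ofReal_mul (by positivity)]
    refine ENNReal.ofReal_le_ofReal (le_of_eq ?_)
    push_cast
    field_simp
  calc ∫⁻ ω, ((S.jumpTimes b ω).card : ℝ≥0∞) ∂P = ∫⁻ ω, liminf (fun n => f n ω) atTop ∂P := by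
        simp only [h1]
    _ ≤ liminf (fun n => ∫⁻ ω, f n ω ∂P) atTop := lintegral_liminf_le hfm
    _ ≤ ENNReal.ofReal (m * b) :=
        (liminf_le_liminf (Eventually.of_forall h2)).trans (by simp)
    _ < ∞ := ENNReal.ofReal_lt_top

end MarkovChain

end AnticipatedBSDE

/-! ### The measure of the jumps -/

namespace AnticipatedBSDE

open Function (leftLim)

theorem ae_prod_of_ae_ae_swap {α β : Type*} [MeasurableSpace α] [MeasurableSpace β]
    {μ : Measure α} {ν : Measure β} [SFinite μ] [SFinite ν] {p : α × β → Prop}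
    (hp : MeasurableSet {x | p x}) (h : ∀ᵐ b ∂ν, ∀ᵐ a ∂μ, p (a, b)) : ∀ᵐ x ∂μ.prod ν, p x := by
  rw [← Measure.prod_swap]
  rw [ae_map_iff measurable_swap.aemeasurable hp]
  exact (Measure.ae_prod_iff_ae_ae (measurable_swap hp)).2 h

namespace MarkovChain

variable {N : ℕ} {Ω : Type u} [MeasurableSpace Ω] {P : Measure Ω} {S : MarkovChain N P}

/-- The counting measure of the points `(s, ω)`, where `s` runs through the jump times of the path
`ω` in `(0, b]`. -/
def jumpMeasure (S : MarkovChain N P) (b : ℝ≥0) (ω : Ω) : Measure (ℝ≥0 × Ω) :=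
  ∑ s ∈ S.jumpTimes b ω, Measure.dirac (s, ω)

theorem lintegral_jumpMeasure (b : ℝ≥0) (ω : Ω) {φ : ℝ≥0 × Ω → ℝ≥0∞} (hφ : Measurable φ) :
    ∫⁻ p, φ p ∂S.jumpMeasure b ω = ∑ s ∈ S.jumpTimes b ω, φ (s, ω) := by
  rw [jumpMeasure, lintegral_finsetSum_measure]
  exact Finset.sum_congr rfl fun s _ => lintegral_dirac' _ hφ

theorem jumpMeasure_apply (b : ℝ≥0) (ω : Ω) {B : Set (ℝ≥0 × Ω)} (hB : MeasurableSet B) :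
    S.jumpMeasure b ω B = ∑ s ∈ S.jumpTimes b ω, B.indicator 1 (s, ω) := by
  rw [← lintegral_indicator_one hB, lintegral_jumpMeasure b ω (measurable_one.indicator hB)]

instance isFiniteMeasure_jumpMeasure (b : ℝ≥0) (ω : Ω) : IsFiniteMeasure (S.jumpMeasure b ω) := by
  rw [jumpMeasure]; infer_instance

/-- The number of jump times in `(0, a]` is a measurable function of the path, and the sets
`(0, a] × F` generate. -/
theorem measurable_jumpMeasure (b : ℝ≥0) : Measurable (S.jumpMeasure b) := by
  have hs : IsCountablySpanning (range (Iic : ℝ≥0 → Set ℝ≥0)) :=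
    ⟨fun n : ℕ => Iic (n : ℝ≥0), fun n => ⟨_, rfl⟩, by
      ext x
      simpa using exists_nat_ge x⟩
  have hgen : (Prod.instMeasurableSpace : MeasurableSpace (ℝ≥0 × Ω)) =
      MeasurableSpace.generateFrom (image2 (· ×ˢ ·) (range Iic) {s : Set Ω | MeasurableSet s}) := by
    refine (generateFrom_eq_prod ?_ MeasurableSpace.generateFrom_measurableSet hs
      isCountablySpanning_measurableSet).symm
    rw [← borel_eq_generateFrom_Iic, ← BorelSpace.measurable_eq]
  refine Measurable.measure_of_isPiSystem hgen
    (isPiSystem_Iic.prod MeasurableSpace.isPiSystem_measurableSet) ?_ ?_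
  · rintro _ ⟨_, ⟨a, rfl⟩, F, hF, rfl⟩
    have h1 : ∀ ω, S.jumpMeasure b ω (Iic a ×ˢ F) = F.indicator (fun ω =>
        (((S.jumpTimes b ω).filter fun s => s ∈ Ioc 0 (0 + min a b)).card : ℝ≥0∞)) ω := by
      intro ω
      rw [jumpMeasure_apply b ω (measurableSet_Iic.prod hF)]
      by_cases hω : ω ∈ F
      · rw [indicator_of_mem hω, Finset.card_eq_sum_ones, Finset.sum_filter, Nat.cast_sum]
        refine Finset.sum_congr rfl fun s hs => ?_
        have h := (mem_jumpTimes.1 hs).1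
        by_cases hsa : s ≤ a
        · rw [indicator_of_mem (show (s, ω) ∈ Iic a ×ˢ F from ⟨hsa, hω⟩),
            if_pos ⟨h.1, by simp [hsa, h.2]⟩]
          simp
        · rw [indicator_of_notMem (fun h => hsa h.1), if_neg]
          · simp
          · intro h'
            exact hsa (h'.2.trans (by simp))
      · rw [indicator_of_notMem hω]
        exact Finset.sum_eq_zero fun s _ => indicator_of_notMem (fun h => hω h.2) _
    simp only [h1]
    exact (S.measurable_card_jumpTimes (by simp)).indicator hF
  · have h1 : ∀ ω, S.jumpMeasure b ω univ =
        (((S.jumpTimes b ω).filter fun s => s ∈ Ioc 0 (0 + b)).card : ℝ≥0∞) := by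
      intro ω
      rw [jumpMeasure_apply b ω MeasurableSet.univ, filter_jumpTimes]
      simp
    simp only [h1]
    exact S.measurable_card_jumpTimes (by simp)

/-- `B ↦ E #{s ; s is a jump time in (0, b] with (s, ·) ∈ B}`. -/
def meanJumpMeasure (S : MarkovChain N P) (b : ℝ≥0) : Measure (ℝ≥0 × Ω) := P.bind (S.jumpMeasure b)

theorem lintegral_meanJumpMeasure (b : ℝ≥0) {φ : ℝ≥0 × Ω → ℝ≥0∞} (hφ : Measurable φ) :
    ∫⁻ p, φ p ∂S.meanJumpMeasure b = ∫⁻ ω, ∑ s ∈ S.jumpTimes b ω, φ (s, ω) ∂P := by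
  rw [meanJumpMeasure, Measure.lintegral_bind (S.measurable_jumpMeasure b).aemeasurable
    hφ.aemeasurable]
  simp only [lintegral_jumpMeasure b _ hφ]

theorem measurable_sum_jumpTimes (b : ℝ≥0) {φ : ℝ≥0 × Ω → ℝ≥0∞} (hφ : Measurable φ) :
    Measurable fun ω => ∑ s ∈ S.jumpTimes b ω, φ (s, ω) := by
  have h := (Measure.measurable_lintegral hφ).comp (S.measurable_jumpMeasure b)
  simpa only [Function.comp_def, lintegral_jumpMeasure b _ hφ] using h

instance isFiniteMeasure_meanJumpMeasure [IsProbabilityMeasure P] (b : ℝ≥0) :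
    IsFiniteMeasure (S.meanJumpMeasure b) := by
  refine ⟨?_⟩
  rw [← lintegral_one, lintegral_meanJumpMeasure b measurable_const]
  simpa using S.lintegral_card_jumpTimes_lt_top b

/-- A predictable version of the indicator of `{X_{s-} = e_i}`. -/
def leftX (S : MarkovChain N P) (i : Fin N) : ℝ≥0 × Ω → ℝ := leftVersion fun t ω => S.X t ω i

theorem measurable_leftX (i : Fin N) : Measurable[S.filtration.predictable] (S.leftX i) :=
  measurable_leftVersion fun t => S.adapted_X_apply t i

theorem leftX_eq {s : ℝ≥0} (hs : 0 < s) (ω : Ω) (i : Fin N) :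
    S.leftX i (s, ω) = if i = S.leftState s ω then 1 else 0 := by
  refine leftVersion_eq hs (tendsto_const_nhds.congr' ?_)
  filter_upwards [(S.isStepPath ω).left s] with r hr
  rw [hr, leftLim_X_eq, Pi.single_apply]

/-- Every path has finitely many jumps, so it does not jump at almost every time. -/
theorem ae_leftState_eq (b : ℝ≥0) (ω : Ω) :
    ∀ᵐ s ∂(volume : Measure ℝ≥0).restrict (Ioc 0 b), S.leftState s ω = S.state s ω := by
  rw [ae_restrict_iff' measurableSet_Ioc]
  have h : ∀ᵐ s ∂(volume : Measure ℝ≥0), s ∉ (S.jumpTimes b ω : Set ℝ≥0) :=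
    measure_eq_zero_iff_ae_notMem.1 ((S.jumpTimes b ω).finite_toSet.measure_zero _)
  filter_upwards [h] with s hs hsI using leftState_eq_of_notMem hs hsI

theorem ae_leftX_eq [IsFiniteMeasure P] (b : ℝ≥0) (i : Fin N) :
    ∀ᵐ p ∂((volume : Measure ℝ≥0).restrict (Ioc 0 b)).prod P, S.leftX i p = S.X p.1 p.2 i := by
  refine ae_prod_of_ae_ae_swap ?_ (Eventually.of_forall fun ω => ?_)
  · exact measurableSet_eq_fun ((S.measurable_leftX i).mono predictable_le le_rfl)
      ((measurable_pi_apply i).comp S.measurable_X_prod)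
  · filter_upwards [S.ae_leftState_eq b ω, ae_restrict_mem measurableSet_Ioc] with s hs hsI
    rw [leftX_eq hsI.1, X_apply, hs]

/-- A coordinate of the chain is the sum of its jumps. -/
theorem sum_jumps_eq {u b : ℝ≥0} (hub : u ≤ b) (ω : Ω) (i : Fin N) :
    ∑ s ∈ S.jumpTimes b ω with u < s, (S.X s ω i - S.leftX i (s, ω)) = S.X b ω i - S.X u ω i := by
  have h := (S.isStepPath ω).eventually_sum_grid (fun x y : Fin N → ℝ => y i - x i)
    (fun x => sub_self _) (a := u) (c := b - u) (b := b) (by rw [add_tsub_cancel_of_le hub])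
  obtain ⟨n, hn⟩ := h.exists
  rw [Finset.sum_range_sub (fun k => S.X (IsStepPath.gridPt u (b - u) n k) ω i),
    IsStepPath.gridPt_last, IsStepPath.gridPt_zero, add_tsub_cancel_of_le hub] at hn
  rw [hn]
  have hfil : (S.jumpTimes b ω).filter (fun s => u < s) =
      (S.jumpTimes b ω).filter fun s => s ∈ Ioc u b :=
    Finset.filter_congr fun s hs => ⟨fun h => ⟨h, (mem_jumpTimes.1 hs).1.2⟩, fun h => h.1⟩
  rw [hfil]
  refine Finset.sum_congr rfl fun s hs => ?_
  rw [leftX_eq (mem_jumpTimes.1 (Finset.mem_filter.1 hs).1).1.1, leftLim_X_eq, Pi.single_apply]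

/-- The identity `sum_jumps_eq` split into positive and negative parts, so that it can be integrated
without subtraction. -/
theorem sum_ofReal_jumps_add {u b : ℝ≥0} (hub : u ≤ b) (ω : Ω) (i : Fin N) :
    ∑ s ∈ S.jumpTimes b ω with u < s, ENNReal.ofReal (S.X s ω i - S.leftX i (s, ω)) +
        ENNReal.ofReal (S.X u ω i) =
      ∑ s ∈ S.jumpTimes b ω with u < s, ENNReal.ofReal (-(S.X s ω i - S.leftX i (s, ω))) +
        ENNReal.ofReal (S.X b ω i) := by
  have h1 : ∀ x : ℝ, ENNReal.ofReal x = ENNReal.ofReal (max x 0) := fun x => by simp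
  have h0 := S.sum_jumps_eq hub ω i
  set D := (S.jumpTimes b ω).filter fun s => u < s
  set f : ℝ≥0 → ℝ := fun s => S.X s ω i - S.leftX i (s, ω) with hf
  have h2 : ∑ s ∈ D, max (f s) 0 - ∑ s ∈ D, max (-(f s)) 0 = ∑ s ∈ D, f s := by
    rw [← Finset.sum_sub_distrib]
    exact Finset.sum_congr rfl fun s _ => max_zero_sub_max_neg_zero_eq_self _
  change ∑ s ∈ D, ENNReal.ofReal (f s) + _ = ∑ s ∈ D, ENNReal.ofReal (-(f s)) + _
  rw [Finset.sum_congr rfl fun s _ => h1 (f s), Finset.sum_congr rfl fun s _ => h1 (-(f s)),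
    ← ENNReal.ofReal_sum_of_nonneg fun _ _ => le_max_right _ _,
    ← ENNReal.ofReal_sum_of_nonneg fun _ _ => le_max_right _ _,
    ← ENNReal.ofReal_add (Finset.sum_nonneg fun _ _ => le_max_right _ _) (S.X_nonneg _ _ _),
    ← ENNReal.ofReal_add (Finset.sum_nonneg fun _ _ => le_max_right _ _) (S.X_nonneg _ _ _)]
  congr 1
  linarith

/-- The martingale property of `M`, split into its positive and negative parts. -/
theorem lintegral_X_add [IsProbabilityMeasure P] {u b : ℝ≥0} (hub : u ≤ b) {F : Set Ω}
    (hF : MeasurableSet[S.filtration u] F) (i : Fin N) :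
    ∫⁻ ω in F, ENNReal.ofReal (S.X b ω i) ∂P +
        ∫⁻ ω in F, (∫⁻ r in Ioc u b, ENNReal.ofReal (-(S.A r *ᵥ S.X r ω) i)) ∂P =
      ∫⁻ ω in F, ENNReal.ofReal (S.X u ω i) ∂P +
        ∫⁻ ω in F, (∫⁻ r in Ioc u b, ENNReal.ofReal ((S.A r *ᵥ S.X r ω) i)) ∂P := by
  have hint := S.integrable_mulVec_X u b F i
  have hm : Measurable fun p : Ω × ℝ≥0 => (S.A p.2 *ᵥ S.X p.2 p.1) i :=
    (S.measurable_mulVec_X i).comp measurable_swap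
  have h1 := S.setIntegral_X_sub hub hF i
  rw [integral_sub (S.integrable_X b i).integrableOn (S.integrable_X u i).integrableOn,
    ← integral_prod _ hint, integral_eq_lintegral_pos_part_sub_lintegral_neg_part hint,
    integral_eq_lintegral_of_nonneg_ae (Eventually.of_forall fun ω => S.X_nonneg b ω i)
      (S.measurable_X_apply b i).aestronglyMeasurable,
    integral_eq_lintegral_of_nonneg_ae (Eventually.of_forall fun ω => S.X_nonneg u ω i)
      (S.measurable_X_apply u i).aestronglyMeasurable,
    lintegral_prod _ hm.ennreal_ofReal.aemeasurable,
    lintegral_prod (fun p : Ω × ℝ≥0 => ENNReal.ofReal (-(S.A p.2 *ᵥ S.X p.2 p.1) i))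
      hm.neg.ennreal_ofReal.aemeasurable] at h1
  have f1 : ∀ t, ∫⁻ ω in F, ENNReal.ofReal (S.X t ω i) ∂P ≠ ∞ := fun t =>
    ((S.integrable_X t i).integrableOn (s := F)).lintegral_lt_top.ne
  have f2 : ∫⁻ ω in F, (∫⁻ r in Ioc u b, ENNReal.ofReal ((S.A r *ᵥ S.X r ω) i)) ∂P ≠ ∞ := by
    rw [← lintegral_prod (fun p : Ω × ℝ≥0 => ENNReal.ofReal ((S.A p.2 *ᵥ S.X p.2 p.1) i))
      hm.ennreal_ofReal.aemeasurable]
    exact hint.lintegral_lt_top.ne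
  have f3 : ∫⁻ ω in F, (∫⁻ r in Ioc u b, ENNReal.ofReal (-(S.A r *ᵥ S.X r ω) i)) ∂P ≠ ∞ := by
    rw [← lintegral_prod (fun p : Ω × ℝ≥0 => ENNReal.ofReal (-(S.A p.2 *ᵥ S.X p.2 p.1) i))
      hm.neg.ennreal_ofReal.aemeasurable]
    exact hint.neg.lintegral_lt_top.ne
  rw [← ENNReal.toReal_eq_toReal_iff' (ENNReal.add_ne_top.2 ⟨f1 b, f3⟩)
    (ENNReal.add_ne_top.2 ⟨f1 u, f2⟩), ENNReal.toReal_add (f1 b) f3, ENNReal.toReal_add (f1 u) f2]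
  linarith

end MarkovChain

end AnticipatedBSDE

/-! ### The compensator of the jumps on predictable sets -/

namespace AnticipatedBSDE

open Function (leftLim)

namespace MarkovChain

variable {N : ℕ} {Ω : Type u} [MeasurableSpace Ω] {P : Measure Ω} {S : MarkovChain N P}

/-- Lebesgue measure on `(0, b]` times `P`. -/
def timeMeasure (P : Measure Ω) (b : ℝ≥0) : Measure (ℝ≥0 × Ω) :=
  ((volume : Measure ℝ≥0).restrict (Ioc 0 b)).prod P

instance isFiniteMeasure_timeMeasure [IsFiniteMeasure P] (b : ℝ≥0) :
    IsFiniteMeasure (timeMeasure P b) := by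
  rw [timeMeasure]; infer_instance

theorem lintegral_timeMeasure [SFinite P] (b : ℝ≥0) {φ : ℝ≥0 × Ω → ℝ≥0∞} (hφ : Measurable φ) :
    ∫⁻ p, φ p ∂timeMeasure P b = ∫⁻ ω, (∫⁻ s in Ioc 0 b, φ (s, ω)) ∂P :=
  lintegral_prod_symm _ hφ.aemeasurable

/-- The jump of the `i`-th coordinate. -/
def jump (S : MarkovChain N P) (i : Fin N) (p : ℝ≥0 × Ω) : ℝ := S.X p.1 p.2 i - S.leftX i p

/-- The density `(A X)_i` of the compensator of the `i`-th coordinate. -/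
def drift (S : MarkovChain N P) (i : Fin N) (p : ℝ≥0 × Ω) : ℝ := (S.A p.1 *ᵥ S.X p.1 p.2) i

theorem measurable_jump (i : Fin N) : Measurable (S.jump i) :=
  ((measurable_pi_apply i).comp S.measurable_X_prod).sub
    ((S.measurable_leftX i).mono predictable_le le_rfl)

theorem measurable_drift (i : Fin N) : Measurable (S.drift i) := S.measurable_mulVec_X i

theorem setLIntegral_meanJumpMeasure {b u : ℝ≥0} {F : Set Ω} (hF : MeasurableSet F)
    {φ : ℝ≥0 × Ω → ℝ≥0∞} (hφ : Measurable φ) :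
    ∫⁻ p in Ioi u ×ˢ F, φ p ∂S.meanJumpMeasure b =
      ∫⁻ ω in F, (∑ s ∈ S.jumpTimes b ω with u < s, φ (s, ω)) ∂P := by
  have hB : MeasurableSet (Ioi u ×ˢ F) := measurableSet_Ioi.prod hF
  rw [← lintegral_indicator hB, lintegral_meanJumpMeasure b (hφ.indicator hB),
    ← lintegral_indicator hF]
  refine lintegral_congr fun ω => ?_
  by_cases hω : ω ∈ F
  · rw [indicator_of_mem hω, Finset.sum_filter]
    refine Finset.sum_congr rfl fun s _ => ?_
    by_cases hs : u < s
    · rw [indicator_of_mem (show (s, ω) ∈ Ioi u ×ˢ F from ⟨hs, hω⟩), if_pos hs]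
    · rw [indicator_of_notMem (fun h => hs h.1), if_neg hs]
  · rw [indicator_of_notMem hω]
    exact Finset.sum_eq_zero fun s _ => indicator_of_notMem (fun h => hω h.2) _

theorem setLIntegral_timeMeasure [SFinite P] {b u : ℝ≥0} {F : Set Ω}
    {φ : ℝ≥0 × Ω → ℝ≥0∞} (hφ : Measurable φ) :
    ∫⁻ p in Ioi u ×ˢ F, φ p ∂timeMeasure P b = ∫⁻ ω in F, (∫⁻ s in Ioc u b, φ (s, ω)) ∂P := by
  rw [timeMeasure, ← Measure.prod_restrict, Measure.restrict_restrict measurableSet_Ioi,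
    lintegral_prod_symm _ hφ.aemeasurable]
  have : Ioi u ∩ Ioc 0 b = Ioc u b := by
    ext s
    exact ⟨fun h => ⟨h.1, h.2.2⟩, fun h => ⟨h.1, pos_of_gt h.1, h.2⟩⟩
  rw [this]

theorem meanJumpMeasure_singleton_prod (b : ℝ≥0) {F : Set Ω} (hF : MeasurableSet F) :
    S.meanJumpMeasure b ({⊥} ×ˢ F) = 0 := by
  have hB : MeasurableSet (({⊥} : Set ℝ≥0) ×ˢ F) := (measurableSet_singleton _).prod hF
  rw [← lintegral_indicator_one hB, lintegral_meanJumpMeasure b (measurable_one.indicator hB)]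
  simp only [lintegral_eq_zero_iff'
    (S.measurable_sum_jumpTimes b (measurable_one.indicator hB)).aemeasurable]
  refine Eventually.of_forall fun ω => Finset.sum_eq_zero fun s hs => indicator_of_notMem ?_ _
  exact fun h => (mem_jumpTimes.1 hs).1.1.ne' h.1

theorem timeMeasure_singleton_prod [SFinite P] (b : ℝ≥0) (F : Set Ω) :
    timeMeasure P b ({⊥} ×ˢ F) = 0 := by
  rw [timeMeasure, Measure.prod_prod]
  simp

/-- The compensation of the jumps on the generators `(u, ∞) × F`, `F ∈ ℱ_u`, of the predictable
`σ`-algebra: this is the martingale property of `M`. -/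
theorem setLIntegral_jump_Ioi [IsProbabilityMeasure P] {b u : ℝ≥0} {F : Set Ω}
    (hF : MeasurableSet[S.filtration u] F) (i : Fin N) :
    ∫⁻ p in Ioi u ×ˢ F, ENNReal.ofReal (S.jump i p) ∂S.meanJumpMeasure b +
        ∫⁻ p in Ioi u ×ˢ F, ENNReal.ofReal (-S.drift i p) ∂timeMeasure P b =
      ∫⁻ p in Ioi u ×ˢ F, ENNReal.ofReal (-S.jump i p) ∂S.meanJumpMeasure b +
        ∫⁻ p in Ioi u ×ˢ F, ENNReal.ofReal (S.drift i p) ∂timeMeasure P b := by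
  have hF' := S.filtration.le u _ hF
  have hj := S.measurable_jump i
  have hd := S.measurable_drift i
  rw [setLIntegral_meanJumpMeasure hF' hj.ennreal_ofReal,
    setLIntegral_meanJumpMeasure hF' (φ := fun p => ENNReal.ofReal (-S.jump i p))
      hj.neg.ennreal_ofReal,
    setLIntegral_timeMeasure hd.ennreal_ofReal,
    setLIntegral_timeMeasure (φ := fun p => ENNReal.ofReal (-S.drift i p)) hd.neg.ennreal_ofReal]
  rcases le_or_gt u b with hub | hub
  · have h1 := S.lintegral_X_add hub hF i
    have hX : ∀ t, Measurable fun ω => ENNReal.ofReal (S.X t ω i) := fun t =>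
      (S.measurable_X_apply t i).ennreal_ofReal
    have h2 := lintegral_congr (μ := P.restrict F) fun ω => S.sum_ofReal_jumps_add hub ω i
    rw [lintegral_add_right _ (hX u), lintegral_add_right _ (hX b)] at h2
    have hfin : ∫⁻ ω in F, ENNReal.ofReal (S.X u ω i) ∂P ≠ ∞ :=
      ((S.integrable_X u i).integrableOn (s := F)).lintegral_lt_top.ne
    simp only [jump, drift]
    refine (ENNReal.add_left_inj hfin).1 ?_
    rw [add_right_comm, h2, add_assoc, add_assoc, h1]
    exact congrArg _ (add_comm _ _)
  · have h1 : ∀ ω, (S.jumpTimes b ω).filter (fun s => u < s) = ∅ := fun ω =>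
      Finset.filter_false_of_mem fun s hs => not_lt.2 ((mem_jumpTimes.1 hs).1.2.trans hub.le)
    simp [h1, Ioc_eq_empty_of_le hub.le]

/-- The jumps of the chain are compensated by the drift on all predictable sets. Both sides are
finite measures on the predictable `σ`-algebra which agree on the `π`-system of its generators. The
positive and negative parts are on different sides, so that no measure has to be signed. -/
theorem setLIntegral_jump [IsProbabilityMeasure P] (b : ℝ≥0) (i : Fin N) {B : Set (ℝ≥0 × Ω)}
    (hB : MeasurableSet[S.filtration.predictable] B) :
    ∫⁻ p in B, ENNReal.ofReal (S.jump i p) ∂S.meanJumpMeasure b +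
        ∫⁻ p in B, ENNReal.ofReal (-S.drift i p) ∂timeMeasure P b =
      ∫⁻ p in B, ENNReal.ofReal (-S.jump i p) ∂S.meanJumpMeasure b +
        ∫⁻ p in B, ENNReal.ofReal (S.drift i p) ∂timeMeasure P b := by
  obtain ⟨m, hm0, hm⟩ := S.exists_bound
  set μ := S.meanJumpMeasure b
  set ν := timeMeasure P b
  have hj := S.measurable_jump i
  have hd := S.measurable_drift i
  have hB' := predictable_le _ hB
  set ρ₁ := μ.withDensity (fun p => ENNReal.ofReal (S.jump i p)) +
    ν.withDensity (fun p => ENNReal.ofReal (-S.drift i p)) with hρ₁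
  set ρ₂ := μ.withDensity (fun p => ENNReal.ofReal (-S.jump i p)) +
    ν.withDensity (fun p => ENNReal.ofReal (S.drift i p)) with hρ₂
  have e1 : ∀ s, MeasurableSet s → ρ₁ s = ∫⁻ p in s, ENNReal.ofReal (S.jump i p) ∂μ +
      ∫⁻ p in s, ENNReal.ofReal (-S.drift i p) ∂ν := fun s hs => by
    rw [hρ₁, Measure.add_apply, withDensity_apply _ hs, withDensity_apply _ hs]
  have e2 : ∀ s, MeasurableSet s → ρ₂ s = ∫⁻ p in s, ENNReal.ofReal (-S.jump i p) ∂μ +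
      ∫⁻ p in s, ENNReal.ofReal (S.drift i p) ∂ν := fun s hs => by
    rw [hρ₂, Measure.add_apply, withDensity_apply _ hs, withDensity_apply _ hs]
  -- time `0` carries no mass: there are no jumps at `0`
  have z : ∀ F, MeasurableSet F → ρ₁ ({⊥} ×ˢ F) = 0 ∧ ρ₂ ({⊥} ×ˢ F) = 0 := by
    intro F hF
    have hm : MeasurableSet (({⊥} : Set ℝ≥0) ×ˢ F) := (measurableSet_singleton _).prod hF
    have h1 : μ ({⊥} ×ˢ F) = 0 := S.meanJumpMeasure_singleton_prod b hF
    have h2 : ν ({⊥} ×ˢ F) = 0 := timeMeasure_singleton_prod b F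
    rw [e1 _ hm, e2 _ hm]
    simp only [setLIntegral_measure_zero _ _ h1, setLIntegral_measure_zero _ _ h2, add_zero,
      and_self]
  -- the jumps and the drift are bounded, and both reference measures are finite
  have hfin : IsFiniteMeasure ρ₁ := by
    have h1 : IsFiniteMeasure (μ.withDensity (fun p => ENNReal.ofReal (S.jump i p))) := by
      refine isFiniteMeasure_withDensity_ofReal ?_
      refine ((Integrable.of_bound hj.aestronglyMeasurable (1 + 1)
        ?_ : Integrable (S.jump i) μ)).2
      rw [ae_iff]
      have hms : MeasurableSet {p | ¬ ‖S.jump i p‖ ≤ 1 + 1} :=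
        (measurableSet_le hj.norm measurable_const).compl
      rw [← lintegral_indicator_one hms, lintegral_meanJumpMeasure b (measurable_one.indicator hms),
        lintegral_eq_zero_iff' (S.measurable_sum_jumpTimes b
          (measurable_one.indicator hms)).aemeasurable]
      refine Eventually.of_forall fun ω => Finset.sum_eq_zero fun s hs => indicator_of_notMem ?_ _
      simp only [mem_ofPred_eq, not_not]
      refine (norm_sub_le _ _).trans (add_le_add (S.abs_X_le _ _ _) ?_)
      rw [leftX_eq (mem_jumpTimes.1 hs).1.1]
      split_ifs <;> simp
    have h2 : IsFiniteMeasure (ν.withDensity (fun p => ENNReal.ofReal (-S.drift i p))) := by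
      refine isFiniteMeasure_withDensity_ofReal ?_
      refine ((Integrable.of_bound hd.neg.aestronglyMeasurable m
        (Eventually.of_forall fun p => ?_) : Integrable (fun p => -S.drift i p) ν)).2
      rw [norm_neg]
      exact abs_mulVec_X_le hm _ _ _
    rw [hρ₁]; infer_instance
  rw [← e1 B hB', ← e2 B hB']
  refine ext_on_measurableSpace_of_generate_finite (m := S.filtration.predictable)
    Prod.instMeasurableSpace ({s | ∃ A, MeasurableSet[S.filtration ⊥] A ∧ s = {⊥} ×ˢ A} ∪
      {s | ∃ i A, MeasurableSet[S.filtration i] A ∧ s = Set.Ioi i ×ˢ A})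
    ?_ predictable_le rfl ?_ ?_ hB
  · rintro _ (⟨F, hF, rfl⟩ | ⟨u, F, hF, rfl⟩)
    · rw [(z F (S.filtration.le _ _ hF)).1, (z F (S.filtration.le _ _ hF)).2]
    · have hm := (measurableSet_Ioi (a := u)).prod (S.filtration.le _ _ hF)
      rw [e1 _ hm, e2 _ hm]
      exact setLIntegral_jump_Ioi hF i
  · rintro _ (⟨F, hF, rfl⟩ | ⟨u, F, hF, rfl⟩) _ (⟨G, hG, rfl⟩ | ⟨v, G, hG, rfl⟩) hne
    · exact Or.inl ⟨F ∩ G, hF.inter hG, by rw [prod_inter_prod, inter_self]⟩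
    · obtain ⟨p, hp⟩ := hne
      exact absurd (show v < p.1 from hp.2.1) (by rw [show p.1 = ⊥ from hp.1.1]; exact not_lt_bot)
    · obtain ⟨p, hp⟩ := hne
      exact absurd (show u < p.1 from hp.1.1) (by rw [show p.1 = ⊥ from hp.2.1]; exact not_lt_bot)
    · refine Or.inr ⟨max u v, F ∩ G, ?_, by rw [prod_inter_prod, Ioi_inter_Ioi]⟩
      exact (S.filtration.mono (le_max_left u v) _ hF).inter
        (S.filtration.mono (le_max_right u v) _ hG)
  · have hu : (univ : Set (ℝ≥0 × Ω)) = ({⊥} ×ˢ univ) ∪ (Ioi 0 ×ˢ univ) := by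
      rw [← union_prod]
      ext ⟨s, ω⟩
      simp
    have hdis : Disjoint (({⊥} : Set ℝ≥0) ×ˢ (univ : Set Ω)) (Ioi 0 ×ˢ univ) := by
      refine disjoint_left.2 fun p h h' => ?_
      exact absurd (show 0 < p.1 from h'.1) (by rw [show p.1 = ⊥ from h.1]; exact not_lt_bot)
    have hm : MeasurableSet ((Ioi 0 : Set ℝ≥0) ×ˢ (univ : Set Ω)) :=
      measurableSet_Ioi.prod MeasurableSet.univ
    rw [hu, measure_union hdis hm, measure_union hdis hm, (z univ .univ).1, (z univ .univ).2,
      zero_add, zero_add, e1 _ hm, e2 _ hm]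
    exact setLIntegral_jump_Ioi MeasurableSet.univ i

end MarkovChain

end AnticipatedBSDE

/-! ### The compensation formula -/

namespace AnticipatedBSDE

open Function (leftLim)

namespace MarkovChain

variable {N : ℕ} {Ω : Type u} [MeasurableSpace Ω] {P : Measure Ω} {S : MarkovChain N P}

/-- The compensator of the jumps from `e_j` to `e_i` has density `A_ij 1{X = e_j}`: restrict the
compensation formula of the coordinate `i` to the predictable set `{X_- = e_j}`. -/
theorem lintegral_jump_pair [IsProbabilityMeasure P] (b : ℝ≥0) {i j : Fin N} (hij : i ≠ j)
    {h : ℝ≥0 × Ω → ℝ≥0∞} (hh : Measurable[S.filtration.predictable] h) :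
    ∫⁻ ω, ∑ s ∈ S.jumpTimes b ω,
        (if S.state s ω = i ∧ S.leftState s ω = j then h (s, ω) else 0) ∂P =
      ∫⁻ ω, (∫⁻ s in Ioc 0 b,
        (if S.state s ω = j then ENNReal.ofReal (S.A s i j) * h (s, ω) else 0)) ∂P := by
  set μ := S.meanJumpMeasure b with hμ
  set ν := timeMeasure P b with hν
  have hLm : MeasurableSet[S.filtration.predictable] (S.leftX j ⁻¹' {1}) :=
    S.measurable_leftX j (measurableSet_singleton 1)
  set Lj : Set (ℝ≥0 × Ω) := S.leftX j ⁻¹' {1} with hLj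
  have hL' := predictable_le _ hLm
  have hmem : ∀ s ω, 0 < s → ((s, ω) ∈ Lj ↔ S.leftState s ω = j) := by
    intro s ω hs
    rw [hLj, mem_preimage, leftX_eq hs, mem_singleton_iff]
    split_ifs with h
    · simp [h]
    · simp [Ne.symm h]
  have hhm : Measurable h := hh.mono predictable_le le_rfl
  have hjm := S.measurable_jump i
  have hjneg : Measurable fun p => ENNReal.ofReal (-S.jump i p) := hjm.neg.ennreal_ofReal
  have hdneg : Measurable fun p => ENNReal.ofReal (-S.drift i p) :=
    (S.measurable_drift i).neg.ennreal_ofReal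
  have hAm : Measurable fun p : ℝ≥0 × Ω =>
      (if S.state p.1 p.2 = j then ENNReal.ofReal (S.A p.1 i j) else 0) :=
    Measurable.ite (S.measurable_state (measurableSet_singleton j))
      ((S.measurable_A i j).comp measurable_fst).ennreal_ofReal measurable_const
  set g₁ : ℝ≥0 × Ω → ℝ≥0∞ := Lj.indicator fun p => ENNReal.ofReal (S.jump i p) with hg₁
  have hg₁m : Measurable g₁ := hjm.ennreal_ofReal.indicator hL'
  set g₂ : ℝ≥0 × Ω → ℝ≥0∞ := fun p =>
    (if S.state p.1 p.2 = j then ENNReal.ofReal (S.A p.1 i j) else 0) with hg₂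
  have hsets : ∀ B, MeasurableSet[S.filtration.predictable] B →
      ∫⁻ p in B, g₁ p ∂μ = ∫⁻ p in B, g₂ p ∂ν := by
    intro B hB
    have hB' := predictable_le _ hB
    have h0 := S.setLIntegral_jump b i (hB.inter hLm)
    -- while `X_- = e_j` the coordinate `i ≠ j` can only jump upwards, at a nonnegative rate
    have n1 : ∫⁻ p in B ∩ Lj, ENNReal.ofReal (-S.jump i p) ∂μ = 0 := by
      rw [← lintegral_indicator (hB'.inter hL'), hμ, lintegral_meanJumpMeasure b
        (hjneg.indicator (hB'.inter hL'))]
      refine (lintegral_congr fun ω => ?_).trans lintegral_zero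
      refine Finset.sum_eq_zero fun s hs => ?_
      by_cases hp : (s, ω) ∈ B ∩ Lj
      · have hs0 := (mem_jumpTimes.1 hs).1.1
        rw [indicator_of_mem hp, jump, leftX_eq hs0, (hmem s ω hs0).1 hp.2, if_neg hij, sub_zero,
          ENNReal.ofReal_eq_zero, neg_nonpos]
        exact S.X_nonneg _ _ _
      · exact indicator_of_notMem hp _
    have hae : ∀ᵐ p ∂ν, p ∈ Lj ↔ S.state p.1 p.2 = j := by
      filter_upwards [S.ae_leftX_eq b j] with p hp
      rw [hLj, mem_preimage, hp, mem_singleton_iff, X_apply]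
      split_ifs with h
      · simp [h]
      · simp [Ne.symm h]
    have n2 : ∫⁻ p in B ∩ Lj, ENNReal.ofReal (-S.drift i p) ∂ν = 0 := by
      rw [lintegral_eq_zero_iff hdneg]
      filter_upwards [ae_restrict_mem (hB'.inter hL'), ae_restrict_of_ae hae] with p hp hp'
      have := hp'.1 hp.2
      simp only [drift, mulVec_X, this, Pi.zero_apply, ENNReal.ofReal_eq_zero, neg_nonpos]
      exact S.A_nonneg _ _ _ hij
    have n3 : ∫⁻ p in B ∩ Lj, ENNReal.ofReal (S.drift i p) ∂ν = ∫⁻ p in B, g₂ p ∂ν := by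
      rw [inter_comm, ← setLIntegral_indicator hL']
      refine lintegral_congr_ae (ae_restrict_of_ae ?_)
      filter_upwards [hae] with p hp
      by_cases hpL : p ∈ Lj
      · rw [indicator_of_mem hpL, hg₂]
        simp only [hp.1 hpL, if_true, drift, mulVec_X]
      · rw [indicator_of_notMem hpL, hg₂]
        simp only [if_neg (fun h => hpL (hp.2 h))]
    rw [n1, n2, n3, add_zero, zero_add] at h0
    rw [← h0, hg₁, setLIntegral_indicator hL', inter_comm]
  -- the two measures agree on predictable sets, so their integrals of predictable functions agree
  have hmeas : (μ.withDensity g₁).trim predictable_le =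
      (ν.withDensity g₂).trim (predictable_le (𝓕 := S.filtration)) := by
    refine @Measure.ext _ S.filtration.predictable _ _ fun B hB => ?_
    rw [trim_measurableSet_eq _ hB, trim_measurableSet_eq _ hB,
      withDensity_apply _ (predictable_le _ hB), withDensity_apply _ (predictable_le _ hB),
      hsets B hB]
  have hfun : ∫⁻ p, (g₁ * h) p ∂μ = ∫⁻ p, (g₂ * h) p ∂ν := by
    rw [← lintegral_withDensity_eq_lintegral_mul _ hg₁m hhm,
      ← lintegral_withDensity_eq_lintegral_mul _ hAm hhm,
      ← lintegral_trim (predictable_le (𝓕 := S.filtration)) hh, hmeas, lintegral_trim _ hh]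
  rw [hμ, hν, lintegral_meanJumpMeasure b (hg₁m.mul hhm),
    lintegral_timeMeasure b (hAm.mul hhm)] at hfun
  simp only [Pi.mul_apply] at hfun
  refine Eq.trans (lintegral_congr fun ω => Finset.sum_congr rfl fun s hs => ?_)
    (hfun.trans (lintegral_congr fun ω => lintegral_congr fun s => ?_))
  · have hs0 := (mem_jumpTimes.1 hs).1.1
    by_cases hj : S.leftState s ω = j
    · rw [hg₁, indicator_of_mem ((hmem s ω hs0).2 hj), jump, leftX_eq hs0, hj, if_neg hij, sub_zero,
        X_apply]
      by_cases hi : S.state s ω = i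
      · simp [hi]
      · simp [hi, Ne.symm hi]
    · rw [hg₁, indicator_of_notMem (fun h => hj ((hmem s ω hs0).1 h)), zero_mul, if_neg]
      exact fun h => hj h.2
  · rw [hg₂]
    simp only [ite_mul, zero_mul]

theorem A_self_nonpos (t : ℝ≥0) (j : Fin N) : S.A t j j ≤ 0 := by
  have h := S.A_sum t j
  rw [← Finset.add_sum_erase _ _ (Finset.mem_univ j)] at h
  have : 0 ≤ ∑ i ∈ Finset.univ.erase j, S.A t i j :=
    Finset.sum_nonneg fun i hi => S.A_nonneg _ _ _ (Finset.ne_of_mem_erase hi)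
  linarith

/-- The jump `Z_s' ΔX_s` of the stochastic integral of `Z`. -/
def jumpOf (S : MarkovChain N P) (Z : ℝ≥0 → Ω → Fin N → ℝ) (s : ℝ≥0) (ω : Ω) : ℝ :=
  Z s ω (S.state s ω) - Z s ω (S.leftState s ω)

theorem dotProduct_jump (Z : ℝ≥0 → Ω → Fin N → ℝ) (s : ℝ≥0) (ω : Ω) :
    Z s ω ⬝ᵥ (S.X s ω - leftLim (fun r => S.X r ω) s) = S.jumpOf Z s ω := by
  rw [leftLim_X_eq, X_eq, dotProduct_sub, dotProduct_single_one, dotProduct_single_one, jumpOf]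

/-- The compensation formula for functions of the jumps `Z' ΔX`, for predictable `Z`. The
term of the current state on the right vanishes, because the diagonal rates are not positive. -/
theorem lintegral_sum_jumpTimes [IsProbabilityMeasure P] (b : ℝ≥0) (Z : ℝ≥0 → Ω → Fin N → ℝ)
    (g : ℝ≥0 → Ω → ℝ → ℝ≥0∞)
    (hg : ∀ i j, Measurable[S.filtration.predictable]
      fun p : ℝ≥0 × Ω => g p.1 p.2 (Z p.1 p.2 i - Z p.1 p.2 j)) :
    ∫⁻ ω, ∑ s ∈ S.jumpTimes b ω, g s ω (S.jumpOf Z s ω) ∂P =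
      ∫⁻ ω, (∫⁻ s in Ioc 0 b, ∑ i, ENNReal.ofReal (S.A s i (S.state s ω)) *
        g s ω (Z s ω i - Z s ω (S.state s ω))) ∂P := by
  set G : Fin N × Fin N → ℝ≥0 × Ω → ℝ≥0∞ := fun q p =>
    g p.1 p.2 (Z p.1 p.2 q.1 - Z p.1 p.2 q.2) with hG
  have hGm : ∀ q, Measurable (G q) := fun q => (hg q.1 q.2).mono predictable_le le_rfl
  -- the pairs (new state, old state) of a jump
  set O : Finset (Fin N × Fin N) := Finset.univ.filter fun q => q.1 ≠ q.2 with hO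
  have m1 : ∀ q : Fin N × Fin N, Measurable fun ω => ∑ s ∈ S.jumpTimes b ω,
      (if S.state s ω = q.1 ∧ S.leftState s ω = q.2 then G q (s, ω) else 0) := by
    intro q
    have h1 : Measurable fun p : ℝ≥0 × Ω =>
        (if S.state p.1 p.2 = q.1 ∧ S.leftX q.2 p = 1 then G q p else 0) :=
      Measurable.ite ((S.measurable_state (measurableSet_singleton q.1)).inter
        (((S.measurable_leftX q.2).mono predictable_le le_rfl) (measurableSet_singleton 1)))
        (hGm q) measurable_const
    have h2 := S.measurable_sum_jumpTimes b h1
    convert h2 using 2 with ω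
    refine Finset.sum_congr rfl fun s hs => ?_
    have : S.leftX q.2 (s, ω) = 1 ↔ S.leftState s ω = q.2 := by
      rw [leftX_eq (mem_jumpTimes.1 hs).1.1]
      split_ifs with h
      · simp [h]
      · simp [Ne.symm h]
    simp only [this]
  have m2 : ∀ q : Fin N × Fin N, Measurable fun p : ℝ≥0 × Ω => (if S.state p.1 p.2 = q.2 then
      ENNReal.ofReal (S.A p.1 q.1 q.2) * G q p else 0) := fun q =>
    Measurable.ite (S.measurable_state (measurableSet_singleton q.2))
      (((S.measurable_A q.1 q.2).comp measurable_fst).ennreal_ofReal.mul (hGm q)) measurable_const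
  have e1 : ∀ ω, ∑ s ∈ S.jumpTimes b ω, g s ω (S.jumpOf Z s ω) =
      ∑ q ∈ O, ∑ s ∈ S.jumpTimes b ω,
        (if S.state s ω = q.1 ∧ S.leftState s ω = q.2 then G q (s, ω) else 0) := by
    intro ω
    rw [Finset.sum_comm]
    refine Finset.sum_congr rfl fun s hs => ?_
    rw [Finset.sum_eq_single (S.state s ω, S.leftState s ω)]
    · simp [hG, jumpOf]
    · intro q _ hq
      rw [if_neg]
      rintro ⟨h1, h2⟩
      exact hq (Prod.ext h1.symm h2.symm)
    · intro h
      refine absurd ?_ h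
      rw [hO, Finset.mem_filter]
      exact ⟨Finset.mem_univ _, (mem_jumpTimes.1 hs).2⟩
  have e2 : ∀ ω s, ∑ i, ENNReal.ofReal (S.A s i (S.state s ω)) *
        g s ω (Z s ω i - Z s ω (S.state s ω)) =
      ∑ q ∈ O, (if S.state s ω = q.2 then
        ENNReal.ofReal (S.A s q.1 q.2) * G q (s, ω) else 0) := by
    intro ω s
    rw [hO, Finset.sum_filter, Fintype.sum_prod_type]
    refine Finset.sum_congr rfl fun i _ => ?_
    rw [Finset.sum_eq_single (S.state s ω)]
    · by_cases hi : i = S.state s ω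
      · simp [← hi, ENNReal.ofReal_eq_zero.2 (S.A_self_nonpos s i)]
      · simp [hi, hG]
    · intro j _ hj
      rw [if_neg (Ne.symm hj), ite_self]
    · simp
  simp only [e1, e2]
  rw [lintegral_finsetSum _ fun q _ => m1 q]
  have e3 : ∀ ω, ∫⁻ s in Ioc 0 b, ∑ q ∈ O, (if S.state s ω = q.2 then
        ENNReal.ofReal (S.A s q.1 q.2) * G q (s, ω) else 0) =
      ∑ q ∈ O, ∫⁻ s in Ioc 0 b, (if S.state s ω = q.2 then
        ENNReal.ofReal (S.A s q.1 q.2) * G q (s, ω) else 0) := fun ω =>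
    lintegral_finsetSum _ fun q _ => (m2 q).comp measurable_prodMk_right
  simp only [e3]
  rw [lintegral_finsetSum _ fun q _ => (m2 q).lintegral_prod_left']
  refine Finset.sum_congr rfl fun q hq => ?_
  exact S.lintegral_jump_pair b (Finset.mem_filter.1 hq).2 (hg q.1 q.2)

end MarkovChain

end AnticipatedBSDE

/-! ### Isometry and mean of stochastic integrals -/

namespace AnticipatedBSDE

open Function (leftLim)

namespace MarkovChain

variable {N : ℕ} {Ω : Type u} [MeasurableSpace Ω] {P : Measure Ω} {S : MarkovChain N P}

/-- The density of the compensator of `∑ g(Z' ΔX)`. -/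
def compensator (S : MarkovChain N P) (Z : ℝ≥0 → Ω → Fin N → ℝ) (g : ℝ → ℝ≥0∞) (s : ℝ≥0) (ω : Ω) :
    ℝ≥0∞ :=
  ∑ i, ENNReal.ofReal (S.A s i (S.state s ω)) * g (Z s ω i - Z s ω (S.state s ω))

/-- The diagonal rate may be negative, but it is only multiplied by zero. -/
theorem ofReal_A_mul_ofReal (s : ℝ≥0) (ω : Ω) (i : Fin N) (x : ℝ)
    (h : i = S.state s ω → x = 0) :
    ENNReal.ofReal (S.A s i (S.state s ω)) * ENNReal.ofReal x =
      ENNReal.ofReal (S.A s i (S.state s ω) * x) := by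
  by_cases hi : i = S.state s ω
  · simp [h hi]
  · rw [ENNReal.ofReal_mul (S.A_nonneg s _ _ hi)]

theorem compensator_sq (Z : ℝ≥0 → Ω → Fin N → ℝ) (s : ℝ≥0) (ω : Ω) :
    S.compensator Z (fun x => ENNReal.ofReal (x ^ 2)) s ω =
      ENNReal.ofReal (S.semiSq s ω (Z s ω)) := by
  rw [semiSq_eq, ENNReal.ofReal_sum_of_nonneg fun i _ => S.semiSq_term_nonneg s ω _ i, compensator]
  refine Finset.sum_congr rfl fun i _ => S.ofReal_A_mul_ofReal s ω i _ fun h => ?_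
  rw [← h]; simp

/-- The compensator of `∑ |h Z' ΔX|` is dominated by `|h| ‖Z‖_X`, because the rates are bounded. -/
theorem compensator_ofReal_abs_le {m : ℝ} (hm : ∀ t i j, |S.A t i j| ≤ m)
    (Z : ℝ≥0 → Ω → Fin N → ℝ) (h : ℝ) (s : ℝ≥0) (ω : Ω) :
    S.compensator Z (fun x => ENNReal.ofReal |h * x|) s ω ≤
      ENNReal.ofReal (N * Real.sqrt m) * ENNReal.ofReal (|h| * S.semi s ω (Z s ω)) := by
  have key : ∀ i, ENNReal.ofReal (S.A s i (S.state s ω)) *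
      ENNReal.ofReal |h * (Z s ω i - Z s ω (S.state s ω))| ≤
      ENNReal.ofReal (Real.sqrt m * (|h| * S.semi s ω (Z s ω))) := by
    intro i
    rw [S.ofReal_A_mul_ofReal s ω i _ fun h => by rw [← h]; simp]
    refine ENNReal.ofReal_le_ofReal ?_
    by_cases hi : i = S.state s ω
    · rw [← hi]
      simp only [sub_self, mul_zero, abs_zero]
      exact mul_nonneg (Real.sqrt_nonneg _) (mul_nonneg (abs_nonneg _) (Real.sqrt_nonneg _))
    set a := S.A s i (S.state s ω)
    set d := Z s ω i - Z s ω (S.state s ω) with hd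
    have ha : 0 ≤ a := S.A_nonneg s _ _ hi
    have h1 : Real.sqrt a ≤ Real.sqrt m := Real.sqrt_le_sqrt ((le_abs_self _).trans (hm _ _ _))
    have h2 : Real.sqrt a * |d| ≤ S.semi s ω (Z s ω) := by
      rw [semi, ← Real.sqrt_sq_eq_abs, ← Real.sqrt_mul ha, semiSq_eq]
      exact Real.sqrt_le_sqrt (Finset.single_le_sum
        (f := fun i => S.A s i (S.state s ω) * (Z s ω i - Z s ω (S.state s ω)) ^ 2)
        (fun i _ => S.semiSq_term_nonneg s ω _ i) (Finset.mem_univ i))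
    calc a * |h * d| = |h| * (Real.sqrt a * (Real.sqrt a * |d|)) := by
          rw [abs_mul, ← mul_assoc (Real.sqrt a), Real.mul_self_sqrt ha]; ring
      _ ≤ |h| * (Real.sqrt m * S.semi s ω (Z s ω)) := by
          gcongr
      _ = _ := by ring
  refine (Finset.sum_le_sum fun i _ => key i).trans (le_of_eq ?_)
  rw [Finset.sum_const, Finset.card_univ, Fintype.card_fin, nsmul_eq_mul,
    ENNReal.ofReal_mul (Real.sqrt_nonneg _), ENNReal.ofReal_mul (Nat.cast_nonneg _),
    ENNReal.ofReal_natCast, mul_assoc]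

variable {Z : ℝ≥0 → Ω → Fin N → ℝ}

theorem measurable_sub_coord
    (hZ : Measurable[S.filtration.predictable] fun p : ℝ≥0 × Ω => Z p.1 p.2) (i j : Fin N) :
    Measurable[S.filtration.predictable] fun p : ℝ≥0 × Ω => Z p.1 p.2 i - Z p.1 p.2 j :=
  ((measurable_pi_apply i).comp hZ).sub ((measurable_pi_apply j).comp hZ)

theorem measurable_coord_state (hZ : Measurable fun p : ℝ≥0 × Ω => Z p.1 p.2) :
    Measurable fun p : ℝ≥0 × Ω => Z p.1 p.2 (S.state p.1 p.2) := by
  have h2 : Measurable fun q : (Fin N → ℝ) × Fin N => q.1 q.2 :=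
    measurable_from_prod_countable_left fun j => measurable_pi_apply j
  exact h2.comp (hZ.prodMk S.measurable_state)

theorem measurable_semiSq (hZ : Measurable fun p : ℝ≥0 × Ω => Z p.1 p.2) :
    Measurable fun p : ℝ≥0 × Ω => S.semiSq p.1 p.2 (Z p.1 p.2) := by
  simp only [semiSq_eq]
  exact Finset.measurable_sum _ fun i _ => (S.measurable_A_state i).mul
    ((((measurable_pi_apply i).comp hZ).sub (S.measurable_coord_state hZ)).pow_const 2)

/-- `ω ↦ ∑ g(s, ω, Z_s' ΔX_s)` is measurable: on the jump times `Z' ΔX` agrees with a jointly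
measurable function. -/
theorem measurable_sum_jumpOf (hZ : Measurable fun p : ℝ≥0 × Ω => Z p.1 p.2) (T : ℝ≥0)
    {g : (ℝ≥0 × Ω) × ℝ → ℝ≥0∞} (hg : Measurable g) :
    Measurable fun ω => ∑ s ∈ S.jumpTimes T ω, g ((s, ω), S.jumpOf Z s ω) := by
  have h1 : Measurable fun p : ℝ≥0 × Ω => ∑ k, Z p.1 p.2 k * (S.X p.1 p.2 k - S.leftX k p) :=
    Finset.measurable_sum _ fun k _ => ((measurable_pi_apply k).comp hZ).mul (S.measurable_jump k)
  convert S.measurable_sum_jumpTimes T (hg.comp (measurable_id.prodMk h1)) using 2 with ω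
  refine Finset.sum_congr rfl fun s hs => ?_
  simp only [Function.comp, id]
  congr 2
  rw [← dotProduct_jump]
  refine Finset.sum_congr rfl fun k _ => ?_
  rw [leftX_eq (mem_jumpTimes.1 hs).1.1, leftLim_X_eq, Pi.sub_apply, Pi.single_apply]

/-- The isometry behind the stochastic integral: the expected quadratic variation `∑ (Z' ΔX)²` of
`∫ Z' dM` over `(t, T]` is `E ∫_t^T ‖Z‖²_X ds`. -/
theorem lintegral_sum_sq_jumpOf [IsProbabilityMeasure P]
    (hZ : Measurable[S.filtration.predictable] fun p : ℝ≥0 × Ω => Z p.1 p.2) (t T : ℝ≥0) :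
    ∫⁻ ω, ∑ s ∈ S.jumpTimes T ω with t < s, ENNReal.ofReal (S.jumpOf Z s ω ^ 2) ∂P =
      ∫⁻ ω, (∫⁻ s in Ioc t T, ENNReal.ofReal (S.semiSq s ω (Z s ω))) ∂P := by
  have h := S.lintegral_sum_jumpTimes T Z
    (fun s _ x => (Ioi t).indicator (fun _ => ENNReal.ofReal (x ^ 2)) s) (fun i j => by
      have h1 := ((measurable_sub_coord hZ i j).pow_const 2).ennreal_ofReal
      have h2 := Measurable.indicator h1 (measurable_fst_predictable (𝓕 := S.filtration)
        (measurableSet_Ioi (a := t)))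
      exact h2)
  have e1 : ∀ ω, ∑ s ∈ S.jumpTimes T ω with t < s, ENNReal.ofReal (S.jumpOf Z s ω ^ 2) =
      ∑ s ∈ S.jumpTimes T ω,
        (Ioi t).indicator (fun _ => ENNReal.ofReal (S.jumpOf Z s ω ^ 2)) s := by
    intro ω
    rw [Finset.sum_filter]
    refine Finset.sum_congr rfl fun s _ => ?_
    by_cases hs : t < s <;> simp [hs]
  simp only [e1, h]
  refine lintegral_congr fun ω => ?_
  have e2 : Ioc t T = Ioi t ∩ Ioc 0 T := by
    ext s
    exact ⟨fun h => ⟨h.1, pos_of_gt h.1, h.2⟩, fun h => ⟨h.1, h.2.2⟩⟩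
  rw [e2, ← setLIntegral_indicator measurableSet_Ioi]
  refine lintegral_congr fun s => ?_
  by_cases hs : t < s
  · simp only [indicator_of_mem (show s ∈ Ioi t from hs)]
    exact S.compensator_sq Z s ω
  · simp [indicator_of_notMem (show s ∉ Ioi t from hs)]

/-- For predictable `H` and `Z` with `E ∫ |H| ‖Z‖_X ds < ∞`, the stochastic integral `∫ H Z' dM` is
an integrable random variable of mean zero: its jump part and its absolutely continuous part are
both integrable, and the compensation formula equates their means. -/
theorem integral_sum_mul_jumpOf [IsProbabilityMeasure P]
    (hZ : Measurable[S.filtration.predictable] fun p : ℝ≥0 × Ω => Z p.1 p.2) {T : ℝ≥0}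
    {H : ℝ≥0 × Ω → ℝ} (hH : Measurable[S.filtration.predictable] H)
    (hfin : ∫⁻ ω, (∫⁻ s in Ioc 0 T, ENNReal.ofReal (|H (s, ω)| * S.semi s ω (Z s ω))) ∂P < ∞) :
    Integrable (fun ω => ∑ s ∈ S.jumpTimes T ω, H (s, ω) * S.jumpOf Z s ω) P ∧
    Integrable (fun p : ℝ≥0 × Ω => H p * (Z p.1 p.2 ⬝ᵥ (S.A p.1 *ᵥ S.X p.1 p.2)))
      (timeMeasure P T) ∧
    ∫ ω, ∑ s ∈ S.jumpTimes T ω, H (s, ω) * S.jumpOf Z s ω ∂P =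
      ∫ ω, (∫ s in Ioc 0 T, H (s, ω) * (Z s ω ⬝ᵥ (S.A s *ᵥ S.X s ω))) ∂P := by
  obtain ⟨m, hm0, hm⟩ := S.exists_bound
  have hZ' : Measurable fun p : ℝ≥0 × Ω => Z p.1 p.2 := hZ.mono predictable_le le_rfl
  have hH' : Measurable H := hH.mono predictable_le le_rfl
  -- the positive part of `∑ H Z' ΔX` is treated for `H` and `-H` at the same time
  have key : ∀ G : ℝ≥0 × Ω → ℝ, Measurable[S.filtration.predictable] G →
      ∫⁻ ω, ∑ s ∈ S.jumpTimes T ω, ENNReal.ofReal (G (s, ω) * S.jumpOf Z s ω) ∂P =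
        ∫⁻ p, S.compensator Z (fun x => ENNReal.ofReal (G p * x)) p.1 p.2 ∂timeMeasure P T := by
    intro G hG
    have hG' : Measurable G := hG.mono predictable_le le_rfl
    rw [S.lintegral_sum_jumpTimes T Z (fun s ω x => ENNReal.ofReal (G (s, ω) * x)) (fun i j =>
      (Measurable.mul hG (measurable_sub_coord hZ i j)).ennreal_ofReal), lintegral_timeMeasure]
    · rfl
    · exact Finset.measurable_sum _ fun i _ => (S.measurable_A_state i).ennreal_ofReal.mul
        (hG'.mul (((measurable_pi_apply i).comp hZ').sub
          (S.measurable_coord_state hZ'))).ennreal_ofReal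
  have hcm : ∀ G : ℝ≥0 × Ω → ℝ, Measurable G → Measurable fun p : ℝ≥0 × Ω =>
      S.compensator Z (fun x => ENNReal.ofReal (G p * x)) p.1 p.2 := fun G hG =>
    Finset.measurable_sum _ fun i _ => (S.measurable_A_state i).ennreal_ofReal.mul
        (hG.mul (((measurable_pi_apply i).comp hZ').sub
          (S.measurable_coord_state hZ'))).ennreal_ofReal
  have hfin' : ∀ G : ℝ≥0 × Ω → ℝ, Measurable G → (∀ p, |G p| ≤ |H p|) →
      ∫⁻ p, S.compensator Z (fun x => ENNReal.ofReal (G p * x)) p.1 p.2 ∂timeMeasure P T ≠ ∞ := by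
    intro G hG hGH
    have h1 : ∀ p : ℝ≥0 × Ω, S.compensator Z (fun x => ENNReal.ofReal (G p * x)) p.1 p.2 ≤
        ENNReal.ofReal (N * Real.sqrt m) *
          ENNReal.ofReal (|H p| * S.semi p.1 p.2 (Z p.1 p.2)) := by
      intro p
      refine le_trans ?_ ((S.compensator_ofReal_abs_le hm Z (G p) p.1 p.2).trans ?_)
      · refine Finset.sum_le_sum fun i _ => ?_
        exact mul_le_mul_right (ENNReal.ofReal_le_ofReal (le_abs_self _)) _
      · exact mul_le_mul_right (ENNReal.ofReal_le_ofReal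
          (mul_le_mul_of_nonneg_right (hGH p) (Real.sqrt_nonneg _))) _
    have h2 : Measurable fun p : ℝ≥0 × Ω =>
        ENNReal.ofReal (|H p| * S.semi p.1 p.2 (Z p.1 p.2)) :=
      (hH'.abs.mul (S.measurable_semiSq hZ').sqrt).ennreal_ofReal
    refine ((lintegral_mono h1).trans_lt ?_).ne
    rw [lintegral_const_mul _ h2, lintegral_timeMeasure T h2]
    exact ENNReal.mul_lt_top ENNReal.ofReal_lt_top hfin
  have hp := key H hH
  have hn := key (fun p => -H p) hH.neg
  have fp := hfin' H hH' fun p => le_rfl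
  have fn := hfin' (fun p => -H p) hH'.neg fun p => (abs_neg _).le
  have mp := hcm H hH'
  have mn := hcm (fun p => -H p) hH'.neg
  have hU : Measurable fun ω => ∑ s ∈ S.jumpTimes T ω, ENNReal.ofReal (H (s, ω) * S.jumpOf Z s ω) :=
    S.measurable_sum_jumpOf hZ' T (g := fun q => ENNReal.ofReal (H q.1 * q.2))
      ((hH'.comp measurable_fst).mul measurable_snd).ennreal_ofReal
  have hV : Measurable fun ω =>
      ∑ s ∈ S.jumpTimes T ω, ENNReal.ofReal (-H (s, ω) * S.jumpOf Z s ω) :=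
    S.measurable_sum_jumpOf hZ' T (g := fun q => ENNReal.ofReal (-H q.1 * q.2))
      ((hH'.neg.comp measurable_fst).mul measurable_snd).ennreal_ofReal
  have toReal_sub : ∀ (ι : Type) (D : Finset ι) (x : ι → ℝ),
      (∑ s ∈ D, ENNReal.ofReal (x s)).toReal - (∑ s ∈ D, ENNReal.ofReal (-x s)).toReal =
        ∑ s ∈ D, x s := by
    intro ι D x
    rw [ENNReal.toReal_sum fun _ _ => ENNReal.ofReal_ne_top,
      ENNReal.toReal_sum fun _ _ => ENNReal.ofReal_ne_top, ← Finset.sum_sub_distrib]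
    refine Finset.sum_congr rfl fun s _ => ?_
    rw [ENNReal.toReal_ofReal', ENNReal.toReal_ofReal']
    exact max_zero_sub_max_neg_zero_eq_self _
  have e1 : ∀ ω, ∑ s ∈ S.jumpTimes T ω, H (s, ω) * S.jumpOf Z s ω =
      (∑ s ∈ S.jumpTimes T ω, ENNReal.ofReal (H (s, ω) * S.jumpOf Z s ω)).toReal -
        (∑ s ∈ S.jumpTimes T ω, ENNReal.ofReal (-H (s, ω) * S.jumpOf Z s ω)).toReal := by
    intro ω
    simp only [neg_mul]
    exact (toReal_sub _ _ _).symm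
  have e2 : ∀ p : ℝ≥0 × Ω, H p * (Z p.1 p.2 ⬝ᵥ (S.A p.1 *ᵥ S.X p.1 p.2)) =
      (S.compensator Z (fun x => ENNReal.ofReal (H p * x)) p.1 p.2).toReal -
        (S.compensator Z (fun x => ENNReal.ofReal (-H p * x)) p.1 p.2).toReal := by
    intro p
    have h1 : ∀ c : ℝ, S.compensator Z (fun x => ENNReal.ofReal (c * x)) p.1 p.2 =
        ∑ i, ENNReal.ofReal (S.A p.1 i (S.state p.1 p.2) *
          (c * (Z p.1 p.2 i - Z p.1 p.2 (S.state p.1 p.2)))) := fun c =>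
      Finset.sum_congr rfl fun i _ =>
        S.ofReal_A_mul_ofReal p.1 p.2 i _ fun h => by rw [← h]; simp
    rw [h1, h1]
    simp only [neg_mul, mul_neg]
    rw [toReal_sub, dotProduct_mulVec_X, Finset.mul_sum]
    exact Finset.sum_congr rfl fun i _ => by ring
  have iU := integrable_toReal_of_lintegral_ne_top hU.aemeasurable (hp.trans_ne fp)
  have iV := integrable_toReal_of_lintegral_ne_top hV.aemeasurable (hn.trans_ne fn)
  have ip := integrable_toReal_of_lintegral_ne_top mp.aemeasurable fp
  have ineg := integrable_toReal_of_lintegral_ne_top mn.aemeasurable fn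
  have i1 : Integrable (fun ω => ∑ s ∈ S.jumpTimes T ω, H (s, ω) * S.jumpOf Z s ω) P :=
    (iU.sub iV).congr (Eventually.of_forall fun ω => (e1 ω).symm)
  have i2 : Integrable (fun p : ℝ≥0 × Ω => H p * (Z p.1 p.2 ⬝ᵥ (S.A p.1 *ᵥ S.X p.1 p.2)))
      (timeMeasure P T) :=
    (ip.sub ineg).congr (Eventually.of_forall fun p => (e2 p).symm)
  refine ⟨i1, i2, ?_⟩
  have e3 : ∫ ω, (∫ s in Ioc 0 T, H (s, ω) * (Z s ω ⬝ᵥ (S.A s *ᵥ S.X s ω))) ∂P =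
      ∫ p, H p * (Z p.1 p.2 ⬝ᵥ (S.A p.1 *ᵥ S.X p.1 p.2)) ∂timeMeasure P T :=
    (integral_prod_symm _ i2).symm
  rw [e3]
  simp only [e1, e2]
  rw [integral_sub iU iV, integral_sub ip ineg,
    integral_toReal hU.aemeasurable (ae_lt_top hU (hp.trans_ne fp)),
    integral_toReal hV.aemeasurable (ae_lt_top hV (hn.trans_ne fn)),
    integral_toReal mp.aemeasurable (ae_lt_top mp fp),
    integral_toReal mn.aemeasurable (ae_lt_top mn fn), hp, hn]

/-- The stochastic integral as a finite sum over the jump times of the chain. -/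
theorem stochInt_eq (Z : ℝ≥0 → Ω → Fin N → ℝ) (t T : ℝ≥0) (ω : Ω) :
    S.stochInt Z t T ω = ∑ s ∈ S.jumpTimes T ω with t < s, S.jumpOf Z s ω -
      ∫ s in Ioc t T, Z s ω ⬝ᵥ (S.A s *ᵥ S.X s ω) := by
  rw [stochInt]
  congr 1
  simp only [dotProduct_jump]
  refine finsum_mem_eq_sum_of_inter_support_eq _ ?_
  ext s
  simp only [mem_inter_iff, Function.mem_support, Finset.coe_filter, mem_ofPred_eq, mem_Ioc,
    mem_jumpTimes]
  have : S.jumpOf Z s ω ≠ 0 → S.state s ω ≠ S.leftState s ω := fun h h' => by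
    simp [jumpOf, h'] at h
  exact ⟨fun h => ⟨⟨⟨⟨pos_of_gt h.1.1, h.1.2⟩, this h.2⟩, h.1.1⟩, h.2⟩,
    fun h => ⟨⟨h.1.2, h.1.1.1.2⟩, h.2⟩⟩

/-- The stochastic integral over `(t, T]` is integrable, and its mean vanishes on every event of
`ℱ_t`. -/
theorem setIntegral_stochInt [IsProbabilityMeasure P]
    (hZ : Measurable[S.filtration.predictable] fun p : ℝ≥0 × Ω => Z p.1 p.2) {t T : ℝ≥0}
    (hfin : ∫⁻ ω, (∫⁻ s in Ioc 0 T, ENNReal.ofReal (S.semi s ω (Z s ω))) ∂P < ∞) :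
    Integrable (S.stochInt Z t T) P ∧
      ∀ F, MeasurableSet[S.filtration t] F → ∫ ω in F, S.stochInt Z t T ω ∂P = 0 := by
  have key : ∀ F, MeasurableSet[S.filtration t] F →
      Integrable (F.indicator (S.stochInt Z t T)) P ∧
      ∫ ω, F.indicator (S.stochInt Z t T) ω ∂P = 0 := by
    intro F hF
    -- the indicator of `F` is absorbed into the integrand, which stays predictable
    set H : ℝ≥0 × Ω → ℝ := (Ioi t ×ˢ F).indicator (fun _ => 1) with hH
    have h0 : Measurable[S.filtration.predictable] (fun _ : ℝ≥0 × Ω => (1 : ℝ)) := measurable_const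
    have hHm : Measurable[S.filtration.predictable] H :=
      h0.indicator (measurableSet_predictable_Ioi_prod hF)
    obtain ⟨h1, h2, h3⟩ := S.integral_sum_mul_jumpOf hZ hHm (T := T) (by
      refine (lintegral_mono fun ω => lintegral_mono fun s => ?_).trans_lt hfin
      refine ENNReal.ofReal_le_ofReal (mul_le_of_le_one_left (Real.sqrt_nonneg _) ?_)
      rw [hH, indicator]
      split_ifs <;> simp)
    have e : ∀ ω, F.indicator (S.stochInt Z t T) ω =
        ∑ s ∈ S.jumpTimes T ω, H (s, ω) * S.jumpOf Z s ω -
          ∫ s in Ioc 0 T, H (s, ω) * (Z s ω ⬝ᵥ (S.A s *ᵥ S.X s ω)) := by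
      intro ω
      by_cases hω : ω ∈ F
      · have hHs : ∀ s, H (s, ω) = (Ioi t).indicator (fun _ => 1) s := fun s => by
          by_cases hs : t < s
          · rw [hH, indicator_of_mem (show (s, ω) ∈ Ioi t ×ˢ F from ⟨hs, hω⟩),
              indicator_of_mem (show s ∈ Ioi t from hs)]
          · rw [hH, indicator_of_notMem (fun h => hs h.1),
              indicator_of_notMem (show s ∉ Ioi t from hs)]
        rw [indicator_of_mem hω, stochInt_eq, Finset.sum_filter]
        congr 1
        · refine Finset.sum_congr rfl fun s _ => ?_
          rw [hHs]
          by_cases hs : t < s <;> simp [hs]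
        · have e2 : Ioc t T = Ioc 0 T ∩ Ioi t := by
            ext s
            exact ⟨fun h => ⟨⟨pos_of_gt h.1, h.2⟩, h.1⟩, fun h => ⟨h.2, h.1.2⟩⟩
          rw [e2, ← setIntegral_indicator measurableSet_Ioi]
          refine integral_congr_ae (Eventually.of_forall fun s => ?_)
          simp only [hHs]
          by_cases hs : t < s <;> simp [hs]
      · have hHs : ∀ s, H (s, ω) = 0 := fun s => indicator_of_notMem (fun h => hω h.2) _
        simp [indicator_of_notMem hω, hHs]
    have e' : F.indicator (S.stochInt Z t T) = fun ω =>
        ∑ s ∈ S.jumpTimes T ω, H (s, ω) * S.jumpOf Z s ω -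
          ∫ s in Ioc 0 T, H (s, ω) * (Z s ω ⬝ᵥ (S.A s *ᵥ S.X s ω)) := funext e
    have h4 : Integrable (fun ω => ∫ s in Ioc 0 T, H (s, ω) * (Z s ω ⬝ᵥ (S.A s *ᵥ S.X s ω))) P :=
      h2.integral_prod_right
    rw [e']
    exact ⟨h1.sub h4, by rw [integral_sub h1 h4, h3, sub_self]⟩
  refine ⟨by simpa using (key univ MeasurableSet.univ).1, fun F hF => ?_⟩
  rw [← integral_indicator (S.filtration.le t F hF)]
  exact (key F hF).2

end MarkovChain

end AnticipatedBSDE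

/-! ### The equation with a given driver and the energy estimate -/

namespace AnticipatedBSDE

open Function (leftLim)

variable {N : ℕ} {Ω : Type u} [MeasurableSpace Ω] {P : Measure Ω}

/-- A square integrable solution `(Y, Z)` of the equation `Y_t = Y_T + ∫_t^T F_s ds - ∫_t^T Z_s'
dM_s`, in which the driver is a given process `F`. Here `F` is only jointly measurable, and `Z` is
predictable for all times, of which only `(0, T]` matters. -/
structure IsLinearSolution (S : MarkovChain N P) (T : ℝ≥0) (F : ℝ≥0 × Ω → ℝ)
    (Y : ℝ≥0 → Ω → ℝ) (Z : ℝ≥0 → Ω → Fin N → ℝ) : Prop where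
  measurable_Z : Measurable[S.filtration.predictable] fun p : ℝ≥0 × Ω => Z p.1 p.2
  lintegral_Z : ∫⁻ ω, (∫⁻ s in Ioc 0 T, ENNReal.ofReal (S.semiSq s ω (Z s ω))) ∂P < ∞
  measurable_F : Measurable F
  lintegral_F : ∫⁻ ω, (∫⁻ s in Ioc 0 T, ENNReal.ofReal (F (s, ω) ^ 2)) ∂P < ∞
  adapted_Y : ∀ t ≤ T, Measurable[S.filtration t] (Y t)
  rcll_Y : ∀ᵐ ω ∂P, IsRCLLOn (fun t => Y t ω) 0 T
  lintegral_Y : ∫⁻ ω, (∫⁻ s in Ioc 0 T, ENNReal.ofReal (Y s ω ^ 2)) ∂P < ∞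
  lintegral_Y_last : ∫⁻ ω, ENNReal.ofReal (Y T ω ^ 2) ∂P < ∞
  equation : ∀ᵐ ω ∂P, ∀ t ≤ T,
    Y t ω = Y T ω + (∫ s in Ioc t T, F (s, ω)) - S.stochInt Z t T ω

/-- A square integrable function on a finite measure space is integrable and in `L²`. -/
theorem integrable_of_lintegral_sq {α : Type*} [MeasurableSpace α] {μ : Measure α}
    [IsFiniteMeasure μ] {f : α → ℝ} (hf : AEStronglyMeasurable f μ)
    (h : ∫⁻ x, ENNReal.ofReal (f x ^ 2) ∂μ < ∞) : Integrable f μ ∧ MemLp f 2 μ := by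
  have h1 : Integrable (fun x => f x ^ 2) μ := by
    refine ⟨hf.pow 2, ?_⟩
    rw [hasFiniteIntegral_iff_ofReal (Eventually.of_forall fun x => sq_nonneg _)]
    exact h
  have h2 : MemLp f 2 μ := (memLp_two_iff_integrable_sq hf).2 h1
  exact ⟨h2.integrable one_le_two, h2⟩

theorem setIntegral_Ioc_eq_indicator (t T : ℝ≥0) (k : ℝ≥0 → ℝ) :
    ∫ s in Ioc t T, k s = ∫ s in Ioc 0 T, (Ioi t).indicator k s := by
  have e2 : Ioc t T = Ioc 0 T ∩ Ioi t := by
    ext s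
    exact ⟨fun h => ⟨⟨pos_of_gt h.1, h.2⟩, h.1⟩, fun h => ⟨h.2, h.1.2⟩⟩
  rw [e2, setIntegral_indicator measurableSet_Ioi]

theorem setLIntegral_Ioc_eq_indicator (t T : ℝ≥0) (k : ℝ≥0 → ℝ≥0∞) :
    ∫⁻ s in Ioc t T, k s = ∫⁻ s in Ioc 0 T, (Ioi t).indicator k s := by
  have e2 : Ioc t T = Ioi t ∩ Ioc 0 T := by
    ext s
    exact ⟨fun h => ⟨h.1, pos_of_gt h.1, h.2⟩, fun h => ⟨h.1, h.2.2⟩⟩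
  rw [e2, setLIntegral_indicator measurableSet_Ioi]

namespace IsLinearSolution

variable {S : MarkovChain N P} {T : ℝ≥0} {F : ℝ≥0 × Ω → ℝ} {Y : ℝ≥0 → Ω → ℝ}
  {Z : ℝ≥0 → Ω → Fin N → ℝ}

theorem lintegral_semi [IsProbabilityMeasure P] (h : IsLinearSolution S T F Y Z) :
    ∫⁻ ω, (∫⁻ s in Ioc 0 T, ENNReal.ofReal (S.semi s ω (Z s ω))) ∂P < ∞ := by
  have hm : Measurable fun p : ℝ≥0 × Ω => ENNReal.ofReal (S.semiSq p.1 p.2 (Z p.1 p.2)) :=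
    (S.measurable_semiSq (h.measurable_Z.mono predictable_le le_rfl)).ennreal_ofReal
  have hm' : Measurable fun p : ℝ≥0 × Ω => ENNReal.ofReal (S.semi p.1 p.2 (Z p.1 p.2)) :=
    (S.measurable_semiSq (h.measurable_Z.mono predictable_le le_rfl)).sqrt.ennreal_ofReal
  rw [← MarkovChain.lintegral_timeMeasure T hm']
  refine (lintegral_mono (g := fun p : ℝ≥0 × Ω =>
    1 + ENNReal.ofReal (S.semiSq p.1 p.2 (Z p.1 p.2))) fun p => ?_).trans_lt ?_
  · change ENNReal.ofReal _ ≤ 1 + ENNReal.ofReal _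
    rw [← ENNReal.ofReal_one, ← ENNReal.ofReal_add zero_le_one (S.semiSq_nonneg _ _ _)]
    refine ENNReal.ofReal_le_ofReal ?_
    rw [MarkovChain.semi, Real.sqrt_le_iff]
    have := S.semiSq_nonneg p.1 p.2 (Z p.1 p.2)
    exact ⟨by positivity, by nlinarith⟩
  · rw [lintegral_add_left measurable_const, MarkovChain.lintegral_timeMeasure T hm]
    refine ENNReal.add_lt_top.2 ⟨?_, h.lintegral_Z⟩
    rw [lintegral_one]
    exact measure_lt_top _ _

/-- A jointly measurable version of `Y`. -/
theorem exists_version (h : IsLinearSolution S T F Y Z) :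
    ∃ Y' : ℝ≥0 × Ω → ℝ, Measurable Y' ∧ ∀ᵐ ω ∂P, ∀ t ≤ T, Y' (t, ω) = Y t ω := by
  refine ⟨rightVersion T Y, measurable_rightVersion fun t ht =>
    (h.adapted_Y t ht).mono (S.filtration.le t) le_rfl, ?_⟩
  filter_upwards [h.rcll_Y] with ω hω t ht using rightVersion_eq hω ht

theorem memLp_F [IsProbabilityMeasure P] (h : IsLinearSolution S T F Y Z) :
    MemLp F 2 (MarkovChain.timeMeasure P T) := by
  refine (integrable_of_lintegral_sq h.measurable_F.aestronglyMeasurable ?_).2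
  rw [MarkovChain.lintegral_timeMeasure T (h.measurable_F.pow_const 2).ennreal_ofReal]
  exact h.lintegral_F

theorem integrable_F [IsProbabilityMeasure P] (h : IsLinearSolution S T F Y Z) :
    Integrable F (MarkovChain.timeMeasure P T) := h.memLp_F.integrable one_le_two

theorem memLp_version [IsProbabilityMeasure P] (h : IsLinearSolution S T F Y Z)
    {Y' : ℝ≥0 × Ω → ℝ} (hm : Measurable Y') (hY' : ∀ᵐ ω ∂P, ∀ t ≤ T, Y' (t, ω) = Y t ω) :
    MemLp Y' 2 (MarkovChain.timeMeasure P T) := by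
  refine (integrable_of_lintegral_sq hm.aestronglyMeasurable ?_).2
  rw [MarkovChain.lintegral_timeMeasure T (hm.pow_const 2).ennreal_ofReal]
  refine (lintegral_congr_ae ?_).trans_lt h.lintegral_Y
  filter_upwards [hY'] with ω hω
  refine setLIntegral_congr_fun measurableSet_Ioc fun s hs => ?_
  simp only [hω s hs.2]

theorem integrable_dotProduct [IsProbabilityMeasure P] (h : IsLinearSolution S T F Y Z) :
    Integrable (fun p : ℝ≥0 × Ω => Z p.1 p.2 ⬝ᵥ (S.A p.1 *ᵥ S.X p.1 p.2))
      (MarkovChain.timeMeasure P T) := by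
  have h1 : Measurable[S.filtration.predictable] (fun _ : ℝ≥0 × Ω => (1 : ℝ)) := measurable_const
  have := (S.integral_sum_mul_jumpOf h.measurable_Z h1 (T := T)
    (by simpa using h.lintegral_semi)).2.1
  simpa using this

/-- Almost every path of `Y` is a jump path. -/
theorem ae_isJumpPath [IsProbabilityMeasure P] (h : IsLinearSolution S T F Y Z) :
    ∀ᵐ ω ∂P, IntegrableOn (fun s => F (s, ω) + Z s ω ⬝ᵥ (S.A s *ᵥ S.X s ω)) (Ioc 0 T) ∧
      IsJumpPath (fun t => Y t ω) (Y T ω) (fun s => F (s, ω) + Z s ω ⬝ᵥ (S.A s *ᵥ S.X s ω))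
        (fun s => S.jumpOf Z s ω) (S.jumpTimes T ω) T := by
  filter_upwards [h.equation, h.integrable_F.prod_left_ae, h.integrable_dotProduct.prod_left_ae]
    with ω hω h1 h2
  refine ⟨h1.add h2, fun t ht => ?_⟩
  have e1 : IntegrableOn (fun s => F (s, ω)) (Ioc t T) :=
    IntegrableOn.mono_set h1 (Ioc_subset_Ioc_left zero_le)
  have e2 : IntegrableOn (fun s => Z s ω ⬝ᵥ (S.A s *ᵥ S.X s ω)) (Ioc t T) :=
    IntegrableOn.mono_set h2 (Ioc_subset_Ioc_left zero_le)
  simp only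
  rw [hω t ht, MarkovChain.stochInt_eq, integral_add e1 e2]
  ring

/-- The energy estimate: Itô's formula for `Y²`, in which the stochastic integral of `Y_- Z` has
mean zero. It is integrable since `|Y_-| ‖Z‖_X ≤ Y² + ‖Z‖²_X` for almost every time. -/
theorem energy [IsProbabilityMeasure P] (h : IsLinearSolution S T F Y Z) {t : ℝ≥0} (ht : t ≤ T) :
    ∫⁻ ω, ENNReal.ofReal (Y t ω ^ 2) ∂P +
        ∫⁻ ω, (∫⁻ s in Ioc t T, ENNReal.ofReal (S.semiSq s ω (Z s ω))) ∂P ≤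
      ∫⁻ ω, ENNReal.ofReal (Y T ω ^ 2) ∂P +
        2 * ∫⁻ ω, (∫⁻ s in Ioc t T, ENNReal.ofReal (|Y s ω| * |F (s, ω)|)) ∂P := by
  obtain ⟨Y', hY'm, hY'⟩ := h.exists_version
  have hZm : Measurable fun p : ℝ≥0 × Ω => Z p.1 p.2 := h.measurable_Z.mono predictable_le le_rfl
  set L : ℝ≥0 × Ω → ℝ := leftVersion fun s => Y (min s T) with hL
  have hLm : Measurable[S.filtration.predictable] L := measurable_leftVersion fun s =>
    (h.adapted_Y _ (min_le_right s T)).mono (S.filtration.mono (min_le_left s T)) le_rfl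
  -- the left limits of the paths
  have hleft : ∀ᵐ ω ∂P, ∀ s ∈ Ioc 0 T,
      L (s, ω) = Y s ω - if s ∈ S.jumpTimes T ω then S.jumpOf Z s ω else 0 := by
    filter_upwards [h.ae_isJumpPath] with ω hω s hs
    refine leftVersion_eq hs.1 ((hω.2.tendsto_left hω.1 hs.2).congr' ?_)
    filter_upwards [self_mem_nhdsWithin] with r (hr : r < s)
    rw [min_eq_left (hr.le.trans hs.2)]
  have hnull : ∀ ω, ∀ᵐ s ∂(volume : Measure ℝ≥0).restrict (Ioc 0 T), s ∉ S.jumpTimes T ω :=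
    fun ω => ae_restrict_of_ae (measure_eq_zero_iff_ae_notMem.1
      ((S.jumpTimes T ω).finite_toSet.measure_zero _))
  have hLY : ∀ᵐ ω ∂P, ∀ᵐ s ∂(volume : Measure ℝ≥0).restrict (Ioc 0 T), L (s, ω) = Y s ω := by
    filter_upwards [hleft] with ω hω
    filter_upwards [hnull ω, ae_restrict_mem measurableSet_Ioc] with s hs hsI
    rw [hω s hsI, if_neg hs, sub_zero]
  -- the integrand `Y_-` of Itô's formula, on `(t, T]`
  set H : ℝ≥0 × Ω → ℝ := (Prod.fst ⁻¹' Ioi t).indicator L with hH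
  have hHm : Measurable[S.filtration.predictable] H :=
    hLm.indicator (measurable_fst_predictable measurableSet_Ioi)
  have hHfin : ∫⁻ ω, (∫⁻ s in Ioc 0 T,
      ENNReal.ofReal (|H (s, ω)| * S.semi s ω (Z s ω))) ∂P < ∞ := by
    have hm2 : Measurable fun p : ℝ≥0 × Ω => ENNReal.ofReal (S.semiSq p.1 p.2 (Z p.1 p.2)) :=
      (S.measurable_semiSq hZm).ennreal_ofReal
    have hm1 : Measurable fun p : ℝ≥0 × Ω => ENNReal.ofReal (Y' p ^ 2) :=
      (hY'm.pow_const 2).ennreal_ofReal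
    have hm12 : Measurable fun p : ℝ≥0 × Ω => ENNReal.ofReal (Y' p ^ 2) +
      ENNReal.ofReal (S.semiSq p.1 p.2 (Z p.1 p.2)) := hm1.add hm2
    calc _ ≤ ∫⁻ ω, (∫⁻ s in Ioc 0 T, (ENNReal.ofReal (Y' (s, ω) ^ 2) +
            ENNReal.ofReal (S.semiSq s ω (Z s ω)))) ∂P := by
          refine lintegral_mono_ae ?_
          filter_upwards [hLY, hY'] with ω hω hω'
          refine lintegral_mono_ae ?_
          filter_upwards [hω, ae_restrict_mem measurableSet_Ioc] with s hs hsI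
          rw [← ENNReal.ofReal_add (sq_nonneg _) (S.semiSq_nonneg _ _ _)]
          refine ENNReal.ofReal_le_ofReal ?_
          have h1 : |H (s, ω)| ≤ |Y s ω| := by
            rw [← hs]
            exact norm_indicator_le_norm_self (s := Prod.fst ⁻¹' Ioi t) L (s, ω)
          have h2 : S.semi s ω (Z s ω) ^ 2 = S.semiSq s ω (Z s ω) :=
            Real.sq_sqrt (S.semiSq_nonneg _ _ _)
          have h3 : 0 ≤ S.semi s ω (Z s ω) := Real.sqrt_nonneg _
          rw [hω' s hsI.2, ← h2, ← sq_abs (Y s ω)]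
          nlinarith [mul_le_mul_of_nonneg_right h1 h3, sq_nonneg (|Y s ω| - S.semi s ω (Z s ω)),
            abs_nonneg (Y s ω)]
      _ = ∫⁻ ω, (∫⁻ s in Ioc 0 T, ENNReal.ofReal (Y' (s, ω) ^ 2)) ∂P +
            ∫⁻ ω, (∫⁻ s in Ioc 0 T, ENNReal.ofReal (S.semiSq s ω (Z s ω))) ∂P := by
          rw [← MarkovChain.lintegral_timeMeasure T hm1, ← MarkovChain.lintegral_timeMeasure T hm2,
            ← lintegral_add_left hm1, MarkovChain.lintegral_timeMeasure T hm12]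
      _ < ∞ := by
          refine ENNReal.add_lt_top.2
            ⟨(lintegral_congr_ae ?_).trans_lt h.lintegral_Y, h.lintegral_Z⟩
          filter_upwards [hY'] with ω hω
          refine setLIntegral_congr_fun measurableSet_Ioc fun s hs => ?_
          simp only [hω s hs.2]
  obtain ⟨hM1, hM2, hM3⟩ := S.integral_sum_mul_jumpOf h.measurable_Z hHm hHfin
  have hM2' : Integrable (fun ω => ∫ s in Ioc 0 T, H (s, ω) * (Z s ω ⬝ᵥ (S.A s *ᵥ S.X s ω))) P :=
    hM2.integral_prod_right
  set k : ℝ≥0 × Ω → ℝ := (Prod.fst ⁻¹' Ioi t).indicator fun p => Y' p * F p with hk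
  have hkint : Integrable k (MarkovChain.timeMeasure P T) :=
    ((h.memLp_version hY'm hY').integrable_mul h.memLp_F).indicator
      (measurable_fst measurableSet_Ioi)
  have hkint' : Integrable (fun ω => ∫ s in Ioc 0 T, k (s, ω)) P := hkint.integral_prod_right
  have hYm : ∀ t ≤ T, Measurable (Y t) := fun t ht =>
    (h.adapted_Y t ht).mono (S.filtration.le t) le_rfl
  have hYT : Integrable (fun ω => Y T ω ^ 2) P := by
    have := (integrable_of_lintegral_sq (hYm T le_rfl).aestronglyMeasurable
      h.lintegral_Y_last).2
    exact this.integrable_sq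
  -- Itô's formula; the drift `Z' A X` of `Y` turns the sum over the jumps into `∫ Y_- Z' dM`
  have hIto : ∀ᵐ ω ∂P, Y t ω ^ 2 + ∑ s ∈ S.jumpTimes T ω with t < s, S.jumpOf Z s ω ^ 2 =
      Y T ω ^ 2 + 2 * (∫ s in Ioc 0 T, k (s, ω)) -
        2 * (∑ s ∈ S.jumpTimes T ω, H (s, ω) * S.jumpOf Z s ω -
          ∫ s in Ioc 0 T, H (s, ω) * (Z s ω ⬝ᵥ (S.A s *ᵥ S.X s ω))) := by
    filter_upwards [h.ae_isJumpPath, hleft, hLY, hY', hM2.prod_left_ae, hkint.prod_left_ae]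
      with ω hω hl hly hy i1 i2
    have h0 := hω.2.sq hω.1 (fun s hs => (MarkovChain.mem_jumpTimes.1 hs).1.2) ht
    have h1 : ∑ s ∈ S.jumpTimes T ω with t < s, (Y s ω - S.jumpOf Z s ω) * S.jumpOf Z s ω =
        ∑ s ∈ S.jumpTimes T ω, H (s, ω) * S.jumpOf Z s ω := by
      rw [Finset.sum_filter]
      refine Finset.sum_congr rfl fun s hs => ?_
      by_cases hts : t < s
      · rw [if_pos hts, hH, indicator_of_mem (show (s, ω) ∈ Prod.fst ⁻¹' Ioi t from hts),
          hl s (MarkovChain.mem_jumpTimes.1 hs).1, if_pos hs]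
      · rw [if_neg hts, hH, indicator_of_notMem (show (s, ω) ∉ Prod.fst ⁻¹' Ioi t from hts),
          zero_mul]
    have h2 : ∫ s in Ioc t T, Y s ω * (F (s, ω) + Z s ω ⬝ᵥ (S.A s *ᵥ S.X s ω)) =
        (∫ s in Ioc 0 T, k (s, ω)) +
          ∫ s in Ioc 0 T, H (s, ω) * (Z s ω ⬝ᵥ (S.A s *ᵥ S.X s ω)) := by
      rw [setIntegral_Ioc_eq_indicator, ← integral_add i2 i1]
      refine integral_congr_ae ?_
      filter_upwards [hly, ae_restrict_mem measurableSet_Ioc] with s hs hsI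
      by_cases hts : t < s
      · rw [indicator_of_mem (show s ∈ Ioi t from hts), hk, hH,
          indicator_of_mem (show (s, ω) ∈ Prod.fst ⁻¹' Ioi t from hts),
          indicator_of_mem (show (s, ω) ∈ Prod.fst ⁻¹' Ioi t from hts), hs, hy s hsI.2]
        ring
      · rw [indicator_of_notMem (show s ∉ Ioi t from hts), hk, hH,
          indicator_of_notMem (show (s, ω) ∉ Prod.fst ⁻¹' Ioi t from hts),
          indicator_of_notMem (show (s, ω) ∉ Prod.fst ⁻¹' Ioi t from hts)]
        ring
    beta_reduce at h0
    rw [h1, h2] at h0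
    linarith
  have i1 : Integrable (fun ω => Y T ω ^ 2 + 2 * ∫ s in Ioc 0 T, k (s, ω)) P :=
    hYT.add (hkint'.const_mul 2)
  have i2 : Integrable (fun ω => 2 * (∑ s ∈ S.jumpTimes T ω, H (s, ω) * S.jumpOf Z s ω -
      ∫ s in Ioc 0 T, H (s, ω) * (Z s ω ⬝ᵥ (S.A s *ᵥ S.X s ω)))) P :=
    (hM1.sub hM2').const_mul 2
  have hW : Integrable (fun ω => Y T ω ^ 2 + 2 * (∫ s in Ioc 0 T, k (s, ω)) -
        2 * (∑ s ∈ S.jumpTimes T ω, H (s, ω) * S.jumpOf Z s ω -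
          ∫ s in Ioc 0 T, H (s, ω) * (Z s ω ⬝ᵥ (S.A s *ᵥ S.X s ω)))) P :=
    i1.sub i2
  have hWint : ∫ ω, (Y T ω ^ 2 + 2 * (∫ s in Ioc 0 T, k (s, ω)) -
        2 * (∑ s ∈ S.jumpTimes T ω, H (s, ω) * S.jumpOf Z s ω -
          ∫ s in Ioc 0 T, H (s, ω) * (Z s ω ⬝ᵥ (S.A s *ᵥ S.X s ω)))) ∂P =
      ∫ ω, Y T ω ^ 2 ∂P + 2 * ∫ p, k p ∂MarkovChain.timeMeasure P T := by
    have e1 : ∫ p, k p ∂MarkovChain.timeMeasure P T = ∫ ω, (∫ s in Ioc 0 T, k (s, ω)) ∂P :=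
      integral_prod_symm _ hkint
    rw [integral_sub i1 i2,
      integral_add hYT (hkint'.const_mul 2), integral_const_mul, integral_const_mul,
      integral_sub hM1 hM2', hM3, sub_self, mul_zero, sub_zero, e1]
  calc _ = ∫⁻ ω, ENNReal.ofReal (Y t ω ^ 2 +
          ∑ s ∈ S.jumpTimes T ω with t < s, S.jumpOf Z s ω ^ 2) ∂P := by
        rw [← S.lintegral_sum_sq_jumpOf h.measurable_Z t T,
          ← lintegral_add_left ((hYm t ht).pow_const 2).ennreal_ofReal]
        refine lintegral_congr fun ω => ?_
        rw [ENNReal.ofReal_add (sq_nonneg _) (Finset.sum_nonneg fun _ _ => sq_nonneg _),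
          ENNReal.ofReal_sum_of_nonneg fun _ _ => sq_nonneg _]
    _ = ENNReal.ofReal (∫ ω, Y T ω ^ 2 ∂P + 2 * ∫ p, k p ∂MarkovChain.timeMeasure P T) := by
        rw [← hWint, ofReal_integral_eq_lintegral_ofReal hW]
        · refine lintegral_congr_ae ?_
          filter_upwards [hIto] with ω hω
          rw [hω]
        · filter_upwards [hIto] with ω hω
          rw [← hω]
          exact add_nonneg (sq_nonneg _) (Finset.sum_nonneg fun _ _ => sq_nonneg _)
    _ ≤ ENNReal.ofReal (∫ ω, Y T ω ^ 2 ∂P) +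
          2 * ENNReal.ofReal (∫ p, |k p| ∂MarkovChain.timeMeasure P T) := by
        refine (ENNReal.ofReal_add_le).trans (add_le_add le_rfl ?_)
        rw [ENNReal.ofReal_mul zero_le_two, ENNReal.ofReal_ofNat]
        exact mul_le_mul_right (ENNReal.ofReal_le_ofReal
          (integral_mono hkint hkint.abs fun p => le_abs_self _)) _
    _ ≤ _ := by
        have hkm : Measurable fun p => ENNReal.ofReal |k p| :=
          ENNReal.measurable_ofReal.comp (continuous_abs.measurable.comp
            ((hY'm.mul h.measurable_F).indicator (measurable_fst measurableSet_Ioi)))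
        rw [ofReal_integral_eq_lintegral_ofReal hYT (Eventually.of_forall fun _ => sq_nonneg _),
          ofReal_integral_eq_lintegral_ofReal hkint.abs
            (Eventually.of_forall fun _ => abs_nonneg _),
          MarkovChain.lintegral_timeMeasure T hkm]
        refine add_le_add le_rfl (mul_le_mul_right ?_ 2)
        refine lintegral_mono_ae ?_
        filter_upwards [hY'] with ω hω
        rw [setLIntegral_Ioc_eq_indicator t]
        refine setLIntegral_mono_ae' measurableSet_Ioc (Eventually.of_forall fun s hs => ?_)
        by_cases hts : t < s
        · rw [indicator_of_mem (show s ∈ Ioi t from hts), hk,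
            indicator_of_mem (show (s, ω) ∈ Prod.fst ⁻¹' Ioi t from hts), hω s hs.2, abs_mul]
        · rw [indicator_of_notMem (show s ∉ Ioi t from hts), hk,
            indicator_of_notMem (show (s, ω) ∉ Prod.fst ⁻¹' Ioi t from hts)]
          simp

end IsLinearSolution

end AnticipatedBSDE

/-! ### Doob's inequality in mean square -/

namespace AnticipatedBSDE

theorem lintegral_ofReal_sq_eq_eLpNorm {α : Type*} [MeasurableSpace α] (μ : Measure α)
    (f : α → ℝ) : ∫⁻ x, ENNReal.ofReal (f x ^ 2) ∂μ = eLpNorm f 2 μ ^ 2 := by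
  have h := eLpNorm_nnreal_pow_eq_lintegral (μ := μ) (f := f) (p := 2) two_ne_zero
  simp only [NNReal.coe_ofNat, ENNReal.coe_ofNat, ENNReal.rpow_ofNat] at h
  rw [h]
  refine lintegral_congr fun x => ?_
  rw [← ofReal_norm, ← ENNReal.ofReal_pow (norm_nonneg _), Real.norm_eq_abs, sq_abs]

/-- Jensen's inequality. No integrability is needed: a conditional expectation is zero by convention
if it does not exist. -/
theorem lintegral_sq_condExp_le {α : Type*} {m m₀ : MeasurableSpace α} {μ : Measure α}
    (f : α → ℝ) :
    ∫⁻ x, ENNReal.ofReal (μ[f | m] x ^ 2) ∂μ ≤ ∫⁻ x, ENNReal.ofReal (f x ^ 2) ∂μ := by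
  rw [lintegral_ofReal_sq_eq_eLpNorm, lintegral_ofReal_sq_eq_eLpNorm]
  gcongr
  exact eLpNorm_condExp_le_eLpNorm f one_le_two

/-- The pathwise inequality behind Doob's: with the running maximum `M`, the difference of the two
sides increases by `(M_{n+1} - M_n) (2 x_{n+1} - M_{n+1} - M_n)`, which is nonnegative because
`x_{n+1} = M_{n+1}` whenever `M` increases. -/
theorem sq_partialSups_add_le (x : ℕ → ℝ) (n : ℕ) :
    partialSups x n ^ 2 + 2 * ∑ k ∈ Finset.range n, partialSups x k * (x (k + 1) - x k) ≤
      2 * (partialSups x n * x n) := by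
  induction n with
  | zero => simp; nlinarith [sq_nonneg (x 0)]
  | succ n ih =>
    rw [Finset.sum_range_succ, partialSups_add_one]
    rcases le_total (x (n + 1)) (partialSups x n) with h | h
    · rw [sup_eq_left.2 h]
      linarith
    · rw [sup_eq_right.2 h]
      nlinarith [sq_nonneg (x (n + 1) - partialSups x n)]

theorem stronglyMeasurable_partialSups {α : Type*} {_ : MeasurableSpace α} {f : ℕ → α → ℝ} {n : ℕ}
    (hf : ∀ k ≤ n, StronglyMeasurable (f k)) :
    StronglyMeasurable fun x => partialSups (fun k => f k x) n := by
  induction n with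
  | zero => simpa using hf 0 le_rfl
  | succ n ih =>
    simp only [partialSups_add_one]
    exact (ih fun k hk => hf k (hk.trans n.le_succ)).sup (hf _ le_rfl)

section Doob

variable {Ω : Type u} {m0 : MeasurableSpace Ω} {μ : Measure Ω}

theorem memLp_partialSups {f : ℕ → Ω → ℝ} {p : ℝ≥0∞} (h2 : ∀ n, MemLp (f n) p μ) (n : ℕ) :
    MemLp (fun ω => partialSups (fun k => f k ω) n) p μ := by
  induction n with
  | zero => simpa using h2 0
  | succ n ih =>
    simp only [partialSups_add_one]
    exact ih.sup (h2 _)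

/-- Doob's `L²` inequality in discrete time, for the (one-sided) running maximum. -/
theorem integral_sq_partialSups_le [IsFiniteMeasure μ] {𝒢 : Filtration ℕ m0} {f : ℕ → Ω → ℝ}
    (hf : Martingale f 𝒢 μ) (h2 : ∀ n, MemLp (f n) 2 μ) (n : ℕ) :
    ∫ ω, partialSups (fun k => f k ω) n ^ 2 ∂μ ≤ 4 * ∫ ω, f n ω ^ 2 ∂μ := by
  have hM := memLp_partialSups h2
  have hinc : ∀ k, Integrable (fun ω => partialSups (fun j => f j ω) k * (f (k + 1) ω - f k ω)) μ :=
    fun k => (hM k).integrable_mul ((h2 (k + 1)).sub (h2 k))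
  -- the martingale increments are orthogonal to the running maximum
  have hzero : ∀ k, ∫ ω, partialSups (fun j => f j ω) k * (f (k + 1) ω - f k ω) ∂μ = 0 := by
    intro k
    have h1 : μ[f (k + 1) - f k | 𝒢 k] =ᵐ[μ] 0 := by
      refine (condExp_sub (hf.integrable _) (hf.integrable _) _).trans ?_
      filter_upwards [hf.2 k (k + 1) k.le_succ, hf.2 k k le_rfl] with ω e1 e2
      rw [Pi.sub_apply, e1, e2, sub_self, Pi.zero_apply]
    have h3 := condExp_mul_of_stronglyMeasurable_left (μ := μ)
      (stronglyMeasurable_partialSups fun j hj => (hf.1 j).mono (𝒢.mono hj))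
      (g := f (k + 1) - f k) (hinc k)
      ((hf.integrable _).sub (hf.integrable _))
    rw [← integral_condExp (𝒢.le k)]
    refine (integral_congr_ae (g := fun _ => (0 : ℝ)) ?_).trans (integral_zero _ _)
    filter_upwards [h1, h3] with ω e1 e3
    refine e3.trans ?_
    rw [Pi.mul_apply, e1, Pi.zero_apply, mul_zero]
  have hsum : Integrable (fun ω => 2 * ∑ k ∈ Finset.range n,
      partialSups (fun j => f j ω) k * (f (k + 1) ω - f k ω)) μ :=
    (integrable_finsetSum _ fun k _ => hinc k).const_mul 2
  have hsq : Integrable (fun ω => partialSups (fun k => f k ω) n ^ 2) μ := (hM n).integrable_sq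
  have hprod : Integrable (fun ω => partialSups (fun k => f k ω) n * f n ω) μ :=
    (hM n).integrable_mul (h2 n)
  have key : ∫ ω, partialSups (fun k => f k ω) n ^ 2 ∂μ ≤
      2 * ∫ ω, partialSups (fun k => f k ω) n * f n ω ∂μ := by
    have := integral_mono (hsq.add hsum) (hprod.const_mul 2)
      fun ω => sq_partialSups_add_le (fun k => f k ω) n
    rw [integral_add' hsq hsum, integral_const_mul, integral_const_mul,
      integral_finsetSum _ fun k _ => hinc k, Finset.sum_eq_zero fun k _ => hzero k] at this
    linarith
  have h4 : 2 * ∫ ω, partialSups (fun k => f k ω) n * f n ω ∂μ ≤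
      (1 / 2) * ∫ ω, partialSups (fun k => f k ω) n ^ 2 ∂μ + 2 * ∫ ω, f n ω ^ 2 ∂μ := by
    rw [← integral_const_mul, ← integral_const_mul, ← integral_const_mul,
      ← integral_add (hsq.const_mul _) ((h2 n).integrable_sq.const_mul 2)]
    refine integral_mono (hprod.const_mul 2)
      ((hsq.const_mul _).add ((h2 n).integrable_sq.const_mul 2)) fun ω => ?_
    beta_reduce
    nlinarith [sq_nonneg (partialSups (fun k => f k ω) n - 2 * f n ω)]
  linarith

end Doob

variable {Ω : Type u} {m0 : MeasurableSpace Ω} {P : Measure Ω} [IsFiniteMeasure P]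
  {𝓕 : Filtration ℝ≥0 m0} {T : ℝ≥0} {Y : ℝ≥0 → Ω → ℝ} {G : Ω → ℝ}

/-- The points `k / (n + 1)`, stopped at `T`. -/
def stoppedGrid (T : ℝ≥0) (n k : ℕ) : ℝ≥0 := min ((k : ℝ≥0) / (n + 1)) T

theorem stoppedGrid_mono (T : ℝ≥0) (n : ℕ) : Monotone (stoppedGrid T n) := fun k l hkl => by
  unfold stoppedGrid
  gcongr

/-- The supremum of `|Y|²` over the stopped grid. The range is long enough for the grid to reach
`T`. -/
def gridSup (T : ℝ≥0) (Y : ℝ≥0 → Ω → ℝ) (n : ℕ) (ω : Ω) : ℝ≥0∞ :=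
  ⨆ k ∈ Finset.range (⌊T * (n + 1)⌋₊ + 2), ENNReal.ofReal (|Y (stoppedGrid T n k) ω| ^ 2)

theorem measurable_gridSup (hY : ∀ t ≤ T, Measurable (Y t)) (n : ℕ) :
    Measurable (gridSup T Y n) :=
  Measurable.biSup _ (Finset.countable_toSet _) fun _ _ =>
    ((continuous_abs.measurable.comp (hY _ (min_le_right _ _))).pow_const 2).ennreal_ofReal

theorem gridSup_le (n : ℕ) (ω : Ω) :
    gridSup T Y n ω ≤ ⨆ s ∈ Icc 0 T, ENNReal.ofReal (|Y s ω| ^ 2) :=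
  iSup₂_le fun k _ => le_iSup₂ (f := fun s (_ : s ∈ Icc 0 T) => ENNReal.ofReal (|Y s ω| ^ 2))
    (stoppedGrid T n k) ⟨zero_le, min_le_right _ _⟩

theorem iSup_le_liminf_gridSup {ω : Ω} (h : IsRCLLOn (fun t => Y t ω) 0 T) :
    ⨆ s ∈ Icc 0 T, ENNReal.ofReal (|Y s ω| ^ 2) ≤ liminf (fun n => gridSup T Y n ω) atTop := by
  refine iSup₂_le fun s hs => ?_
  have hlim : Tendsto (fun n => ENNReal.ofReal (|Y (min (gridRight n s) T) ω| ^ 2)) atTop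
      (𝓝 (ENNReal.ofReal (|Y s ω| ^ 2))) := by
    rcases hs.2.lt_or_eq with h1 | rfl
    · have h2 : Tendsto (fun n => Y (gridRight n s) ω) atTop (𝓝 (Y s ω)) :=
        (h.1 s ⟨zero_le, h1⟩).tendsto.comp (tendsto_gridRight s)
      have h3 : ∀ᶠ n in atTop, gridRight n s < T :=
        (tendsto_nhdsWithin_iff.1 (tendsto_gridRight s)).1.eventually_lt_const h1
      refine (ENNReal.tendsto_ofReal (h2.abs.pow 2)).congr' ?_
      filter_upwards [h3] with n hn
      rw [min_eq_left hn.le]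
    · refine tendsto_const_nhds.congr fun n => ?_
      rw [min_eq_right lt_gridRight.le]
  rw [← hlim.liminf_eq]
  refine liminf_le_liminf (Eventually.of_forall fun n => ?_)
  refine le_iSup₂_of_le (⌊s * (n + 1)⌋₊ + 1) ?_ le_rfl
  rw [Finset.mem_range]
  have : ⌊s * (n + 1)⌋₊ ≤ ⌊T * (n + 1)⌋₊ := Nat.floor_mono (mul_le_mul_left hs.2 _)
  lia

/-- Doob's inequality on a finite grid, for the martingale which dominates `|Y|`. -/
theorem lintegral_gridSup_le (hG : MemLp G 2 P) (hle : ∀ t ≤ T, ∀ᵐ ω ∂P, |Y t ω| ≤ P[G | 𝓕 t] ω)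
    (n : ℕ) : ∫⁻ ω, gridSup T Y n ω ∂P ≤ 4 * ∫⁻ ω, ENNReal.ofReal (G ω ^ 2) ∂P := by
  let 𝒢 : Filtration ℕ m0 :=
    { seq := fun k => 𝓕 (stoppedGrid T n k)
      mono' := fun k l hkl => 𝓕.mono (stoppedGrid_mono T n hkl)
      le' := fun k => 𝓕.le _ }
  have hf := martingale_condExp G 𝒢 P
  have h2 : ∀ k, MemLp (P[G | 𝒢 k]) 2 P := fun k => hG.condExp one_le_two
  set m := ⌊T * (n + 1)⌋₊ + 1 with hm
  have hle' : ∀ᵐ ω ∂P, ∀ k, |Y (stoppedGrid T n k) ω| ≤ P[G | 𝒢 k] ω :=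
    ae_all_iff.2 fun k => hle _ (min_le_right _ _)
  calc _ ≤ ∫⁻ ω, ENNReal.ofReal (partialSups (fun k => P[G | 𝒢 k] ω) m ^ 2) ∂P := by
        refine lintegral_mono_ae ?_
        filter_upwards [hle'] with ω hω
        refine iSup₂_le fun k hk => ENNReal.ofReal_le_ofReal ?_
        have h3 : P[G | 𝒢 k] ω ≤ partialSups (fun k => P[G | 𝒢 k] ω) m :=
          le_partialSups_of_le (fun k => P[G | 𝒢 k] ω) (by rw [Finset.mem_range] at hk; lia)
        exact pow_le_pow_left₀ (abs_nonneg _) ((hω k).trans h3) 2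
    _ = ENNReal.ofReal (∫ ω, partialSups (fun k => P[G | 𝒢 k] ω) m ^ 2 ∂P) := by
        rw [ofReal_integral_eq_lintegral_ofReal (memLp_partialSups h2 m).integrable_sq
          (Eventually.of_forall fun _ => sq_nonneg _)]
    _ ≤ ENNReal.ofReal (4 * ∫ ω, P[G | 𝒢 m] ω ^ 2 ∂P) :=
        ENNReal.ofReal_le_ofReal (integral_sq_partialSups_le hf h2 m)
    _ = 4 * ∫⁻ ω, ENNReal.ofReal (P[G | 𝒢 m] ω ^ 2) ∂P := by
        rw [ENNReal.ofReal_mul (by norm_num), ENNReal.ofReal_ofNat,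
          ofReal_integral_eq_lintegral_ofReal (h2 m).integrable_sq
          (Eventually.of_forall fun _ => sq_nonneg _)]
    _ ≤ _ := mul_le_mul_right (lintegral_sq_condExp_le G) 4

/-- Doob's `L²` inequality for a right continuous process dominated by a closed martingale. By right
continuity the supremum is the limit of suprema over finite grids. -/
theorem lintegral_iSup_sq_le (hrcll : ∀ᵐ ω ∂P, IsRCLLOn (fun t => Y t ω) 0 T)
    (hY : ∀ t ≤ T, Measurable (Y t)) (hG : MemLp G 2 P)
    (hle : ∀ t ≤ T, ∀ᵐ ω ∂P, |Y t ω| ≤ P[G | 𝓕 t] ω) :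
    AEMeasurable (fun ω => ⨆ s ∈ Icc 0 T, ENNReal.ofReal (|Y s ω| ^ 2)) P ∧
      ∫⁻ ω, (⨆ s ∈ Icc 0 T, ENNReal.ofReal (|Y s ω| ^ 2)) ∂P ≤
        4 * ∫⁻ ω, ENNReal.ofReal (G ω ^ 2) ∂P := by
  have hm : ∀ n, Measurable (gridSup T Y n) := measurable_gridSup hY
  have heq : ∀ᵐ ω ∂P, ⨆ s ∈ Icc 0 T, ENNReal.ofReal (|Y s ω| ^ 2) =
      liminf (fun n => gridSup T Y n ω) atTop := by
    filter_upwards [hrcll] with ω hω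
    refine (iSup_le_liminf_gridSup hω).antisymm ?_
    refine (liminf_le_liminf (Eventually.of_forall fun n => gridSup_le n ω)).trans ?_
    rw [liminf_const]
  refine ⟨⟨_, Measurable.liminf hm, heq⟩, ?_⟩
  rw [lintegral_congr_ae heq]
  refine (lintegral_liminf_le hm).trans ?_
  refine (liminf_le_liminf (Eventually.of_forall fun n => lintegral_gridSup_le hG hle n)).trans ?_
  rw [liminf_const]

end AnticipatedBSDE

/-! ### Grönwall's inequality and the supremum of a solution -/

namespace AnticipatedBSDE

/-- The Cauchy–Schwarz inequality for `1 · g`. -/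
theorem sq_lintegral_le {α : Type*} [MeasurableSpace α] {μ : Measure α} {g : α → ℝ≥0∞}
    (hg : AEMeasurable g μ) : (∫⁻ x, g x ∂μ) ^ 2 ≤ μ univ * ∫⁻ x, g x ^ 2 ∂μ := by
  have h := ENNReal.lintegral_mul_le_Lp_mul_Lq μ Real.HolderConjugate.two_two
    (f := fun _ => 1) (g := g) aemeasurable_const hg
  simp only [Pi.mul_apply, one_mul, ENNReal.one_rpow, lintegral_one] at h
  calc _ ≤ (μ univ ^ (1 / 2 : ℝ) * (∫⁻ x, g x ^ (2 : ℝ) ∂μ) ^ (1 / 2 : ℝ)) ^ 2 := by gcongr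
    _ = _ := by
      rw [mul_pow, ← ENNReal.rpow_natCast, ← ENNReal.rpow_natCast, ← ENNReal.rpow_mul,
        ← ENNReal.rpow_mul]
      simp

theorem add_add_sq_le (x y z : ℝ≥0∞) : (x + y + z) ^ 2 ≤ 3 * (x ^ 2 + y ^ 2 + z ^ 2) := by
  induction x with
  | top => simp
  | coe x =>
    induction y with
    | top => simp
    | coe y =>
      induction z with
      | top => simp
      | coe z =>
        norm_cast
        rw [← NNReal.coe_le_coe]
        push_cast
        nlinarith [sq_nonneg ((x : ℝ) - y), sq_nonneg ((x : ℝ) - z), sq_nonneg ((y : ℝ) - z)]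

theorem ofReal_abs_sq (x : ℝ) : ENNReal.ofReal |x| ^ 2 = ENNReal.ofReal (x ^ 2) := by
  rw [← ENNReal.ofReal_pow (abs_nonneg x), sq_abs]

/-- Grönwall's inequality in backward time. On an interval of length at most `1 / (2 B)` the
integral on the right can be absorbed, and `[0, T]` is covered by finitely many of them. -/
theorem exists_gronwall (B T : ℝ≥0) : ∃ C : ℝ≥0, ∀ (φ : ℝ≥0 → ℝ≥0∞) (A : ℝ≥0∞),
    (∫⁻ s in Ioc 0 T, φ s) < ∞ → (∀ t ≤ T, φ t ≤ A + B * (∫⁻ s in Ioc t T, φ s)) →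
      (∫⁻ s in Ioc 0 T, φ s) ≤ C * A := by
  obtain ⟨h, hh0, hh⟩ : ∃ h : ℝ≥0, 0 < h ∧ h * B ≤ 1 / 2 := by
    refine ⟨1 / (2 * (B + 1)), by positivity, ?_⟩
    rw [div_mul_eq_mul_div, one_mul, div_le_div_iff₀ (by positivity) two_pos, one_mul, mul_comm]
    gcongr
    exact le_self_add
  obtain ⟨n, hn⟩ : ∃ n : ℕ, T ≤ n * h := by
    obtain ⟨n, hn⟩ := exists_nat_ge (T / h)
    exact ⟨n, by rwa [div_le_iff₀ hh0] at hn⟩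
  refine ⟨2 ^ (n + 1) * h, fun φ A hfin hφ => ?_⟩
  -- each interval of length `h` at most doubles the bound and adds `2 h A`
  have key : ∀ j : ℕ, ∀ t ≤ T, T ≤ t + j * h →
      (∫⁻ s in Ioc t T, φ s) ≤ (2 ^ (j + 1) - 2 : ℕ) * h * A := by
    intro j
    induction j with
    | zero =>
      intro t ht hT
      simp only [Nat.cast_zero, zero_mul, add_zero] at hT
      rw [Ioc_eq_empty (not_lt.2 hT)]
      simp
    | succ j ih =>
      intro t ht hT
      set t' := min (t + h) T with ht'
      have h1 : t ≤ t' := le_min le_self_add ht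
      have h2 : T ≤ t' + j * h := by
        rcases min_cases (t + h) T with ⟨e, -⟩ | ⟨e, -⟩
        · rw [ht', e]
          refine hT.trans_eq ?_
          push_cast
          ring
        · rw [ht', e]
          exact le_self_add
      have h3 : (∫⁻ s in Ioc t T, φ s) = (∫⁻ s in Ioc t t', φ s) + (∫⁻ s in Ioc t' T, φ s) := by
        rw [← Ioc_union_Ioc_eq_Ioc h1 (min_le_right _ _),
          lintegral_union measurableSet_Ioc (Ioc_disjoint_Ioc_of_le le_rfl)]
      have hfin' : (∫⁻ s in Ioc t T, φ s) < ∞ :=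
        (lintegral_mono_set (Ioc_subset_Ioc_left zero_le)).trans_lt hfin
      have h4 : (∫⁻ s in Ioc t t', φ s) ≤ h * A + 1 / 2 * (∫⁻ s in Ioc t T, φ s) := by
        calc _ ≤ ∫⁻ _ in Ioc t t', (A + B * (∫⁻ s in Ioc t T, φ s)) := by
              refine setLIntegral_mono' measurableSet_Ioc fun s hs => ?_
              refine (hφ s (hs.2.trans (min_le_right _ _))).trans ?_
              gcongr
              exact hs.1.le
          _ = (A + B * (∫⁻ s in Ioc t T, φ s)) * (t' - t : ℝ≥0) := by
              rw [setLIntegral_const, volume_nnreal_Ioc, ← NNReal.coe_sub h1,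
                ENNReal.ofReal_coe_nnreal]
          _ ≤ (A + B * (∫⁻ s in Ioc t T, φ s)) * h := by
              gcongr
              exact tsub_le_iff_left.2 (min_le_left _ _)
          _ = h * A + (h * B : ℝ≥0) * (∫⁻ s in Ioc t T, φ s) := by
              push_cast
              ring
          _ ≤ _ := by
              gcongr
              refine (ENNReal.coe_le_coe.2 hh).trans ?_
              simp
      have h5 := ih t' (min_le_right _ _) h2
      have h6 : (∫⁻ s in Ioc t T, φ s) ≤ 1 / 2 * (∫⁻ s in Ioc t T, φ s) +
          (h * A + (2 ^ (j + 1) - 2 : ℕ) * h * A) := by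
        calc _ ≤ _ := h3.le.trans (add_le_add h4 h5)
          _ = _ := by ring
      have h7 : (1 / 2 : ℝ≥0∞) * (∫⁻ s in Ioc t T, φ s) ≤
          h * A + (2 ^ (j + 1) - 2 : ℕ) * h * A := by
        refine (ENNReal.add_le_add_iff_left (a := 1 / 2 * (∫⁻ s in Ioc t T, φ s))
          (ENNReal.mul_lt_top (by simp) hfin').ne).1 ?_
        refine le_of_eq_of_le ?_ h6
        rw [← add_mul, ENNReal.add_halves, one_mul]
      calc _ = 2 * ((1 / 2 : ℝ≥0∞) * (∫⁻ s in Ioc t T, φ s)) := by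
            rw [← mul_assoc, one_div, ENNReal.mul_inv_cancel two_ne_zero (by simp), one_mul]
        _ ≤ 2 * (h * A + (2 ^ (j + 1) - 2 : ℕ) * h * A) := by gcongr
        _ = (2 * (1 + (2 ^ (j + 1) - 2)) : ℕ) * h * A := by
            push_cast
            ring
        _ = _ := by
            congr 3
            have : 2 ≤ 2 ^ (j + 1) := by
              simpa using Nat.pow_le_pow_right two_pos (Nat.le_add_left 1 j)
            rw [pow_succ 2 (j + 1)]
            lia
  refine (key n 0 zero_le (by simpa using hn)).trans ?_
  gcongr
  push_cast
  gcongr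
  exact_mod_cast Nat.sub_le _ _

namespace IsLinearSolution

variable {N : ℕ} {Ω : Type u} [MeasurableSpace Ω] {P : Measure Ω}
  {S : MarkovChain N P} {T : ℝ≥0} {F : ℝ≥0 × Ω → ℝ} {Y : ℝ≥0 → Ω → ℝ}
  {Z : ℝ≥0 → Ω → Fin N → ℝ}

theorem measurable_Y (h : IsLinearSolution S T F Y Z) {t : ℝ≥0} (ht : t ≤ T) : Measurable (Y t) :=
  (h.adapted_Y t ht).mono (S.filtration.le t) le_rfl

theorem measurable_lintegral_abs {F : ℝ≥0 × Ω → ℝ} (hF : Measurable F) :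
    Measurable fun ω => ∫⁻ s in Ioc 0 T, ENNReal.ofReal |F (s, ω)| :=
  (show Measurable fun p => ENNReal.ofReal |F p| from
    (continuous_abs.measurable.comp hF).ennreal_ofReal).lintegral_prod_left'

theorem sq_lintegral_abs_le {F : ℝ≥0 × Ω → ℝ} (hF : Measurable F) :
    ∫⁻ ω, (∫⁻ s in Ioc 0 T, ENNReal.ofReal |F (s, ω)|) ^ 2 ∂P ≤
      T * ∫⁻ ω, (∫⁻ s in Ioc 0 T, ENNReal.ofReal (F (s, ω) ^ 2)) ∂P := by
  rw [← lintegral_const_mul' _ _ ENNReal.coe_ne_top]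
  refine lintegral_mono fun ω => (sq_lintegral_le ?_).trans_eq ?_
  · exact ((continuous_abs.measurable.comp
      (hF.comp measurable_prodMk_right)).ennreal_ofReal).aemeasurable
  · rw [Measure.restrict_apply_univ, volume_nnreal_Ioc, NNReal.coe_zero, sub_zero,
      ENNReal.ofReal_coe_nnreal]
    simp only [ofReal_abs_sq]

/-- The random variable `|Y_T| + ∫_0^T |F_s| ds`, whose conditional expectations dominate `Y`. -/
def dominant (T : ℝ≥0) (F : ℝ≥0 × Ω → ℝ) (Y : ℝ≥0 → Ω → ℝ) (ω : Ω) : ℝ :=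
  |Y T ω| + ∫ s in Ioc 0 T, |F (s, ω)|

theorem ae_ofReal_dominant [IsProbabilityMeasure P] (h : IsLinearSolution S T F Y Z) :
    ∀ᵐ ω ∂P, ENNReal.ofReal (dominant T F Y ω ^ 2) =
      (ENNReal.ofReal |Y T ω| + ∫⁻ s in Ioc 0 T, ENNReal.ofReal |F (s, ω)|) ^ 2 := by
  filter_upwards [h.integrable_F.prod_left_ae] with ω hω
  have h0 : 0 ≤ ∫ s in Ioc 0 T, |F (s, ω)| := integral_nonneg fun _ => abs_nonneg _
  rw [dominant, ENNReal.ofReal_pow (add_nonneg (abs_nonneg _) h0),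
    ENNReal.ofReal_add (abs_nonneg _) h0,
    ofReal_integral_eq_lintegral_ofReal hω.abs (Eventually.of_forall fun _ => abs_nonneg _)]

theorem memLp_dominant [IsProbabilityMeasure P] (h : IsLinearSolution S T F Y Z) :
    MemLp (dominant T F Y) 2 P := by
  have h1 : Integrable (fun ω => ∫ s in Ioc 0 T, |F (s, ω)|) P :=
    h.integrable_F.abs.integral_prod_right
  refine (integrable_of_lintegral_sq ?_ ?_).2
  · exact (continuous_abs.measurable.comp (h.measurable_Y le_rfl)).aestronglyMeasurable.add
      h1.aestronglyMeasurable
  · rw [lintegral_congr_ae h.ae_ofReal_dominant]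
    have hm : Measurable fun ω => ENNReal.ofReal |Y T ω| ^ 2 :=
      ((continuous_abs.measurable.comp (h.measurable_Y le_rfl)).ennreal_ofReal).pow_const 2
    calc _ ≤ ∫⁻ ω, 3 * (ENNReal.ofReal |Y T ω| ^ 2 +
            (∫⁻ s in Ioc 0 T, ENNReal.ofReal |F (s, ω)|) ^ 2) ∂P := by
          refine lintegral_mono fun ω => ?_
          simpa using add_add_sq_le (ENNReal.ofReal |Y T ω|)
            (∫⁻ s in Ioc 0 T, ENNReal.ofReal |F (s, ω)|) 0
      _ = 3 * (∫⁻ ω, ENNReal.ofReal (Y T ω ^ 2) ∂P +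
            ∫⁻ ω, (∫⁻ s in Ioc 0 T, ENNReal.ofReal |F (s, ω)|) ^ 2 ∂P) := by
          rw [lintegral_const_mul' _ _ (by simp), lintegral_add_left hm]
          simp only [ofReal_abs_sq]
      _ < ∞ := by
          refine ENNReal.mul_lt_top (by simp) (ENNReal.add_lt_top.2 ⟨h.lintegral_Y_last, ?_⟩)
          exact (sq_lintegral_abs_le h.measurable_F).trans_lt
            (ENNReal.mul_lt_top ENNReal.coe_lt_top h.lintegral_F)

/-- `Y` is dominated by a closed martingale, because `Y_t` is the conditional expectation of
`Y_T + ∫_t^T F_s ds`. -/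
theorem ae_abs_le_condExp [IsProbabilityMeasure P] (h : IsLinearSolution S T F Y Z) {t : ℝ≥0}
    (ht : t ≤ T) : ∀ᵐ ω ∂P, |Y t ω| ≤ P[dominant T F Y | S.filtration t] ω := by
  obtain ⟨hI, hI0⟩ := S.setIntegral_stochInt (t := t) h.measurable_Z h.lintegral_semi
  set R : Ω → ℝ := fun ω => Y T ω + ∫ s in Ioc t T, F (s, ω) with hR
  have hF : Integrable (fun ω => ∫ s in Ioc t T, F (s, ω)) P := by
    have : Integrable (fun ω => ∫ s in Ioc 0 T, (Prod.fst ⁻¹' Ioi t).indicator F (s, ω)) P :=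
      (h.integrable_F.indicator (measurable_fst measurableSet_Ioi)).integral_prod_right
    refine this.congr (Eventually.of_forall fun ω => ?_)
    beta_reduce
    rw [setIntegral_Ioc_eq_indicator t]
    rfl
  have hYT : Integrable (Y T) P := (integrable_of_lintegral_sq
    (h.measurable_Y le_rfl).aestronglyMeasurable h.lintegral_Y_last).1
  have hRi : Integrable R P := hYT.add hF
  have hG : Integrable (dominant T F Y) P := h.memLp_dominant.integrable one_le_two
  have hYt : Y t =ᵐ[P] R - S.stochInt Z t T := by
    filter_upwards [h.equation] with ω hω using hω t ht
  have hle : ∀ᵐ ω ∂P, |R ω| ≤ dominant T F Y ω := by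
    filter_upwards [h.integrable_F.prod_left_ae] with ω hω
    refine (abs_add_le _ _).trans (add_le_add le_rfl ?_)
    refine (abs_integral_le_integral_abs).trans ?_
    exact setIntegral_mono_set hω.abs (Eventually.of_forall fun _ => abs_nonneg _)
      (Ioc_subset_Ioc_left zero_le).eventuallyLE
  have hcond : Y t =ᵐ[P] P[R | S.filtration t] := by
    refine ae_eq_condExp_of_forall_setIntegral_eq (S.filtration.le t) hRi
      (fun A _ _ => ((hRi.sub hI).congr hYt.symm).integrableOn) (fun A hA _ => ?_)
      (h.adapted_Y t ht).stronglyMeasurable.aestronglyMeasurable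
    rw [setIntegral_congr_ae (g := R - S.stochInt Z t T) (S.filtration.le t A hA)
      (hYt.mono fun ω hω _ => hω), integral_sub' hRi.integrableOn hI.integrableOn, hI0 A hA,
      sub_zero]
  have h1 := condExp_mono (m := S.filtration t) hRi hG
    (hle.mono fun ω hω => (le_abs_self _).trans hω)
  have h2 := condExp_mono (m := S.filtration t) hRi.neg hG
    (hle.mono fun ω hω => (neg_le_abs _).trans hω)
  filter_upwards [hcond, h1, h2, condExp_neg R (S.filtration t)] with ω e1 e2 e3 e4
  rw [e4, Pi.neg_apply] at e3
  rw [e1, abs_le]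
  exact ⟨by linarith, e2⟩

/-- The estimate of the supremum, by Doob's inequality for the martingale which dominates `Y`. The
driver is split at a reference `F₀`, of which only the time integral has to be square integrable;
for the rest the Cauchy–Schwarz inequality costs a factor `T`. -/
theorem lintegral_iSup_le [IsProbabilityMeasure P] (h : IsLinearSolution S T F Y Z)
    {F₀ : ℝ≥0 × Ω → ℝ} (hF₀ : Measurable F₀) :
    AEMeasurable (fun ω => ⨆ s ∈ Icc 0 T, ENNReal.ofReal (|Y s ω| ^ 2)) P ∧
      ∫⁻ ω, (⨆ s ∈ Icc 0 T, ENNReal.ofReal (|Y s ω| ^ 2)) ∂P ≤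
        12 * (∫⁻ ω, ENNReal.ofReal (Y T ω ^ 2) ∂P +
          ∫⁻ ω, (∫⁻ s in Ioc 0 T, ENNReal.ofReal |F₀ (s, ω)|) ^ 2 ∂P +
          T * ∫⁻ ω, (∫⁻ s in Ioc 0 T, ENNReal.ofReal ((F (s, ω) - F₀ (s, ω)) ^ 2)) ∂P) := by
  obtain ⟨hm, hle⟩ := lintegral_iSup_sq_le h.rcll_Y (fun t ht => h.measurable_Y ht)
    h.memLp_dominant fun t ht => h.ae_abs_le_condExp ht
  refine ⟨hm, hle.trans ?_⟩
  have hF₁ : Measurable fun p => F p - F₀ p := h.measurable_F.sub hF₀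
  have hm1 : Measurable fun ω => ENNReal.ofReal |Y T ω| ^ 2 :=
    ((continuous_abs.measurable.comp (h.measurable_Y le_rfl)).ennreal_ofReal).pow_const 2
  have hm2 : Measurable fun ω => (∫⁻ s in Ioc 0 T, ENNReal.ofReal |F₀ (s, ω)|) ^ 2 :=
    (measurable_lintegral_abs hF₀).pow_const 2
  have hm12 : Measurable fun ω => ENNReal.ofReal |Y T ω| ^ 2 +
    (∫⁻ s in Ioc 0 T, ENNReal.ofReal |F₀ (s, ω)|) ^ 2 := hm1.add hm2
  rw [lintegral_congr_ae h.ae_ofReal_dominant]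
  calc _ ≤ 4 * ∫⁻ ω, 3 * (ENNReal.ofReal |Y T ω| ^ 2 +
          (∫⁻ s in Ioc 0 T, ENNReal.ofReal |F₀ (s, ω)|) ^ 2 +
          (∫⁻ s in Ioc 0 T, ENNReal.ofReal |F (s, ω) - F₀ (s, ω)|) ^ 2) ∂P := by
        refine mul_le_mul_right (lintegral_mono fun ω => ?_) 4
        refine le_trans ?_ (add_add_sq_le _ _ _)
        have hm3 : Measurable fun s => ENNReal.ofReal |F₀ (s, ω)| :=
          (continuous_abs.measurable.comp (hF₀.comp measurable_prodMk_right)).ennreal_ofReal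
        rw [add_assoc, ← lintegral_add_left hm3]
        gcongr with s
        rw [← ENNReal.ofReal_add (abs_nonneg _) (abs_nonneg _)]
        refine ENNReal.ofReal_le_ofReal ?_
        have := abs_add_le (F₀ (s, ω)) (F (s, ω) - F₀ (s, ω))
        rwa [add_sub_cancel] at this
    _ = 12 * (∫⁻ ω, ENNReal.ofReal (Y T ω ^ 2) ∂P +
          ∫⁻ ω, (∫⁻ s in Ioc 0 T, ENNReal.ofReal |F₀ (s, ω)|) ^ 2 ∂P +
          ∫⁻ ω, (∫⁻ s in Ioc 0 T, ENNReal.ofReal |F (s, ω) - F₀ (s, ω)|) ^ 2 ∂P) := by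
        rw [lintegral_const_mul' _ _ (by simp), lintegral_add_left hm12, lintegral_add_left hm1,
          ← mul_assoc]
        simp only [ofReal_abs_sq]
        norm_num
    _ ≤ _ := by
        gcongr
        exact sq_lintegral_abs_le hF₁

end IsLinearSolution

end AnticipatedBSDE

/-! ### The a priori estimate for a given driver -/

namespace AnticipatedBSDE

/-- The elementary system of inequalities behind the estimate, for the quantities `a = E|Y_T|²`, `d
= E(∫|F₀|)²`, `e = E∫|Y||F₀|`, `σ = E sup|Y|²`, `Φ = E∫|Y|²`, `Ψ = E∫‖Z‖²`, `q = E∫|F - F₀|²` and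
the terminal data `τ`. All of them are bounded by `a + d + τ + e`, and `e` is as small as desired
compared with `σ`, up to a multiple of `d`, so it can be absorbed. -/
theorem exists_const_of_system (G B B' D₁ D₂ T : ℝ≥0) : ∃ C : ℝ≥0, 0 < C ∧
    ∀ a d τ e σ Φ Ψ q : ℝ≥0, Φ ≤ G * (a + 2 * e + B' * τ) →
      Ψ ≤ 2 * (a + 2 * e + B' * τ + B * Φ) → q ≤ D₁ * (Φ + τ) + D₂ * (Ψ + τ) →
      σ ≤ 12 * (a + d + T * q) → (∀ l : ℝ≥0, 0 < l → e ≤ l * σ + l⁻¹ * d) →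
      σ + Ψ ≤ C * (a + d + τ) := by
  set k₀ : ℝ≥0 := 2 + B' with hk₀
  set k₁ : ℝ≥0 := G * k₀ with hk₁
  set k₂ : ℝ≥0 := 2 * (k₀ + B * k₁) with hk₂
  set k₃ : ℝ≥0 := D₁ * (k₁ + 1) + D₂ * (k₂ + 1) with hk₃
  set M : ℝ≥0 := 12 * (1 + T * k₃) with hM
  have hM0 : 0 < M := by positivity
  refine ⟨(M + k₂) * (2 + 4 * M) + 1, by positivity, fun a d τ e σ Φ Ψ q h1 h2 h3 h4 h5 => ?_⟩
  set p := a + d + τ + e with hp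
  have hA : a + 2 * e + B' * τ ≤ k₀ * p := by
    calc a + 2 * e + B' * τ ≤ 2 * (a + d + τ + e) + B' * (a + d + τ + e) := by
          gcongr
          · calc a + 2 * e ≤ a + 2 * e + (a + 2 * d + 2 * τ) := le_self_add
              _ = _ := by ring
          · calc τ ≤ τ + (a + d + e) := le_self_add
              _ = _ := by ring
      _ = _ := by rw [hk₀]; ring
  have hτ : τ ≤ p := by
    calc τ ≤ τ + (a + d + e) := le_self_add
      _ = _ := by rw [hp]; ring
  have had : a + d ≤ p := by
    calc a + d ≤ a + d + (τ + e) := le_self_add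
      _ = _ := by rw [hp]; ring
  have hΦ : Φ ≤ k₁ * p := by
    calc Φ ≤ G * (k₀ * p) := h1.trans (by gcongr)
      _ = _ := by rw [hk₁]; ring
  have hΨ : Ψ ≤ k₂ * p := by
    calc Ψ ≤ 2 * (k₀ * p + B * (k₁ * p)) := h2.trans (by gcongr)
      _ = _ := by rw [hk₂]; ring
  have hq : q ≤ k₃ * p := by
    calc q ≤ D₁ * (k₁ * p + p) + D₂ * (k₂ * p + p) := h3.trans (by gcongr)
      _ = _ := by rw [hk₃]; ring
  have hσ : σ ≤ M * p := by
    calc σ ≤ 12 * (p + T * (k₃ * p)) := h4.trans (by gcongr)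
      _ = _ := by rw [hM]; ring
  have he : e ≤ (1 + 4 * M) * (a + d + τ) := by
    -- `l = 1 / (2 M)` leaves at most half of `e` on the right
    have h6 : e ≤ 1 / 2 * p + 2 * M * d := by
      calc e ≤ (2 * M)⁻¹ * σ + (2 * M)⁻¹⁻¹ * d := h5 _ (by positivity)
        _ ≤ (2 * M)⁻¹ * (M * p) + (2 * M)⁻¹⁻¹ * d := by gcongr
        _ = _ := by
          rw [inv_inv]
          field_simp
    rw [hp, ← NNReal.coe_le_coe] at h6
    rw [← NNReal.coe_le_coe]
    push_cast at h6 ⊢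
    nlinarith [mul_nonneg M.2 a.2, mul_nonneg M.2 τ.2, d.2]
  calc σ + Ψ ≤ M * p + k₂ * p := add_le_add hσ hΨ
    _ = (M + k₂) * (a + d + τ + e) := by ring
    _ ≤ (M + k₂) * (a + d + τ + (1 + 4 * M) * (a + d + τ)) := by gcongr
    _ = (M + k₂) * (2 + 4 * M) * (a + d + τ) := by ring
    _ ≤ _ := by
      gcongr
      exact le_self_add

/-- Young's inequality with a parameter. -/
theorem mul_le_young (x y : ℝ≥0∞) {l : ℝ≥0} (hl : 0 < l) :
    x * y ≤ l * x ^ 2 + (l⁻¹ : ℝ≥0) * y ^ 2 := by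
  have hl' : (l : ℝ≥0∞) ≠ 0 := by simpa using hl.ne'
  have hl'' : ((l⁻¹ : ℝ≥0) : ℝ≥0∞) ≠ 0 := by simpa using hl.ne'
  induction x with
  | top => simp [ENNReal.mul_top hl']
  | coe x =>
    induction y with
    | top => simp [ENNReal.mul_top hl'']
    | coe y =>
      norm_cast
      rw [← NNReal.coe_le_coe]
      push_cast
      have h4 : (l : ℝ)⁻¹ * (l * x - y) ^ 2 = l * x ^ 2 - 2 * (x * y) + (l : ℝ)⁻¹ * y ^ 2 := by
        have : (l : ℝ) ≠ 0 := by exact_mod_cast hl.ne'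
        field_simp
        ring
      have h5 : (0 : ℝ) ≤ (l : ℝ)⁻¹ * (l * x - y) ^ 2 := by positivity
      have h6 : (0 : ℝ) ≤ x * y := by positivity
      linarith

namespace IsLinearSolution

variable {N : ℕ} {Ω : Type u} [MeasurableSpace Ω] {P : Measure Ω}
  {S : MarkovChain N P} {T : ℝ≥0} {F F₀ : ℝ≥0 × Ω → ℝ} {Y : ℝ≥0 → Ω → ℝ}
  {Z : ℝ≥0 → Ω → Fin N → ℝ}

/-- `E ∫ |Y| |F₀| ds` is at most `E[sup |Y| · ∫ |F₀| ds]`, to which Young's inequality applies. -/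
theorem lintegral_mul_le (hF₀ : Measurable F₀)
    (hsup : AEMeasurable (fun ω => ⨆ s ∈ Icc 0 T, ENNReal.ofReal (|Y s ω| ^ 2)) P)
    {l : ℝ≥0} (hl : 0 < l) :
    ∫⁻ ω, (∫⁻ s in Ioc 0 T, ENNReal.ofReal (|Y s ω| * |F₀ (s, ω)|)) ∂P ≤
      l * ∫⁻ ω, (⨆ s ∈ Icc 0 T, ENNReal.ofReal (|Y s ω| ^ 2)) ∂P +
        (l⁻¹ : ℝ≥0) * ∫⁻ ω, (∫⁻ s in Ioc 0 T, ENNReal.ofReal |F₀ (s, ω)|) ^ 2 ∂P := by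
  rw [← lintegral_const_mul' _ _ ENNReal.coe_ne_top, ← lintegral_const_mul' _ _ ENNReal.coe_ne_top,
    ← lintegral_add_left' (hsup.const_mul _)]
  refine lintegral_mono fun ω => ?_
  set σ := ⨆ s ∈ Icc 0 T, ENNReal.ofReal (|Y s ω| ^ 2) with hσ
  have hm : Measurable fun s => ENNReal.ofReal |F₀ (s, ω)| :=
    (continuous_abs.measurable.comp (hF₀.comp measurable_prodMk_right)).ennreal_ofReal
  have hsq : (σ ^ (1 / 2 : ℝ)) ^ 2 = σ := by
    rw [← ENNReal.rpow_natCast, ← ENNReal.rpow_mul]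
    simp
  calc _ ≤ ∫⁻ s in Ioc 0 T, σ ^ (1 / 2 : ℝ) * ENNReal.ofReal |F₀ (s, ω)| := by
        refine setLIntegral_mono' measurableSet_Ioc fun s hs => ?_
        rw [ENNReal.ofReal_mul (abs_nonneg _)]
        gcongr
        rw [← ENNReal.pow_le_pow_left_iff two_ne_zero, hsq, ← ENNReal.ofReal_pow (abs_nonneg _)]
        exact le_iSup₂ (f := fun s (_ : s ∈ Icc 0 T) => ENNReal.ofReal (|Y s ω| ^ 2)) s
          ⟨zero_le, hs.2⟩
    _ = σ ^ (1 / 2 : ℝ) * ∫⁻ s in Ioc 0 T, ENNReal.ofReal |F₀ (s, ω)| :=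
        lintegral_const_mul _ hm
    _ ≤ _ := by
        refine (mul_le_young _ _ hl).trans_eq ?_
        rw [hsq]

/-- The cross term of the energy estimate, by Young's inequality for `|Y| |F - F₀|`. The part with
`F₀` is left alone, because `F₀` is to enter only through its time integral. -/
theorem lintegral_mul_driver_le (h : IsLinearSolution S T F Y Z) (hF₀ : Measurable F₀)
    {ε : ℝ≥0} (hε : 0 < ε) (t : ℝ≥0) :
    2 * ∫⁻ ω, (∫⁻ s in Ioc t T, ENNReal.ofReal (|Y s ω| * |F (s, ω)|)) ∂P ≤
      2 * ∫⁻ ω, (∫⁻ s in Ioc 0 T, ENNReal.ofReal (|Y s ω| * |F₀ (s, ω)|)) ∂P +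
        (ε⁻¹ : ℝ≥0) * ∫⁻ ω, (∫⁻ s in Ioc t T, ENNReal.ofReal (Y s ω ^ 2)) ∂P +
        ε * ∫⁻ ω, (∫⁻ s in Ioc t T, ENNReal.ofReal ((F (s, ω) - F₀ (s, ω)) ^ 2)) ∂P := by
  obtain ⟨Y', hY'm, hY'⟩ := h.exists_version
  have hcongr : ∀ (k : ℝ≥0 → Ω → ℝ → ℝ≥0∞) (u : ℝ≥0),
      ∫⁻ ω, (∫⁻ s in Ioc u T, k s ω (Y s ω)) ∂P =
        ∫⁻ ω, (∫⁻ s in Ioc u T, k s ω (Y' (s, ω))) ∂P := by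
    intro k u
    refine lintegral_congr_ae ?_
    filter_upwards [hY'] with ω hω
    refine setLIntegral_congr_fun measurableSet_Ioc fun s hs => ?_
    simp only [hω s hs.2]
  have hm1 : Measurable fun p : ℝ≥0 × Ω => ENNReal.ofReal (|Y' p| * |F₀ p|) :=
    ((continuous_abs.measurable.comp hY'm).mul (continuous_abs.measurable.comp hF₀)).ennreal_ofReal
  have hm2 : Measurable fun p : ℝ≥0 × Ω => ENNReal.ofReal (Y' p ^ 2) :=
    (hY'm.pow_const 2).ennreal_ofReal
  have hm1' : Measurable fun ω => ∫⁻ s in Ioc t T, ENNReal.ofReal (|Y' (s, ω)| * |F₀ (s, ω)|) :=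
    hm1.lintegral_prod_left'
  have hm2' : Measurable fun ω => ∫⁻ s in Ioc t T, ENNReal.ofReal (Y' (s, ω) ^ 2) :=
    hm2.lintegral_prod_left'
  have hm12' : Measurable fun ω =>
      2 * (∫⁻ s in Ioc t T, ENNReal.ofReal (|Y' (s, ω)| * |F₀ (s, ω)|)) +
        (ε⁻¹ : ℝ≥0) * ∫⁻ s in Ioc t T, ENNReal.ofReal (Y' (s, ω) ^ 2) :=
    (hm1'.const_mul 2).add (hm2'.const_mul _)
  have hsub : ∫⁻ ω, (∫⁻ s in Ioc t T, ENNReal.ofReal (|Y s ω| * |F₀ (s, ω)|)) ∂P ≤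
      ∫⁻ ω, (∫⁻ s in Ioc 0 T, ENNReal.ofReal (|Y s ω| * |F₀ (s, ω)|)) ∂P :=
    lintegral_mono fun ω => lintegral_mono_set (Ioc_subset_Ioc_left zero_le)
  refine le_trans ?_ (add_le_add (add_le_add (mul_le_mul_right hsub 2) le_rfl) le_rfl)
  rw [hcongr fun s ω y => ENNReal.ofReal (|y| * |F (s, ω)|),
    hcongr fun s ω y => ENNReal.ofReal (|y| * |F₀ (s, ω)|),
    hcongr fun s ω y => ENNReal.ofReal (y ^ 2),
    ← lintegral_const_mul' _ _ ENNReal.ofNat_ne_top,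
    ← lintegral_const_mul' _ _ ENNReal.ofNat_ne_top,
    ← lintegral_const_mul' _ _ ENNReal.coe_ne_top, ← lintegral_const_mul' _ _ ENNReal.coe_ne_top,
    ← lintegral_add_left (hm1'.const_mul 2),
    ← lintegral_add_left hm12']
  refine lintegral_mono fun ω => ?_
  have hn1 : Measurable fun s => ENNReal.ofReal (|Y' (s, ω)| * |F₀ (s, ω)|) :=
    hm1.comp measurable_prodMk_right
  have hn2 : Measurable fun s => ENNReal.ofReal (Y' (s, ω) ^ 2) :=
    hm2.comp measurable_prodMk_right
  have hn12 : Measurable fun s => 2 * ENNReal.ofReal (|Y' (s, ω)| * |F₀ (s, ω)|) +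
    (ε⁻¹ : ℝ≥0) * ENNReal.ofReal (Y' (s, ω) ^ 2) := (hn1.const_mul 2).add (hn2.const_mul _)
  rw [← lintegral_const_mul' _ _ ENNReal.ofNat_ne_top,
    ← lintegral_const_mul' _ _ ENNReal.ofNat_ne_top,
    ← lintegral_const_mul' _ _ ENNReal.coe_ne_top, ← lintegral_const_mul' _ _ ENNReal.coe_ne_top,
    ← lintegral_add_left (hn1.const_mul 2), ← lintegral_add_left hn12]
  refine lintegral_mono fun s => ?_
  have hε' : (0 : ℝ) < ε := hε
  rw [← ENNReal.ofReal_ofNat, ← ENNReal.ofReal_coe_nnreal, ← ENNReal.ofReal_coe_nnreal,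
    ← ENNReal.ofReal_mul (by norm_num), ← ENNReal.ofReal_mul (by norm_num),
    ← ENNReal.ofReal_mul (NNReal.coe_nonneg _), ← ENNReal.ofReal_mul (NNReal.coe_nonneg _),
    ← ENNReal.ofReal_add (by positivity) (by positivity),
    ← ENNReal.ofReal_add (by positivity) (by positivity)]
  refine ENNReal.ofReal_le_ofReal ?_
  set y := Y' (s, ω)
  set f := F (s, ω)
  set f₀ := F₀ (s, ω)
  have h1 : |f| ≤ |f₀| + |f - f₀| := by
    have := abs_add_le f₀ (f - f₀)
    rwa [add_sub_cancel] at this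
  have h2 : ((ε⁻¹ : ℝ≥0) : ℝ) * (|y| - ε * |f - f₀|) ^ 2 =
      ((ε⁻¹ : ℝ≥0) : ℝ) * y ^ 2 + ε * (f - f₀) ^ 2 - 2 * (|y| * |f - f₀|) := by
    rw [← sq_abs y, ← sq_abs (f - f₀)]
    push_cast
    field_simp
    ring
  have h3 : (0 : ℝ) ≤ ((ε⁻¹ : ℝ≥0) : ℝ) * (|y| - ε * |f - f₀|) ^ 2 := by positivity
  have h4 := mul_le_mul_of_nonneg_left h1 (abs_nonneg y)
  linarith

/-- The a priori estimate for the equation with a given driver `F`, when the mean square of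
`F - F₀` is controlled by the solution itself. The quantities `Φ`, `Ψ`, `q`, `σ` are finite before
they are estimated, which is what allows absorbing them. -/
theorem exists_const (D₁ D₂ T : ℝ≥0) (hD₂ : 0 < D₂) : ∃ C : ℝ≥0, 0 < C ∧
    ∀ (N : ℕ) (Ω : Type u) [MeasurableSpace Ω] (P : Measure Ω) [IsProbabilityMeasure P]
      (S : MarkovChain N P) (F F₀ : ℝ≥0 × Ω → ℝ) (Y : ℝ≥0 → Ω → ℝ) (Z : ℝ≥0 → Ω → Fin N → ℝ)
      (τ : ℝ≥0∞), IsLinearSolution S T F Y Z → Measurable F₀ →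
      (∀ t ≤ T, ∫⁻ ω, (∫⁻ s in Ioc t T, ENNReal.ofReal ((F (s, ω) - F₀ (s, ω)) ^ 2)) ∂P ≤
        D₁ * (∫⁻ ω, (∫⁻ s in Ioc t T, ENNReal.ofReal (Y s ω ^ 2)) ∂P + τ) +
        D₂ * (∫⁻ ω, (∫⁻ s in Ioc t T, ENNReal.ofReal (S.semiSq s ω (Z s ω))) ∂P + τ)) →
      ∫⁻ ω, (⨆ s ∈ Icc 0 T, ENNReal.ofReal (|Y s ω| ^ 2)) ∂P +
          ∫⁻ ω, (∫⁻ s in Ioc 0 T, ENNReal.ofReal (S.semiSq s ω (Z s ω))) ∂P ≤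
        C * (∫⁻ ω, ENNReal.ofReal (Y T ω ^ 2) ∂P +
          ∫⁻ ω, (∫⁻ s in Ioc 0 T, ENNReal.ofReal |F₀ (s, ω)|) ^ 2 ∂P + τ) := by
  -- with this `ε` half of the contribution of `Z` is left over
  set ε : ℝ≥0 := (2 * D₂)⁻¹ with hε
  have hε0 : 0 < ε := by positivity
  set B : ℝ≥0 := ε⁻¹ + ε * D₁ with hB
  set B' : ℝ≥0 := ε * D₁ + 1 / 2 with hB'
  obtain ⟨G, hG⟩ := exists_gronwall B T
  obtain ⟨C, hC0, hC⟩ := exists_const_of_system G B B' D₁ D₂ T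
  refine ⟨C, hC0, fun N Ω _ P _ S F F₀ Y Z τ h hF₀ hq => ?_⟩
  obtain ⟨hsup, hσ⟩ := h.lintegral_iSup_le hF₀
  have he : ∀ l : ℝ≥0, 0 < l → _ := fun l hl => lintegral_mul_le hF₀ hsup hl
  have hen := fun t ht => (h.energy (t := t) ht).trans
    (add_le_add le_rfl (h.lintegral_mul_driver_le hF₀ hε0 t))
  have hΦt : ∀ t, ∫⁻ ω, (∫⁻ s in Ioc t T, ENNReal.ofReal (Y s ω ^ 2)) ∂P =
      ∫⁻ s in Ioc t T, (∫⁻ ω, ENNReal.ofReal (Y s ω ^ 2) ∂P) := by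
    intro t
    obtain ⟨Y', hY'm, hY'⟩ := h.exists_version
    have hm : Measurable fun p : ℝ≥0 × Ω => ENNReal.ofReal (Y' p ^ 2) :=
      (hY'm.pow_const 2).ennreal_ofReal
    calc _ = ∫⁻ ω, (∫⁻ s in Ioc t T, ENNReal.ofReal (Y' (s, ω) ^ 2)) ∂P := by
          refine lintegral_congr_ae ?_
          filter_upwards [hY'] with ω hω
          refine setLIntegral_congr_fun measurableSet_Ioc fun s hs => ?_
          simp only [hω s hs.2]
      _ = ∫⁻ s in Ioc t T, (∫⁻ ω, ENNReal.ofReal (Y' (s, ω) ^ 2) ∂P) :=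
          lintegral_lintegral_swap (hm.comp measurable_swap).aemeasurable
      _ = _ := by
          refine setLIntegral_congr_fun measurableSet_Ioc fun s hs => ?_
          refine lintegral_congr_ae ?_
          filter_upwards [hY'] with ω hω
          rw [hω s hs.2]
  have hafin := h.lintegral_Y_last
  have hΦfin := h.lintegral_Y
  have hΨfin := h.lintegral_Z
  have hΨfin' : ∀ t, ∫⁻ ω, (∫⁻ s in Ioc t T, ENNReal.ofReal (S.semiSq s ω (Z s ω))) ∂P < ∞ :=
    fun t => (lintegral_mono fun ω => lintegral_mono_set
      (Ioc_subset_Ioc_left zero_le)).trans_lt hΨfin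
  set a := ∫⁻ ω, ENNReal.ofReal (Y T ω ^ 2) ∂P with ha
  set d := ∫⁻ ω, (∫⁻ s in Ioc 0 T, ENNReal.ofReal |F₀ (s, ω)|) ^ 2 ∂P with hd
  set e := ∫⁻ ω, (∫⁻ s in Ioc 0 T, ENNReal.ofReal (|Y s ω| * |F₀ (s, ω)|)) ∂P with he'
  set σ := ∫⁻ ω, (⨆ s ∈ Icc 0 T, ENNReal.ofReal (|Y s ω| ^ 2)) ∂P with hσ'
  set A : ℝ≥0∞ := a + 2 * e + B' * τ with hA
  have hC0' : (C : ℝ≥0∞) ≠ 0 := by simpa using hC0.ne'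
  -- if the data are infinite there is nothing to prove
  rcases eq_or_ne τ ∞ with rfl | hτ
  · simp [ENNReal.mul_top hC0']
  rcases eq_or_ne d ∞ with hd' | hd'
  · simp [hd', ENNReal.mul_top hC0']
  -- the energy estimate with the driver estimated by the solution
  have hmain : ∀ t ≤ T, ∫⁻ ω, ENNReal.ofReal (Y t ω ^ 2) ∂P +
      1 / 2 * ∫⁻ ω, (∫⁻ s in Ioc t T, ENNReal.ofReal (S.semiSq s ω (Z s ω))) ∂P ≤
      A + B * ∫⁻ ω, (∫⁻ s in Ioc t T, ENNReal.ofReal (Y s ω ^ 2)) ∂P := by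
    intro t ht
    have h1 := (hen t ht).trans (add_le_add le_rfl (add_le_add le_rfl
      (mul_le_mul_right (hq t ht) (ε : ℝ≥0∞))))
    have hfin := hΨfin' t
    set φ := ∫⁻ ω, ENNReal.ofReal (Y t ω ^ 2) ∂P
    set Φ := ∫⁻ ω, (∫⁻ s in Ioc t T, ENNReal.ofReal (Y s ω ^ 2)) ∂P
    set Ψ := ∫⁻ ω, (∫⁻ s in Ioc t T, ENNReal.ofReal (S.semiSq s ω (Z s ω))) ∂P
    have h2 : (ε : ℝ≥0∞) * D₂ = 1 / 2 := by
      rw [← ENNReal.coe_mul, hε, mul_inv, mul_assoc, inv_mul_cancel₀ hD₂.ne', mul_one]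
      simp
    refine (ENNReal.add_le_add_iff_right (a := 1 / 2 * Ψ)
      (ENNReal.mul_lt_top (by simp) hfin).ne).1 ?_
    calc φ + 1 / 2 * Ψ + 1 / 2 * Ψ = φ + Ψ := by
          rw [add_assoc, ← add_mul, ENNReal.add_halves, one_mul]
      _ ≤ _ := h1
      _ = a + 2 * e + (ε * D₁ + ε * D₂) * τ + ((ε⁻¹ : ℝ≥0) + ε * D₁) * Φ + ε * D₂ * Ψ := by ring
      _ = _ := by
          rw [h2, hA, hB, hB']
          push_cast
          simp
  have hΦ := hG (fun s => ∫⁻ ω, ENNReal.ofReal (Y s ω ^ 2) ∂P) A ((hΦt 0).symm.trans_lt hΦfin)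
    fun t ht => by
      rw [← hΦt]
      exact le_self_add.trans (hmain t ht)
  rw [← hΦt] at hΦ
  have hΨ := le_add_self.trans (hmain 0 zero_le)
  have hq0 := hq 0 zero_le
  have hFfin : ∫⁻ ω, (∫⁻ s in Ioc 0 T, ENNReal.ofReal ((F (s, ω) - F₀ (s, ω)) ^ 2)) ∂P < ∞ := by
    refine hq0.trans_lt (ENNReal.add_lt_top.2 ⟨?_, ?_⟩) <;>
    refine ENNReal.mul_lt_top ENNReal.coe_lt_top (ENNReal.add_lt_top.2 ⟨?_, hτ.lt_top⟩)
    · exact hΦfin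
    · exact hΨfin
  set Φ := ∫⁻ ω, (∫⁻ s in Ioc 0 T, ENNReal.ofReal (Y s ω ^ 2)) ∂P with hΦ'
  set Ψ := ∫⁻ ω, (∫⁻ s in Ioc 0 T, ENNReal.ofReal (S.semiSq s ω (Z s ω))) ∂P with hΨ'
  set q := ∫⁻ ω, (∫⁻ s in Ioc 0 T, ENNReal.ofReal ((F (s, ω) - F₀ (s, ω)) ^ 2)) ∂P with hq'
  have hσfin : σ < ∞ := hσ.trans_lt (ENNReal.mul_lt_top (by simp) (ENNReal.add_lt_top.2
    ⟨ENNReal.add_lt_top.2 ⟨hafin, hd'.lt_top⟩, ENNReal.mul_lt_top ENNReal.coe_lt_top hFfin⟩))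
  have hefin : e < ∞ := (he 1 one_pos).trans_lt (ENNReal.add_lt_top.2
    ⟨ENNReal.mul_lt_top ENNReal.coe_lt_top hσfin,
      ENNReal.mul_lt_top ENNReal.coe_lt_top hd'.lt_top⟩)
  have hΨ2 : Ψ ≤ 2 * (A + B * Φ) := by
    calc Ψ = 2 * (1 / 2 * Ψ) := by
          rw [← mul_assoc, one_div, ENNReal.mul_inv_cancel two_ne_zero (by simp), one_mul]
      _ ≤ _ := by gcongr
  rw [hA] at hΦ hΨ2
  clear_value a d e σ Φ Ψ q
  lift a to ℝ≥0 using hafin.ne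
  lift d to ℝ≥0 using hd'
  lift τ to ℝ≥0 using hτ
  lift e to ℝ≥0 using hefin.ne
  lift σ to ℝ≥0 using hσfin.ne
  lift Φ to ℝ≥0 using hΦfin.ne
  lift Ψ to ℝ≥0 using hΨfin.ne
  lift q to ℝ≥0 using hFfin.ne
  have := hC a d τ e σ Φ Ψ q (by exact_mod_cast hΦ) (by exact_mod_cast hΨ2)
    (by exact_mod_cast hq0) (by exact_mod_cast hσ) fun l hl => by exact_mod_cast he l hl
  exact_mod_cast this

end IsLinearSolution

end AnticipatedBSDE

/-! ### The Lipschitz condition in mean square -/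

namespace AnticipatedBSDE

/-- The change of variables bound for functions which may take the value `∞`, by truncation. -/
theorem DelayChange.lintegral_comp_le {T K L : ℝ≥0} {δ : ℝ≥0 → ℝ≥0} (h : DelayChange T K L δ)
    (hδ : ContinuousOn δ (Icc 0 T)) {t : ℝ≥0} (ht : t ≤ T) {g : ℝ≥0 → ℝ≥0∞} (hg : Measurable g)
    (hfin : ∫⁻ s in Icc t (T + K), g s < ∞) :
    ∫⁻ s in Icc t T, g (s + δ s) ≤ L * ∫⁻ s in Icc t (T + K), g s := by
  have hδm : AEMeasurable (fun s => s + δ s) ((volume : Measure ℝ≥0).restrict (Icc t T)) :=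
    ((continuousOn_id.add (hδ.mono (Icc_subset_Icc_left zero_le))).aemeasurable measurableSet_Icc)
  have hsup : ∀ x : ℝ≥0∞, ⨆ n : ℕ, min x n = x := by
    intro x
    have h1 : (⨆ n : ℕ, min x n) = min x (⨆ n : ℕ, (n : ℝ≥0∞)) := (inf_iSup_eq x _).symm
    rw [h1, ENNReal.iSup_natCast, min_eq_left le_top]
  have hlt : ∀ (x : ℝ≥0∞) (n : ℕ), min x n ≠ ∞ := fun x n =>
    ((min_le_right _ _).trans_lt (ENNReal.natCast_lt_top n)).ne
  calc ∫⁻ s in Icc t T, g (s + δ s) = ∫⁻ s in Icc t T, ⨆ n : ℕ, min (g (s + δ s)) n := by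
        simp only [hsup]
    _ = ⨆ n : ℕ, ∫⁻ s in Icc t T, min (g (s + δ s)) n := by
        refine lintegral_iSup' (fun n => ?_) (Eventually.of_forall fun s m n hmn => ?_)
        · exact (hg.min measurable_const).comp_aemeasurable hδm
        · exact min_le_min le_rfl (by exact_mod_cast hmn)
    _ ≤ _ := by
        refine iSup_le fun n => ?_
        have h1 := h t ⟨zero_le, ht⟩ (fun s => (min (g s) n).toNNReal)
          (hg.min measurable_const).ennreal_toNNReal
        simp only [ENNReal.coe_toNNReal (hlt _ n)] at h1
        have h2 : ∫⁻ s in Icc t (T + K), min (g s) n ≤ ∫⁻ s in Icc t (T + K), g s :=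
          lintegral_mono fun s => min_le_left _ _
        exact (h1 (h2.trans_lt hfin)).trans (mul_le_mul_right h2 _)

theorem IsRCLLOn.mono {E : Type*} [TopologicalSpace E] {g : ℝ≥0 → E} {a b a' b' : ℝ≥0}
    (h : IsRCLLOn g a b) (ha : a ≤ a') (hb : b' ≤ b) : IsRCLLOn g a' b' :=
  ⟨fun t ht => h.1 t ⟨ha.trans ht.1, ht.2.trans_le hb⟩,
    fun t ht => h.2 t ⟨ha.trans_lt ht.1, ht.2.trans hb⟩⟩

namespace MarkovChain

variable {N : ℕ} {Ω : Type u} [MeasurableSpace Ω] {P : Measure Ω} {S : MarkovChain N P}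
  {a b s : ℝ≥0} {Y : ℝ≥0 → Ω → ℝ} {Z : ℝ≥0 → Ω → Fin N → ℝ}

theorem semiSq_zero (t : ℝ≥0) (ω : Ω) : S.semiSq t ω 0 = 0 := by
  simp [semiSq]

theorem sq_semi (t : ℝ≥0) (ω : Ω) (z : Fin N → ℝ) : S.semi t ω z ^ 2 = S.semiSq t ω z :=
  Real.sq_sqrt (S.semiSq_nonneg _ _ _)

theorem MemL2.mono_left (h : S.MemL2 a b Y) (has : a ≤ s) : S.MemL2 s b Y := by
  refine ⟨fun t ht => h.1 t ⟨has.trans ht.1, ht.2⟩, ?_, ?_⟩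
  · filter_upwards [h.2.1] with ω hω using hω.mono has le_rfl
  · exact (lintegral_mono fun ω => lintegral_mono_set (Icc_subset_Icc_left has)).trans_lt h.2.2

theorem MemH2.mono_left (h : S.MemH2 a b Z) (has : a ≤ s) : S.MemH2 s b Z := by
  refine ⟨?_, (lintegral_mono fun ω => lintegral_mono_set
    (Icc_subset_Icc_left has)).trans_lt h.2⟩
  have h1 : StronglyMeasurable[S.filtration.predictable]
      ((Prod.fst ⁻¹' Icc s b).indicator (Function.uncurry fun (t : ℝ≥0) (ω : Ω) =>
        (Icc a b).indicator (fun s => Z s ω) t)) :=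
    StronglyMeasurable.indicator h.1 (measurable_fst_predictable measurableSet_Icc)
  have h2 : (Function.uncurry fun (t : ℝ≥0) (ω : Ω) => (Icc s b).indicator (fun s => Z s ω) t) =
      (Prod.fst ⁻¹' Icc s b).indicator (Function.uncurry fun (t : ℝ≥0) (ω : Ω) =>
        (Icc a b).indicator (fun s => Z s ω) t) := by
    ext1 ⟨t, ω⟩
    by_cases ht : t ∈ Icc s b
    · rw [indicator_of_mem (show (t, ω) ∈ Prod.fst ⁻¹' Icc s b from ht)]
      simp only [Function.uncurry_apply_pair]
      rw [indicator_of_mem ht, indicator_of_mem (show t ∈ Icc a b from ⟨has.trans ht.1, ht.2⟩)]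
    · rw [indicator_of_notMem (show (t, ω) ∉ Prod.fst ⁻¹' Icc s b from ht)]
      simp only [Function.uncurry_apply_pair]
      rw [indicator_of_notMem ht]
  rw [IsStronglyPredictable, h2]
  exact h1

theorem memL2_zero : S.MemL2 a b 0 := by
  refine ⟨fun t _ => stronglyMeasurable_const,
    Eventually.of_forall fun ω => ⟨fun t _ => ?_, fun t _ => ⟨0, ?_⟩⟩, ?_⟩
  · exact continuousWithinAt_const
  · exact tendsto_const_nhds
  · simp

theorem memH2_zero : S.MemH2 a b 0 := by
  refine ⟨?_, ?_⟩
  · have : (fun t ω => (Icc a b).indicator (fun s => (0 : ℝ≥0 → Ω → Fin N → ℝ) s ω) t) =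
        fun _ _ => 0 := by
      ext t ω
      simp
    rw [this]
    exact stronglyMeasurable_const
  · simp [semiSq_zero]

theorem memL2At_zero : S.MemL2At s 0 := ⟨stronglyMeasurable_const, MemLp.zero⟩

theorem memH2At_zero : S.MemH2At s 0 := ⟨stronglyMeasurable_const, by simp [semiSq_zero]⟩

theorem MemL2.memL2At (h : S.MemL2 a b Y) (hs : s ∈ Icc a b)
    (hfin : ∫⁻ ω, ENNReal.ofReal (Y s ω ^ 2) ∂P < ∞) : S.MemL2At s (Y s) := by
  have hm : AEStronglyMeasurable (Y s) P :=
    ((h.1 s hs).mono (S.filtration.le s)).aestronglyMeasurable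
  refine ⟨h.1 s hs, (memLp_two_iff_integrable_sq hm).2 ⟨hm.pow 2, ?_⟩⟩
  rwa [hasFiniteIntegral_iff_ofReal (Eventually.of_forall fun x => sq_nonneg _)]

theorem MemH2.stronglyMeasurable (h : S.MemH2 a b Z) (hs : s ∈ Icc a b) :
    StronglyMeasurable[S.filtration s] (Z s) := by
  have := h.1.stronglyAdapted s
  simpa only [indicator_of_mem hs] using this

theorem MemH2.memH2At (h : S.MemH2 a b Z) (hs : s ∈ Icc a b)
    (hfin : ∫⁻ ω, ENNReal.ofReal (S.semiSq s ω (Z s ω)) ∂P < ∞) : S.MemH2At s (Z s) :=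
  ⟨h.stronglyMeasurable hs, hfin⟩

theorem measurable_semiSq_apply (s : ℝ≥0) {z : Ω → Fin N → ℝ} (hz : Measurable z) :
    Measurable fun ω => S.semiSq s ω (z ω) :=
  (S.measurable_semiSq (Z := fun _ => z) (hz.comp measurable_snd)).comp measurable_prodMk_left

end MarkovChain

variable {N : ℕ} {Ω : Type u} [MeasurableSpace Ω] {P : Measure Ω} {S : MarkovChain N P}
  {T K L : ℝ≥0} {c₁ c₂ : ℝ} {δ ζ : ℝ≥0 → ℝ≥0} {f : Driver N Ω}
  {Y : ℝ≥0 → Ω → ℝ} {Z : ℝ≥0 → Ω → Fin N → ℝ}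

/-- The Lipschitz condition in mean square: by Jensen's inequality the conditional expectations are
controlled by the second moments at the anticipated times. The condition only applies if these are
finite; otherwise the right-hand side is infinite. -/
theorem Driver.H1.lintegral_sq_sub_le (hf : f.H1 S T K c₁ c₂) (hc₁ : 0 < c₁) (hc₂ : 0 < c₂)
    (hδ : DelayBound T K δ) (hζ : DelayBound T K ζ) (hY : S.MemL2 0 (T + K) Y)
    (hZ : S.MemH2 0 (T + K) Z) {s : ℝ≥0} (hs : s ∈ Icc 0 T) :
    ∫⁻ ω, ENNReal.ofReal ((f.along δ ζ Y Z s ω - f.atZero δ ζ s ω) ^ 2) ∂P ≤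
      ENNReal.ofReal (4 * c₁ ^ 2) * (∫⁻ ω, ENNReal.ofReal (Y s ω ^ 2) ∂P +
        ∫⁻ ω, ENNReal.ofReal (Y (s + δ s) ω ^ 2) ∂P) +
      ENNReal.ofReal (4 * c₂ ^ 2) * (∫⁻ ω, ENNReal.ofReal (S.semiSq s ω (Z s ω)) ∂P +
        ∫⁻ ω, ENNReal.ofReal (S.semiSq (s + ζ s) ω (Z (s + ζ s) ω)) ∂P) := by
  have hC₁ : ENNReal.ofReal (4 * c₁ ^ 2) ≠ 0 := (ENNReal.ofReal_pos.2 (by positivity)).ne'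
  have hC₂ : ENNReal.ofReal (4 * c₂ ^ 2) ≠ 0 := (ENNReal.ofReal_pos.2 (by positivity)).ne'
  set r := s + δ s with hr
  set r' := s + ζ s with hr'
  rcases eq_or_ne (∫⁻ ω, ENNReal.ofReal (Y r ω ^ 2) ∂P) ∞ with h1 | h1
  · rw [h1, add_top, ENNReal.mul_top hC₁, top_add]
    exact le_top
  rcases eq_or_ne (∫⁻ ω, ENNReal.ofReal (S.semiSq r' ω (Z r' ω)) ∂P) ∞ with h2 | h2
  · rw [h2, add_top, ENNReal.mul_top hC₂, add_top]
    exact le_top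
  have hsT : s ≤ T + K := hs.2.trans le_self_add
  have hrI : r ∈ Icc 0 (T + K) := ⟨zero_le, hδ s hs⟩
  have hrI' : r' ∈ Icc 0 (T + K) := ⟨zero_le, hζ s hs⟩
  have hlip := hf s hs r ⟨le_self_add, hrI.2⟩ r' ⟨le_self_add, hrI'.2⟩ Y 0 (hY.mono_left zero_le)
    MarkovChain.memL2_zero (hY.memL2At hrI h1.lt_top) MarkovChain.memL2At_zero
    Z 0 (hZ.mono_left zero_le) MarkovChain.memH2_zero (hZ.memH2At hrI' h2.lt_top)
    MarkovChain.memH2At_zero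
  set U : Ω → ℝ := P[fun ω' => |Y r ω' - (0 : ℝ≥0 → Ω → ℝ) r ω'| | S.filtration s] with hU
  set V : Ω → ℝ := P[fun ω' => S.semi r' ω' (Z r' ω' - (0 : ℝ≥0 → Ω → Fin N → ℝ) r' ω') |
    S.filtration s] with hV
  have hUle : ∫⁻ ω, ENNReal.ofReal (U ω ^ 2) ∂P ≤ ∫⁻ ω, ENNReal.ofReal (Y r ω ^ 2) ∂P := by
    refine (lintegral_sq_condExp_le _).trans_eq ?_
    simp [sq_abs]
  have hVle : ∫⁻ ω, ENNReal.ofReal (V ω ^ 2) ∂P ≤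
      ∫⁻ ω, ENNReal.ofReal (S.semiSq r' ω (Z r' ω)) ∂P := by
    refine (lintegral_sq_condExp_le _).trans_eq ?_
    simp [MarkovChain.sq_semi]
  have hm1 : Measurable fun ω => ENNReal.ofReal (Y s ω ^ 2) :=
    (((hY.1 s ⟨zero_le, hsT⟩).mono (S.filtration.le s)).measurable.pow_const 2).ennreal_ofReal
  have hm2 : Measurable fun ω => ENNReal.ofReal (U ω ^ 2) :=
    ((stronglyMeasurable_condExp.mono (S.filtration.le s)).measurable.pow_const 2).ennreal_ofReal
  have hm3 : Measurable fun ω => ENNReal.ofReal (S.semiSq s ω (Z s ω)) :=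
    (MarkovChain.measurable_semiSq_apply s
      ((hZ.stronglyMeasurable ⟨zero_le, hsT⟩).mono (S.filtration.le s)).measurable).ennreal_ofReal
  have hm12 : Measurable fun ω => ENNReal.ofReal (4 * c₁ ^ 2) *
      (ENNReal.ofReal (Y s ω ^ 2) + ENNReal.ofReal (U ω ^ 2)) := (hm1.add hm2).const_mul _
  calc _ ≤ ∫⁻ ω, (ENNReal.ofReal (4 * c₁ ^ 2) *
          (ENNReal.ofReal (Y s ω ^ 2) + ENNReal.ofReal (U ω ^ 2)) +
        ENNReal.ofReal (4 * c₂ ^ 2) *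
          (ENNReal.ofReal (S.semiSq s ω (Z s ω)) + ENNReal.ofReal (V ω ^ 2))) ∂P := by
        refine lintegral_mono_ae ?_
        filter_upwards [hlip] with ω hω
        have h3 := hω (Y s ω) 0 (Z s ω) 0
        rw [sub_zero, sub_zero] at h3
        have hq := S.semiSq_nonneg s ω (Z s ω)
        rw [← ENNReal.ofReal_add (sq_nonneg _) (sq_nonneg _),
          ← ENNReal.ofReal_add hq (sq_nonneg _),
          ← ENNReal.ofReal_mul (by positivity), ← ENNReal.ofReal_mul (by positivity),
          ← ENNReal.ofReal_add (by positivity) (by positivity)]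
        refine ENNReal.ofReal_le_ofReal ?_
        have h4 : |f.along δ ζ Y Z s ω - f.atZero δ ζ s ω| ≤
          c₁ * (|Y s ω| + U ω) + c₂ * (S.semi s ω (Z s ω) + V ω) := h3
        rw [← sq_abs (f.along δ ζ Y Z s ω - _), ← sq_abs (Y s ω), ← MarkovChain.sq_semi]
        refine (pow_le_pow_left₀ (abs_nonneg _) h4 2).trans ?_
        nlinarith [sq_nonneg (c₁ * (|Y s ω| - U ω)), sq_nonneg (c₂ * (S.semi s ω (Z s ω) - V ω)),
          sq_nonneg (c₁ * (|Y s ω| + U ω) - c₂ * (S.semi s ω (Z s ω) + V ω))]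
    _ = ENNReal.ofReal (4 * c₁ ^ 2) * (∫⁻ ω, ENNReal.ofReal (Y s ω ^ 2) ∂P +
          ∫⁻ ω, ENNReal.ofReal (U ω ^ 2) ∂P) +
        ENNReal.ofReal (4 * c₂ ^ 2) * (∫⁻ ω, ENNReal.ofReal (S.semiSq s ω (Z s ω)) ∂P +
          ∫⁻ ω, ENNReal.ofReal (V ω ^ 2) ∂P) := by
        rw [lintegral_add_left hm12, lintegral_const_mul' _ _ ENNReal.ofReal_ne_top,
          lintegral_const_mul' _ _ ENNReal.ofReal_ne_top, lintegral_add_left hm1,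
          lintegral_add_left hm3]
    _ ≤ _ := by gcongr

end AnticipatedBSDE

/-! ### The driver along a solution -/

namespace AnticipatedBSDE

/-- A function and its delayed copy, integrated over `(t, T]`, are controlled by the function over
`(t, T]` and over the terminal interval. -/
theorem DelayChange.lintegral_add_comp_le {T K L : ℝ≥0} {δ : ℝ≥0 → ℝ≥0} (h : DelayChange T K L δ)
    (hδ : ContinuousOn δ (Icc 0 T)) {t : ℝ≥0} (ht : t ≤ T) {g : ℝ≥0 → ℝ≥0∞} (hg : Measurable g)
    (hfin : ∫⁻ s in Icc 0 (T + K), g s < ∞) :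
    (∫⁻ s in Ioc t T, (g s + g (s + δ s))) ≤
      (1 + L : ℝ≥0) * ((∫⁻ s in Ioc t T, g s) + (∫⁻ s in Icc T (T + K), g s)) := by
  have h1 := h.lintegral_comp_le hδ ht hg
    ((lintegral_mono_set (Icc_subset_Icc_left zero_le)).trans_lt hfin)
  have h2 : (∫⁻ s in Icc t (T + K), g s) ≤
      (∫⁻ s in Ioc t T, g s) + (∫⁻ s in Icc T (T + K), g s) := by
    rw [restrict_Ioc_eq_restrict_Icc, ← Icc_union_Icc_eq_Icc ht (le_self_add : T ≤ T + K)]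
    exact lintegral_union_le g (Icc t T) (Icc T (T + K))
  rw [lintegral_add_left hg]
  calc _ ≤ (∫⁻ s in Ioc t T, g s) +
          L * ((∫⁻ s in Ioc t T, g s) + (∫⁻ s in Icc T (T + K), g s)) := by
        refine add_le_add le_rfl ?_
        rw [restrict_Ioc_eq_restrict_Icc (a := t)]
        refine h1.trans (mul_le_mul_right (h2.trans_eq ?_) _)
        rw [restrict_Ioc_eq_restrict_Icc]
    _ ≤ ((∫⁻ s in Ioc t T, g s) + (∫⁻ s in Icc T (T + K), g s)) +
          L * ((∫⁻ s in Ioc t T, g s) + (∫⁻ s in Icc T (T + K), g s)) := by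
        gcongr
        exact le_self_add
    _ = _ := by
        push_cast
        ring

/-- A jointly measurable version, which agrees with the process for almost every time almost surely,
and also almost surely for almost every time. -/
theorem exists_measurable_version {Ω : Type u} [MeasurableSpace Ω] {P : Measure Ω} [SFinite P]
    {T : ℝ≥0} {G : ℝ≥0 → Ω → ℝ}
    (hG : AEStronglyMeasurable (fun p : ℝ≥0 × Ω => G p.1 p.2)
      ((volume.restrict (Icc 0 T)).prod P)) :
    ∃ F : ℝ≥0 × Ω → ℝ, Measurable F ∧
      (∀ᵐ s ∂(volume : Measure ℝ≥0).restrict (Icc 0 T), ∀ᵐ ω ∂P, G s ω = F (s, ω)) ∧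
      ∀ᵐ ω ∂P, ∀ᵐ s ∂(volume : Measure ℝ≥0).restrict (Icc 0 T), G s ω = F (s, ω) := by
  have h := hG.ae_eq_mk
  refine ⟨hG.mk _, hG.stronglyMeasurable_mk.measurable, Measure.ae_ae_of_ae_prod h, ?_⟩
  have h' : ∀ᵐ p ∂P.prod ((volume : Measure ℝ≥0).restrict (Icc 0 T)),
      G p.2 p.1 = hG.mk _ (p.2, p.1) :=
    Measure.measurePreserving_swap.quasiMeasurePreserving.ae h
  exact Measure.ae_ae_of_ae_prod h'

variable {N : ℕ} {Ω : Type u} [MeasurableSpace Ω] {P : Measure Ω} {S : MarkovChain N P}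
  {T K L : ℝ≥0} {c₁ c₂ : ℝ} {δ ζ : ℝ≥0 → ℝ≥0} {f : Driver N Ω}
  {Y : ℝ≥0 → Ω → ℝ} {Z : ℝ≥0 → Ω → Fin N → ℝ} {ξ : ℝ≥0 → Ω → ℝ} {η : ℝ≥0 → Ω → Fin N → ℝ}

/-- `Z` on `[0, b]`, extended by zero: this process is predictable for all times if `Z` is
predictable on `[0, b]`. -/
def cutoff (b : ℝ≥0) (Z : ℝ≥0 → Ω → Fin N → ℝ) (t : ℝ≥0) (ω : Ω) : Fin N → ℝ :=
  (Icc 0 b).indicator (fun s => Z s ω) t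

theorem cutoff_eq {Ω : Type u} {Z : ℝ≥0 → Ω → Fin N → ℝ} {b s : ℝ≥0} (hs : s ≤ b) (ω : Ω) :
    cutoff b Z s ω = Z s ω :=
  indicator_of_mem (show s ∈ Icc 0 b from ⟨zero_le, hs⟩) _

theorem MarkovChain.MemH2.measurable_cutoff {b : ℝ≥0} (h : S.MemH2 0 b Z) :
    Measurable[S.filtration.predictable] fun p : ℝ≥0 × Ω => cutoff b Z p.1 p.2 :=
  StronglyMeasurable.measurable h.1

/-- The stochastic integral over `(a, b]` only depends on the path of the integrand there. -/
theorem MarkovChain.stochInt_congr {Z' : ℝ≥0 → Ω → Fin N → ℝ} {a b : ℝ≥0} {ω : Ω}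
    (h : ∀ s ∈ Ioc a b, Z' s ω = Z s ω) : S.stochInt Z' a b ω = S.stochInt Z a b ω := by
  unfold stochInt
  congr 1
  · refine finsum_congr fun s => finsum_congr fun hs => ?_
    rw [h s hs]
  · refine setIntegral_congr_fun measurableSet_Ioc fun s hs => ?_
    simp only [h s hs]

/-- A jointly measurable version of an RCLL process. -/
theorem MarkovChain.MemL2.exists_version {b : ℝ≥0} (h : S.MemL2 0 b Y) :
    ∃ Y' : ℝ≥0 × Ω → ℝ, Measurable Y' ∧ ∀ᵐ ω ∂P, ∀ t ≤ b, Y' (t, ω) = Y t ω := by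
  refine ⟨rightVersion b Y, measurable_rightVersion fun t ht =>
    ((h.1 t ⟨zero_le, ht⟩).mono (S.filtration.le t)).measurable, ?_⟩
  filter_upwards [h.2.1] with ω hω t ht using rightVersion_eq hω ht

/-- The second moments of `(Y, Z)` over the terminal interval `[T, T + K]`. -/
def terminalEnergy (S : MarkovChain N P) (T K : ℝ≥0) (Y : ℝ≥0 → Ω → ℝ)
    (Z : ℝ≥0 → Ω → Fin N → ℝ) : ℝ≥0∞ :=
  ∫⁻ ω, (∫⁻ s in Icc T (T + K),
    (ENNReal.ofReal (|Y s ω| ^ 2) + ENNReal.ofReal (S.semiSq s ω (Z s ω)))) ∂P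

/-- The driver along `(Y, Z)`, compared with the driver at zero, is controlled in mean square by the
second moments of `(Y, Z)`. -/
theorem lintegral_sq_driver_sub_le [IsProbabilityMeasure P] (hf : f.H1 S T K c₁ c₂) (hc₁ : 0 < c₁)
    (hc₂ : 0 < c₂) (hδ : DelayBound T K δ) (hζ : DelayBound T K ζ)
    (hδ' : DelayChange T K L δ) (hζ' : DelayChange T K L ζ) (hδc : ContinuousOn δ (Icc 0 T))
    (hζc : ContinuousOn ζ (Icc 0 T)) (hY : S.MemL2 0 (T + K) Y) (hZ : S.MemH2 0 (T + K) Z)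
    {F F₀ : ℝ≥0 × Ω → ℝ} (hFm : Measurable F) (hF₀m : Measurable F₀)
    (hF : ∀ᵐ s ∂(volume : Measure ℝ≥0).restrict (Icc 0 T), ∀ᵐ ω ∂P,
      f.along δ ζ Y Z s ω = F (s, ω))
    (hF₀ : ∀ᵐ s ∂(volume : Measure ℝ≥0).restrict (Icc 0 T), ∀ᵐ ω ∂P,
      f.atZero δ ζ s ω = F₀ (s, ω)) {t : ℝ≥0} (ht : t ≤ T) :
    ∫⁻ ω, (∫⁻ s in Ioc t T, ENNReal.ofReal ((F (s, ω) - F₀ (s, ω)) ^ 2)) ∂P ≤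
      ((4 * c₁ ^ 2).toNNReal * (1 + L) : ℝ≥0) *
        (∫⁻ ω, (∫⁻ s in Ioc t T, ENNReal.ofReal (Y s ω ^ 2)) ∂P + terminalEnergy S T K Y Z) +
      ((4 * c₂ ^ 2).toNNReal * (1 + L) : ℝ≥0) *
        (∫⁻ ω, (∫⁻ s in Ioc t T, ENNReal.ofReal (S.semiSq s ω (cutoff (T + K) Z s ω))) ∂P +
          terminalEnergy S T K Y Z) := by
  obtain ⟨Y', hY'm, hY'⟩ := hY.exists_version
  have hZm : Measurable fun p : ℝ≥0 × Ω => cutoff (T + K) Z p.1 p.2 :=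
    hZ.measurable_cutoff.mono predictable_le le_rfl
  have hTK : T ≤ T + K := le_self_add
  have hkm : Measurable fun p : ℝ≥0 × Ω => ENNReal.ofReal (Y' p ^ 2) :=
    (hY'm.pow_const 2).ennreal_ofReal
  have hlm : Measurable fun p : ℝ≥0 × Ω =>
      ENNReal.ofReal (S.semiSq p.1 p.2 (cutoff (T + K) Z p.1 p.2)) :=
    (S.measurable_semiSq hZm).ennreal_ofReal
  -- the second moments at fixed times, to which the change of variables bound is applied
  set φ : ℝ≥0 → ℝ≥0∞ := fun s => ∫⁻ ω, ENNReal.ofReal (Y' (s, ω) ^ 2) ∂P with hφ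
  set ψ : ℝ≥0 → ℝ≥0∞ := fun s =>
    ∫⁻ ω, ENNReal.ofReal (S.semiSq s ω (cutoff (T + K) Z s ω)) ∂P with hψ
  have hφm : Measurable φ := hkm.lintegral_prod_right'
  have hψm : Measurable ψ := hlm.lintegral_prod_right'
  have hφY : ∀ s ≤ T + K, ∫⁻ ω, ENNReal.ofReal (Y s ω ^ 2) ∂P = φ s := by
    intro s hs
    refine lintegral_congr_ae ?_
    filter_upwards [hY'] with ω hω
    rw [hω s hs]
  have hψZ : ∀ s ≤ T + K, ∫⁻ ω, ENNReal.ofReal (S.semiSq s ω (Z s ω)) ∂P = ψ s := by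
    intro s hs
    simp only [hψ, cutoff_eq hs]
  have hφswap : ∀ A : Set ℝ≥0, MeasurableSet A → A ⊆ Iic (T + K) →
      ∫⁻ s in A, φ s = ∫⁻ ω, (∫⁻ s in A, ENNReal.ofReal (Y s ω ^ 2)) ∂P := by
    intro A hA hAT
    rw [hφ, lintegral_lintegral_swap hkm.aemeasurable]
    refine lintegral_congr_ae ?_
    filter_upwards [hY'] with ω hω
    refine setLIntegral_congr_fun hA fun s hs => ?_
    simp only [hω s (hAT hs)]
  have hψswap : ∀ A : Set ℝ≥0, ∫⁻ s in A, ψ s =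
      ∫⁻ ω, (∫⁻ s in A, ENNReal.ofReal (S.semiSq s ω (cutoff (T + K) Z s ω))) ∂P := by
    intro A
    rw [hψ, lintegral_lintegral_swap hlm.aemeasurable]
  have hφfin : ∫⁻ s in Icc 0 (T + K), φ s < ∞ := by
    rw [hφswap _ measurableSet_Icc fun s hs => hs.2]
    simpa only [sq_abs] using hY.2.2
  have hψfin : ∫⁻ s in Icc 0 (T + K), ψ s < ∞ := by
    rw [hψswap]
    refine (lintegral_congr fun ω => ?_).trans_lt hZ.2
    refine setLIntegral_congr_fun measurableSet_Icc fun s hs => ?_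
    simp only [cutoff_eq hs.2]
  have hφτ : (∫⁻ s in Icc T (T + K), φ s) ≤ terminalEnergy S T K Y Z := by
    rw [hφswap _ measurableSet_Icc fun s hs => hs.2]
    refine lintegral_mono fun ω => lintegral_mono fun s => ?_
    rw [sq_abs]
    exact le_self_add
  have hψτ : (∫⁻ s in Icc T (T + K), ψ s) ≤ terminalEnergy S T K Y Z := by
    rw [hψswap]
    refine lintegral_mono fun ω => setLIntegral_mono' measurableSet_Icc fun s hs => ?_
    rw [cutoff_eq hs.2]
    exact le_add_self
  have hsub : (volume : Measure ℝ≥0).restrict (Ioc t T) ≤ volume.restrict (Icc 0 T) :=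
    Measure.restrict_mono (Ioc_subset_Icc_self.trans (Icc_subset_Icc_left zero_le)) le_rfl
  have hdm : Measurable fun p : ℝ≥0 × Ω => ENNReal.ofReal ((F p - F₀ p) ^ 2) :=
    ((hFm.sub hF₀m).pow_const 2).ennreal_ofReal
  have hδm : AEMeasurable (fun s => s + δ s) ((volume : Measure ℝ≥0).restrict (Ioc t T)) :=
    ((continuousOn_id.add hδc).aemeasurable measurableSet_Icc).mono_measure hsub
  have hm1 : AEMeasurable (fun s => ENNReal.ofReal (4 * c₁ ^ 2) * (φ s + φ (s + δ s)))
      ((volume : Measure ℝ≥0).restrict (Ioc t T)) :=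
    (hφm.aemeasurable.add (hφm.comp_aemeasurable hδm)).const_mul _
  calc _ = ∫⁻ s in Ioc t T, (∫⁻ ω, ENNReal.ofReal ((F (s, ω) - F₀ (s, ω)) ^ 2) ∂P) :=
        lintegral_lintegral_swap (hdm.comp measurable_swap).aemeasurable
    _ ≤ ∫⁻ s in Ioc t T, (ENNReal.ofReal (4 * c₁ ^ 2) * (φ s + φ (s + δ s)) +
          ENNReal.ofReal (4 * c₂ ^ 2) * (ψ s + ψ (s + ζ s))) := by
        refine lintegral_mono_ae ?_
        filter_upwards [ae_mono hsub hF, ae_mono hsub hF₀, ae_restrict_mem measurableSet_Ioc]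
          with s h1 h2 hs
        have hsT : s ∈ Icc 0 T := ⟨zero_le, hs.2⟩
        have h3 := hf.lintegral_sq_sub_le hc₁ hc₂ hδ hζ hY hZ hsT
        rw [hφY s (hs.2.trans hTK), hφY _ (hδ s hsT), hψZ s (hs.2.trans hTK),
          hψZ _ (hζ s hsT)] at h3
        refine (lintegral_congr_ae ?_).trans_le h3
        filter_upwards [h1, h2] with ω e1 e2
        rw [e1, e2]
    _ = ENNReal.ofReal (4 * c₁ ^ 2) * (∫⁻ s in Ioc t T, (φ s + φ (s + δ s))) +
          ENNReal.ofReal (4 * c₂ ^ 2) * (∫⁻ s in Ioc t T, (ψ s + ψ (s + ζ s))) := by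
        rw [lintegral_add_left' hm1, lintegral_const_mul' _ _ ENNReal.ofReal_ne_top,
          lintegral_const_mul' _ _ ENNReal.ofReal_ne_top]
    _ ≤ ENNReal.ofReal (4 * c₁ ^ 2) * ((1 + L : ℝ≥0) *
            ((∫⁻ s in Ioc t T, φ s) + terminalEnergy S T K Y Z)) +
          ENNReal.ofReal (4 * c₂ ^ 2) * ((1 + L : ℝ≥0) *
            ((∫⁻ s in Ioc t T, ψ s) + terminalEnergy S T K Y Z)) := by
        refine add_le_add (mul_le_mul_right ?_ _) (mul_le_mul_right ?_ _)
        · exact (hδ'.lintegral_add_comp_le hδc ht hφm hφfin).trans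
            (mul_le_mul_right (add_le_add le_rfl hφτ) _)
        · exact (hζ'.lintegral_add_comp_le hζc ht hψm hψfin).trans
            (mul_le_mul_right (add_le_add le_rfl hψτ) _)
    _ = _ := by
        rw [hφswap (Ioc t T) measurableSet_Ioc fun s hs => hs.2.trans hTK, hψswap, ENNReal.coe_mul,
          ENNReal.coe_mul, mul_assoc, mul_assoc]
        rfl

end AnticipatedBSDE

/-! ### The anticipated equation -/

namespace AnticipatedBSDE

variable {N : ℕ} {Ω : Type u} [MeasurableSpace Ω] {P : Measure Ω} {S : MarkovChain N P}
  {T K L : ℝ≥0} {c₁ c₂ : ℝ} {δ ζ : ℝ≥0 → ℝ≥0} {f : Driver N Ω}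
  {Y : ℝ≥0 → Ω → ℝ} {Z : ℝ≥0 → Ω → Fin N → ℝ} {ξ : ℝ≥0 → Ω → ℝ} {η : ℝ≥0 → Ω → Fin N → ℝ}

theorem terminalEnergy_lt_top (hY : S.MemL2 0 (T + K) Y) (hZ : S.MemH2 0 (T + K) Z) :
    terminalEnergy S T K Y Z < ∞ := by
  obtain ⟨Y', hY'm, hY'⟩ := hY.exists_version
  have hkm : Measurable fun p : ℝ≥0 × Ω => ENNReal.ofReal (|Y' p| ^ 2) :=
    ((continuous_abs.measurable.comp hY'm).pow_const 2).ennreal_ofReal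
  have hkm' : Measurable fun ω => ∫⁻ s in Icc 0 (T + K), ENNReal.ofReal (|Y' (s, ω)| ^ 2) :=
    hkm.lintegral_prod_left'
  calc terminalEnergy S T K Y Z ≤ ∫⁻ ω, ((∫⁻ s in Icc 0 (T + K), ENNReal.ofReal (|Y' (s, ω)| ^ 2)) +
          ∫⁻ s in Icc 0 (T + K), ENNReal.ofReal (S.semiSq s ω (Z s ω))) ∂P := by
        refine lintegral_mono_ae ?_
        filter_upwards [hY'] with ω hω
        have hn : Measurable fun s => ENNReal.ofReal (|Y' (s, ω)| ^ 2) :=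
          hkm.comp measurable_prodMk_right
        rw [← lintegral_add_left hn]
        refine (lintegral_mono_set (Icc_subset_Icc_left zero_le)).trans_eq ?_
        refine setLIntegral_congr_fun measurableSet_Icc fun s hs => ?_
        simp only [hω s hs.2]
    _ = ∫⁻ ω, (∫⁻ s in Icc 0 (T + K), ENNReal.ofReal (|Y s ω| ^ 2)) ∂P +
          ∫⁻ ω, (∫⁻ s in Icc 0 (T + K), ENNReal.ofReal (S.semiSq s ω (Z s ω))) ∂P := by
        rw [lintegral_add_left hkm']
        congr 1
        refine lintegral_congr_ae ?_
        filter_upwards [hY'] with ω hω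
        refine setLIntegral_congr_fun measurableSet_Icc fun s hs => ?_
        simp only [hω s hs.2]
    _ < ∞ := ENNReal.add_lt_top.2 ⟨hY.2.2, hZ.2⟩

theorem IsSolution.ae_eq_last (h : IsSolution S T K δ ζ f ξ η Y Z) : ∀ᵐ ω ∂P, Y T ω = ξ T ω :=
  h.terminal_Y.mono fun _ hω => hω T ⟨le_rfl, le_self_add⟩

theorem IsSolution.terminalEnergy_eq (h : IsSolution S T K δ ζ f ξ η Y Z) :
    terminalEnergy S T K Y Z = terminalEnergy S T K ξ η := by
  refine lintegral_congr_ae ?_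
  filter_upwards [h.terminal_Y, h.terminal_Z] with ω h1 h2
  refine setLIntegral_congr_fun measurableSet_Icc fun s hs => ?_
  simp only [h1 s hs, h2 s hs]

/-- Along a given solution the anticipated equation is an equation with a given driver. -/
theorem IsSolution.isLinearSolution [IsProbabilityMeasure P]
    (h : IsSolution S T K δ ζ f ξ η Y Z) (hξ : ∫⁻ ω, ENNReal.ofReal (ξ T ω ^ 2) ∂P < ∞)
    {F : ℝ≥0 × Ω → ℝ} (hFm : Measurable F)
    (hF : ∀ᵐ ω ∂P, ∀ᵐ s ∂(volume : Measure ℝ≥0).restrict (Icc 0 T),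
      f.along δ ζ Y Z s ω = F (s, ω))
    (hFfin : ∫⁻ ω, (∫⁻ s in Ioc 0 T, ENNReal.ofReal (F (s, ω) ^ 2)) ∂P < ∞) :
    IsLinearSolution S T F Y (cutoff (T + K) Z) where
  measurable_Z := h.memH2.measurable_cutoff
  lintegral_Z := by
    refine (lintegral_mono fun ω => ?_).trans_lt h.memH2.2
    refine (setLIntegral_mono_ae' measurableSet_Ioc (Eventually.of_forall fun s hs => ?_)).trans
      (lintegral_mono_set (Ioc_subset_Icc_self.trans (Icc_subset_Icc_right le_self_add)))
    rw [cutoff_eq (hs.2.trans le_self_add)]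
  measurable_F := hFm
  lintegral_F := hFfin
  adapted_Y t ht := (h.memL2.1 t ⟨zero_le, ht.trans le_self_add⟩).measurable
  rcll_Y := h.memL2.2.1.mono fun ω hω => hω.mono le_rfl le_self_add
  lintegral_Y := by
    refine (lintegral_mono fun ω => ?_).trans_lt h.memL2.2.2
    simp only [sq_abs]
    exact lintegral_mono_set (Ioc_subset_Icc_self.trans (Icc_subset_Icc_right le_self_add))
  lintegral_Y_last := by
    refine (lintegral_congr_ae ?_).trans_lt hξ
    filter_upwards [h.ae_eq_last] with ω hω
    rw [hω]
  equation := by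
    filter_upwards [h.equation, h.ae_eq_last, hF] with ω h1 h2 h3 t ht
    have hsub : (volume : Measure ℝ≥0).restrict (Ioc t T) ≤ volume.restrict (Icc 0 T) :=
      Measure.restrict_mono (Ioc_subset_Icc_self.trans (Icc_subset_Icc_left zero_le)) le_rfl
    rw [h1 t ⟨zero_le, ht⟩, ← h2, integral_congr_ae (ae_mono hsub h3),
      MarkovChain.stochInt_congr fun s hs => cutoff_eq (Z := Z) (hs.2.trans le_self_add) ω]

end AnticipatedBSDE

end

theorem mainTheorem3 (c₁ c₂ : ℝ) (hc₁ : 0 < c₁) (hc₂ : 0 < c₂) (L K T : ℝ≥0) :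
    ∃ C : ℝ≥0, 0 < C ∧
      ∀ (N : ℕ) (Ω : Type u) [MeasurableSpace Ω] (P : Measure Ω) [IsProbabilityMeasure P]
        (S : AnticipatedBSDE.MarkovChain N P) (δ ζ : ℝ≥0 → ℝ≥0)
        (f : AnticipatedBSDE.Driver N Ω),
        ContinuousOn δ (Icc 0 T) → ContinuousOn ζ (Icc 0 T) →
        AnticipatedBSDE.DelayBound T K δ → AnticipatedBSDE.DelayBound T K ζ →
        AnticipatedBSDE.DelayChange T K L δ → AnticipatedBSDE.DelayChange T K L ζ →
        f.IsAdmissible S T K δ ζ → f.H1 S T K c₁ c₂ → f.H2 P T δ ζ →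
        ∀ (ξ : ℝ≥0 → Ω → ℝ) (η : ℝ≥0 → Ω → Fin N → ℝ),
          S.MemL2 T (T + K) ξ → S.MemH2 T (T + K) η →
          ∀ (Y : ℝ≥0 → Ω → ℝ) (Z : ℝ≥0 → Ω → Fin N → ℝ),
            AnticipatedBSDE.IsSolution S T K δ ζ f ξ η Y Z →
            ∫⁻ ω, ((⨆ s ∈ Icc 0 T, ENNReal.ofReal (|Y s ω| ^ 2)) +
                ∫⁻ s in Icc 0 T, ENNReal.ofReal (S.semiSq s ω (Z s ω))) ∂P ≤
              C * ∫⁻ ω, (ENNReal.ofReal (|ξ T ω| ^ 2) +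
                (∫⁻ s in Icc T (T + K),
                  (ENNReal.ofReal (|ξ s ω| ^ 2) + ENNReal.ofReal (S.semiSq s ω (η s ω)))) +
                (∫⁻ s in Icc 0 T, ENNReal.ofReal |f.atZero δ ζ s ω|) ^ 2) ∂P := by
  open AnticipatedBSDE in
  -- the constants of `lintegral_sq_driver_sub_le`
  set D₁ : ℝ≥0 := (4 * c₁ ^ 2).toNNReal * (1 + L)
  set D₂ : ℝ≥0 := (4 * c₂ ^ 2).toNNReal * (1 + L)
  have hD₂ : 0 < D₂ := mul_pos (Real.toNNReal_pos.2 (by positivity)) (by positivity)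
  obtain ⟨C, hC0, hC⟩ := IsLinearSolution.exists_const.{u} D₁ D₂ T hD₂
  refine ⟨C, hC0, fun N Ω _ P _ S δ ζ f hδc hζc hδ hζ hδ' hζ' hadm hf hf₀ ξ η hξ hη Y Z h => ?_⟩
  have hξm : Measurable (ξ T) :=
    ((hξ.1 T ⟨le_rfl, le_self_add⟩).mono (S.filtration.le T)).measurable
  rcases eq_or_ne (∫⁻ ω, ENNReal.ofReal (ξ T ω ^ 2) ∂P) ∞ with hξtop | hξfin
  · -- an infinite terminal second moment makes the right-hand side infinite
    have htop : ∫⁻ ω, (ENNReal.ofReal (|ξ T ω| ^ 2) +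
        (∫⁻ s in Icc T (T + K),
          (ENNReal.ofReal (|ξ s ω| ^ 2) + ENNReal.ofReal (S.semiSq s ω (η s ω)))) +
        (∫⁻ s in Icc 0 T, ENNReal.ofReal |f.atZero δ ζ s ω|) ^ 2) ∂P = ∞ := by
      refine top_unique (hξtop.symm.le.trans (lintegral_mono fun ω => ?_))
      rw [sq_abs, add_assoc]
      exact le_self_add
    rw [htop, ENNReal.mul_top (by simpa using hC0.ne')]
    exact le_top
  -- jointly measurable versions of the driver along `(Y, Z)` and at zero
  obtain ⟨F, hFm, hF, hF'⟩ := exists_measurable_version (hadm.2 Y Z h.memL2 h.memH2)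
  obtain ⟨F₀, hF₀m, hF₀, hF₀'⟩ := exists_measurable_version
    (hadm.2 0 0 MarkovChain.memL2_zero MarkovChain.memH2_zero)
  have hq := fun t (ht : t ≤ T) => lintegral_sq_driver_sub_le hf hc₁ hc₂ hδ hζ hδ' hζ' hδc hζc
    h.memL2 h.memH2 hFm hF₀m hF hF₀ ht
  have hτ := terminalEnergy_lt_top h.memL2 h.memH2
  have hΦ : ∫⁻ ω, (∫⁻ s in Ioc 0 T, ENNReal.ofReal (Y s ω ^ 2)) ∂P < ∞ := by
    refine (lintegral_mono fun ω => ?_).trans_lt h.memL2.2.2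
    simp only [sq_abs]
    exact lintegral_mono_set (Ioc_subset_Icc_self.trans (Icc_subset_Icc_right le_self_add))
  have hΨeq : ∫⁻ ω, (∫⁻ s in Ioc 0 T, ENNReal.ofReal (S.semiSq s ω (cutoff (T + K) Z s ω))) ∂P =
      ∫⁻ ω, (∫⁻ s in Icc 0 T, ENNReal.ofReal (S.semiSq s ω (Z s ω))) ∂P := by
    refine lintegral_congr fun ω => ?_
    rw [restrict_Ioc_eq_restrict_Icc]
    refine setLIntegral_congr_fun measurableSet_Icc fun s hs => ?_
    simp only [cutoff_eq (hs.2.trans le_self_add)]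
  have hΨ : ∫⁻ ω, (∫⁻ s in Icc 0 T, ENNReal.ofReal (S.semiSq s ω (Z s ω))) ∂P < ∞ :=
    (lintegral_mono fun ω => lintegral_mono_set
      (Icc_subset_Icc_right le_self_add)).trans_lt h.memH2.2
  have hF₀fin : ∫⁻ ω, (∫⁻ s in Ioc 0 T, ENNReal.ofReal (F₀ (s, ω) ^ 2)) ∂P < ∞ := by
    refine (lintegral_congr_ae ?_).trans_lt hf₀
    filter_upwards [hF₀'] with ω hω
    rw [restrict_Ioc_eq_restrict_Icc]
    refine lintegral_congr_ae ?_
    filter_upwards [hω] with s hs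
    rw [sq_abs]
    exact congrArg (fun x => ENNReal.ofReal (x ^ 2)) hs.symm
  have hm₀ : Measurable fun p => ENNReal.ofReal (F₀ p ^ 2) := (hF₀m.pow_const 2).ennreal_ofReal
  -- the square integrability of the driver along `(Y, Z)` comes from that of the driver at zero
  have hFfin : ∫⁻ ω, (∫⁻ s in Ioc 0 T, ENNReal.ofReal (F (s, ω) ^ 2)) ∂P < ∞ := by
    have hdfin := (hq 0 zero_le).trans_lt (ENNReal.add_lt_top.2
      ⟨ENNReal.mul_lt_top ENNReal.coe_lt_top (ENNReal.add_lt_top.2 ⟨hΦ, hτ⟩),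
        ENNReal.mul_lt_top ENNReal.coe_lt_top (ENNReal.add_lt_top.2 ⟨hΨeq.trans_lt hΨ, hτ⟩)⟩)
    have hm₀' : Measurable fun ω => ∫⁻ s in Ioc 0 T, ENNReal.ofReal (F₀ (s, ω) ^ 2) :=
      hm₀.lintegral_prod_left'
    calc _ ≤ ∫⁻ ω, 2 * ((∫⁻ s in Ioc 0 T, ENNReal.ofReal (F₀ (s, ω) ^ 2)) +
            ∫⁻ s in Ioc 0 T, ENNReal.ofReal ((F (s, ω) - F₀ (s, ω)) ^ 2)) ∂P := by
          refine lintegral_mono fun ω => ?_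
          have hn₀ : Measurable fun s => ENNReal.ofReal (F₀ (s, ω) ^ 2) :=
            hm₀.comp measurable_prodMk_right
          rw [← lintegral_add_left hn₀, ← lintegral_const_mul' _ _ ENNReal.ofNat_ne_top]
          refine lintegral_mono fun s => ?_
          rw [← ENNReal.ofReal_add (sq_nonneg _) (sq_nonneg _), ← ENNReal.ofReal_ofNat,
            ← ENNReal.ofReal_mul (by norm_num)]
          refine ENNReal.ofReal_le_ofReal ?_
          nlinarith [sq_nonneg (F (s, ω) - 2 * F₀ (s, ω))]
      _ = 2 * (∫⁻ ω, (∫⁻ s in Ioc 0 T, ENNReal.ofReal (F₀ (s, ω) ^ 2)) ∂P +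
            ∫⁻ ω, (∫⁻ s in Ioc 0 T, ENNReal.ofReal ((F (s, ω) - F₀ (s, ω)) ^ 2)) ∂P) := by
          rw [lintegral_const_mul' _ _ ENNReal.ofNat_ne_top, lintegral_add_left hm₀']
      _ < ∞ := ENNReal.mul_lt_top (by simp) (ENNReal.add_lt_top.2 ⟨hF₀fin, hdfin⟩)
  have hlin := h.isLinearSolution hξfin.lt_top hFm hF' hFfin
  have key := hC N Ω P S F F₀ Y (cutoff (T + K) Z) _ hlin hF₀m hq
  rw [hΨeq, h.terminalEnergy_eq] at key
  -- the two sides of the estimate in terms of `(Y, Z)` and the driver itself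
  have hsup := (hlin.lintegral_iSup_le hF₀m).1
  have hYξ : ∫⁻ ω, ENNReal.ofReal (Y T ω ^ 2) ∂P = ∫⁻ ω, ENNReal.ofReal (|ξ T ω| ^ 2) ∂P := by
    refine lintegral_congr_ae ?_
    filter_upwards [h.ae_eq_last] with ω hω
    rw [hω, sq_abs]
  have hd : ∀ᵐ ω ∂P, ∫⁻ s in Icc 0 T, ENNReal.ofReal |f.atZero δ ζ s ω| =
      ∫⁻ s in Ioc 0 T, ENNReal.ofReal |F₀ (s, ω)| := by
    filter_upwards [hF₀'] with ω hω
    rw [restrict_Ioc_eq_restrict_Icc]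
    refine lintegral_congr_ae ?_
    filter_upwards [hω] with s hs
    exact congrArg (fun x => ENNReal.ofReal |x|) hs
  have hdm : Measurable fun ω => (∫⁻ s in Ioc 0 T, ENNReal.ofReal |F₀ (s, ω)|) ^ 2 :=
    (IsLinearSolution.measurable_lintegral_abs hF₀m).pow_const 2
  have ham : Measurable fun ω => ENNReal.ofReal (|ξ T ω| ^ 2) :=
    ((continuous_abs.measurable.comp hξm).pow_const 2).ennreal_ofReal
  rw [lintegral_add_left' hsup]
  refine key.trans (mul_le_mul_right (le_of_eq ?_) _)
  have hcongr : ∫⁻ ω, (ENNReal.ofReal (|ξ T ω| ^ 2) +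
      (∫⁻ s in Icc T (T + K),
        (ENNReal.ofReal (|ξ s ω| ^ 2) + ENNReal.ofReal (S.semiSq s ω (η s ω)))) +
      (∫⁻ s in Icc 0 T, ENNReal.ofReal |f.atZero δ ζ s ω|) ^ 2) ∂P =
      ∫⁻ ω, (ENNReal.ofReal (|ξ T ω| ^ 2) +
      (∫⁻ s in Icc T (T + K),
        (ENNReal.ofReal (|ξ s ω| ^ 2) + ENNReal.ofReal (S.semiSq s ω (η s ω)))) +
      (∫⁻ s in Ioc 0 T, ENNReal.ofReal |F₀ (s, ω)|) ^ 2) ∂P := by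
    refine lintegral_congr_ae ?_
    filter_upwards [hd] with ω hω
    rw [hω]
  rw [hcongr, lintegral_add_right _ hdm, lintegral_add_left ham, hYξ, add_right_comm]
  rfl
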